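/- **Languages.** Let $\mathbf V$ be a countable set of random variables. Each $V\in\mathbf V$ has constant symbols $c^V_1,c^V_2,\dots$ (infinitely many; or exactly $c^V_1,\dots,c^V_N$ in the signature of size $N$) and range variables $v_1,v_2,\dots$; $d,d'$ stand for constants or range variables. Base formulas $\delta$ are Boolean combinations of $\top$ and atoms $V=d$. A condition $\kappa$ is $\top$ or a conjunction of literals $V=d$, $\neg V=d$ in which each random variable occurs at most once. Terms are $\mathsf t::=\mathsf P(\delta\mid\kappa)\mid\sum_{v_i}\mathsf t\mid\mathsf t+\mathsf t\mid\mathsf t\cdot\mathsf t$, and formulas are $\varphi::=d\equiv d'$ (same $V$) $\mid\mathsf t\succsim\mathsf t\mid\neg\varphi\mid\varphi\wedge\varphi$. Let $\mathcal L$ be the set of formulas over infinitely many constants, $\mathcal L_N$ that over $N$ constants per variable, and $\mathcal L^{\rm closed},\mathcal L_N^{\rm closed}$ their subsets of formulas without free range variables. Write $\mathsf P(\delta)$ for $\mathsf P(\delta\mid\top)$, $\underline 1$ for $\mathsf P(\top)$, $\underline 0$ for $\mathsf P(\neg\top)$, $\underline n$ for the $n$-fold sum of $\underline1$; $\precsim,\succ,\prec,\approx,\to$,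 etc. are the usual abbreviations. Inequalities containing differences or quotients abbreviate the inequalities obtained by clearing them. **Models.** A model is a structural causal model with endogenous variables $\mathbf V$ and ranges $\mathrm{Val}(V)\subseteq\{1,2,\dots\}$ that is recursive (the structural functions respect a well-order of $\mathbf V$) and measurable (under each finite intervention the joint distribution of $\mathbf V$ is defined), with an interpretation of the constants of each $V$ that maps onto $\mathrm{Val}(V)$. Terms denote elements of $[0,\infty]$ (with $0\cdot\infty=0$), or are undefined if they involve a probability conditional on a null event; $\sum_{v_i}$ sums over all values in $\mathrm{Val}(V)$. $\mathsf t\succsim\mathsf t'$ holds iff both terms are defined and the value of $\mathsf t$ is at least that of $\mathsf t'$. A formula is valid in a model if it holds under all assignments of values to range variables; $\Gamma\vDash\varphi$ over a class of models if $\varphi$ is valid in each member in which all of $\Gamma$ is valid. $\mathcal M^+$ is the class of models in which every nonempty cylinder set (restricting finitely many variables) has positive probability and every range has at least two elements; $\mathcal M^+_{\rm fin}$ and $\mathcal M^+_N$ ($N\ge2$; signature of size $N$) are the subclasses in which every range is finite, respectively has exactly $N$ elements. **Systems.** All instances are taken within the language at hand. $\mathsf{AX}^{\rm closed}$ has modus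 ponens and these axioms. - $\mathsf{AX}_{\rm poly}$: all Boolean tautologies; $\neg(\underline0\succsim\underline1)$; $\mathsf t\succsim\underline 0$; $\mathsf P(\delta\wedge\epsilon)+\mathsf P(\delta\wedge\neg\epsilon)\approx\mathsf P(\delta)$; $\mathsf P(\delta)\approx\mathsf P(\epsilon)$ for propositionally equivalent $\delta,\epsilon$; $\succsim$ is total and transitive; the commutative semiring laws for $+,\cdot,\underline0,\underline1$ up to $\approx$; $\mathsf t\succsim\mathsf s\to\mathsf t+\mathsf r\succsim\mathsf s+\mathsf r$; $(\mathsf t\succsim\mathsf s\wedge\mathsf r\succsim\mathsf q)\to\mathsf t\mathsf r+\mathsf s\mathsf q\succsim\mathsf t\mathsf q+\mathsf s\mathsf r$; and, for $\mathsf r$ without summation operator, $\mathsf t+\mathsf r\succsim\mathsf s+\mathsf r\to\mathsf t\succsim\mathsf s$ and $(\mathsf r\succ\underline0\wedge\mathsf t\mathsf r\succsim\mathsf s\mathsf r)\to\mathsf t\succsim\mathsf s$. - EqReflex: $c\equiv c$. EqReplace: $c\equiv c'\to(\varphi[v/c]\to\varphi[v/c'])$. EqDist: $c\not\equiv c'\to\mathsf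 P(V=c\wedge V=c')\approx\underline0$. - Cond: $\mathsf P(\delta\mid\kappa)\succsim\mathsf t\leftrightarrow\mathsf P(\delta\wedge\kappa)\succsim\mathsf t\cdot\mathsf P(\kappa)$. Pos: $\mathsf P(\kappa)\succ\underline0$. - SumLower: $\bigwedge_{c\ne c'\in S}c\not\equiv c'\to\sum_{v_i}\mathsf t\succsim\sum_{c\in S}\mathsf t[v_i/c]$ for finite sets $S$ of constants of $V$. Its infinitary rules are the following. - Conv: from $\varphi\to\mathsf t-\mathsf s\precsim\underline{1/n}$ for all $n\ge1$ infer $\varphi\to\mathsf t\precsim\mathsf s$. - Unity, for finite $\mathbf X\subseteq\mathbf V$ and rational $q>0$: from $\varphi\to\underline1-\mathsf P(\bigwedge_{X\in\mathbf X}\bigvee_{i\le n}X=c^X_i)\succ\underline q$ for all $n\ge1$ infer $\varphi\to\underline1-\mathsf P(\bigwedge_{X\in\mathbf X}(X=c^X_1\vee\neg X=c^X_1))\succ\underline q$. - SumUpper: from $\varphi\to[E_\Pi\to\mathsf q\cdot\sum_{S\in\Pi}\mathsf t[X=x_i/\bigvee_{c\in S}X=c]+\mathsf s\precsim\mathsf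 r]$ for all $n\ge1$ and all partitions $\Pi$ of $\{c^X_1,\dots,c^X_n\}$ infer $\varphi\to\mathsf q\cdot\sum_{x_i}\mathsf t+\mathsf s\precsim\mathsf r$. Here $E_\Pi$ says that two of these constants are equal if they lie in the same part and unequal otherwise; inside conditions the first constant of $S$ is substituted for $x_i$ instead of the disjunction. $\mathsf{AX}^{\rm closed}_{\rm fin}$ adds the rule Fin: from $\varphi\to\sum_{x_i}\mathsf P(\top)\succsim\underline n$ for all $n\ge1$ infer $\varphi\to\sum_{x_i}\mathsf P(\top)\prec\underline0$. $\mathsf{AX}^{\rm closed}_N$ adds the axioms $\sum_{v_i}\mathsf P(\top)\approx\underline N$. $\mathsf{AX},\mathsf{AX}_{\rm fin},\mathsf{AX}_N$ arise from these by allowing free range variables and adding FreeElim (from $\varphi$ infer $\varphi[v/c]$) and FreeIntro (from $\varphi[v/c]$ for all constants $c$ of $V$ infer $\varphi$). **Theorem.** Let $N\ge2$. Each of the following systems is sound and strongly complete for the given language over the given class, i.e. for every set $\Gamma$ of formulas (possibly infinite) and every formula $\varphi$ of the language, $\Gamma\vdash\varphi$ if and only if $\Gamma\vDash\varphi$: $\mathsf{AX}^{\rm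 closed}$ for $\mathcal L^{\rm closed}$ over $\mathcal M^+$; $\mathsf{AX}^{\rm closed}_{\rm fin}$ for $\mathcal L^{\rm closed}$ over $\mathcal M^+_{\rm fin}$; $\mathsf{AX}^{\rm closed}_N$ for $\mathcal L^{\rm closed}_N$ over $\mathcal M^+_N$; $\mathsf{AX}$ for $\mathcal L$ over $\mathcal M^+$; $\mathsf{AX}_{\rm fin}$ for $\mathcal L$ over $\mathcal M^+_{\rm fin}$; $\mathsf{AX}_N$ for $\mathcal L_N$ over $\mathcal M^+_N$. -/

import Mathlib

open MeasureTheory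
open scoped ENNReal

universe u

namespace ProbSum

/-! ## Signatures and languages -/

/-- The constant symbols `c₁, c₂, …` attached to one random variable, when there are `B` of them
(`B = ⊤`: infinitely many). The constant `c_{i+1}` is represented by the index `i`. -/
abbrev Cst (B : ℕ∞) : Type := {i : ℕ // (i : ℕ∞) < B}

/-- The first `n` constant symbols (all of them, if there are fewer than `n`). -/
def firstCst (B : ℕ∞) (n : ℕ) : Finset (Cst B) :=
  open Classical in Finset.subtype (fun i : ℕ => (i : ℕ∞) < B) (Finset.range n)

/-- Value symbols of one random variable: constants and range variables. -/
inductive Sym (B : ℕ∞) : Type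
  | const (c : Cst B)
  | var (i : ℕ)

/-- Base (event) formulas: Boolean combinations of atoms `X = d`. -/
inductive Base (V : Type u) (B : ℕ∞) : Type u
  | top
  | atom (X : V) (d : Sym B)
  | neg (δ : Base V B)
  | and (δ ε : Base V B)

/-- Literals `X = d` (`pos = true`) and `¬ X = d` (`pos = false`). -/
structure Lit (V : Type u) (B : ℕ∞) : Type u where
  rv : V
  sym : Sym B
  pos : Bool

/-- Conditions: conjunctions of literals in which every random variable occurs at most once; the
empty conjunction is `⊤`. -/
structure Cond (V : Type u) (B : ℕ∞) : Type u where
  lits : List (Lit V B)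
  nodup : (lits.map Lit.rv).Nodup

/-- Probability terms with restricted coefficients: `P(δ | κ)`, `∑_{x_i} t`, `t + s`, `t · s`. -/
inductive Term (V : Type u) (B : ℕ∞) : Type u
  | prob (δ : Base V B) (κ : Cond V B)
  | sum (X : V) (i : ℕ) (t : Term V B)
  | add (t s : Term V B)
  | mul (t s : Term V B)

/-- Formulas: `d ≡ d'` for two symbols of the same random variable, `t ≿ s`, negation and
conjunction. -/
inductive Formula (V : Type u) (B : ℕ∞) : Type u
  | eq (X : V) (d d' : Sym B)
  | ge (t s : Term V B)
  | neg (φ : Formula V B)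
  | and (φ ψ : Formula V B)

variable {V : Type u} {B : ℕ∞}

/-! ### Abbreviations -/

namespace Base

def bot : Base V B := neg top

def or (δ ε : Base V B) : Base V B := neg (and (neg δ) (neg ε))

/-- Finite conjunction. -/
def conj (l : List (Base V B)) : Base V B := l.foldr and top

/-- Finite disjunction. -/
def disj (l : List (Base V B)) : Base V B := l.foldr or bot

/-- Truth value of a base formula under a valuation of the atoms, regarded as independent
propositional letters. -/
def Eval (p : V → Sym B → Prop) : Base V B → Prop
  | top => True
  | atom X d => p X d
  | neg δ => ¬ δ.Eval p
  | and δ ε => δ.Eval p ∧ ε.Eval p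

/-- Propositional equivalence of base formulas. -/
def TautEquiv (δ ε : Base V B) : Prop := ∀ p : V → Sym B → Prop, δ.Eval p ↔ ε.Eval p

end Base

def Lit.toBase (l : Lit V B) : Base V B :=
  match l.pos with
  | true => .atom l.rv l.sym
  | false => .neg (.atom l.rv l.sym)

/-- The condition as a base formula. -/
def Cond.toBase (κ : Cond V B) : Base V B := Base.conj (κ.lits.map Lit.toBase)

/-- The trivial condition `⊤`. -/
def Cond.top : Cond V B := ⟨[], List.nodup_nil⟩

namespace Term

/-- Unconditional probability `P(δ) = P(δ | ⊤)`. -/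
def pr (δ : Base V B) : Term V B := prob δ Cond.top

def zero : Term V B := pr Base.bot

def one : Term V B := pr Base.top

/-- The numeral `n`, a sum of `n` copies of `P(⊤)`. -/
def num : ℕ → Term V B
  | 0 => zero
  | n + 1 => add (num n) one

/-- Finite (informal) sums. -/
def finSum (l : List (Term V B)) : Term V B := l.foldr add zero

/-- Terms without the summation operator. -/
def SumFree : Term V B → Prop
  | prob _ _ => True
  | sum _ _ _ => False
  | add t s => t.SumFree ∧ s.SumFree
  | mul t s => t.SumFree ∧ s.SumFree

end Term

namespace Formula

def imp (φ ψ : Formula V B) : Formula V B := neg (and φ (neg ψ))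

def or (φ ψ : Formula V B) : Formula V B := neg (and (neg φ) (neg ψ))

def iff (φ ψ : Formula V B) : Formula V B := and (imp φ ψ) (imp ψ φ)

/-- `t ≾ s`. -/
def le (t s : Term V B) : Formula V B := ge s t

/-- `t ≻ s`. -/
def gt (t s : Term V B) : Formula V B := and (ge t s) (neg (ge s t))

/-- `t ≈ s`. -/
def approx (t s : Term V B) : Formula V B := and (ge t s) (le t s)

/-- Finite conjunction; the empty one is `1 ≿ 1`. -/
def conj (l : List (Formula V B)) : Formula V B := l.foldr and (ge Term.one Term.one)

/-- Boolean tautologies, formulas `d ≡ d'` and `t ≿ s` being the propositional letters. -/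
def Taut (φ : Formula V B) : Prop :=
  ∀ p : Formula V B → Prop, (∀ ψ, p (neg ψ) ↔ ¬ p ψ) → (∀ ψ χ, p (and ψ χ) ↔ p ψ ∧ p χ) → p φ

end Formula

/-! ### Free variables and substitution -/

def Base.Free (X : V) (i : ℕ) : Base V B → Prop
  | .top => False
  | .atom Y d => Y = X ∧ d = .var i
  | .neg δ => δ.Free X i
  | .and δ ε => δ.Free X i ∨ ε.Free X i

def Cond.Free (X : V) (i : ℕ) (κ : Cond V B) : Prop := ∃ l ∈ κ.lits, l.rv = X ∧ l.sym = .var i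

def Term.Free (X : V) (i : ℕ) : Term V B → Prop
  | .prob δ κ => δ.Free X i ∨ κ.Free X i
  | .sum Y j t => t.Free X i ∧ ¬ (Y = X ∧ j = i)
  | .add t s => t.Free X i ∨ s.Free X i
  | .mul t s => t.Free X i ∨ s.Free X i

def Formula.Free (X : V) (i : ℕ) : Formula V B → Prop
  | .eq Y d d' => Y = X ∧ (d = .var i ∨ d' = .var i)
  | .ge t s => t.Free X i ∨ s.Free X i
  | .neg φ => φ.Free X i
  | .and φ ψ => φ.Free X i ∨ ψ.Free X i

/-- Formulas without free range variables. -/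
def Formula.Closed (φ : Formula V B) : Prop := ∀ X i, ¬ φ.Free X i

open Classical in
/-- Replace the range variable `x_i` of `X` by the constant `c` in a symbol of `Y`. -/
noncomputable def Sym.subst (X : V) (i : ℕ) (c : Cst B) (Y : V) (d : Sym B) : Sym B :=
  if Y = X ∧ d = .var i then .const c else d

open Classical in
/-- Replace the atom `X = x_i` by the base formula `ε`. -/
noncomputable def Base.subst (X : V) (i : ℕ) (ε : Base V B) : Base V B → Base V B
  | .top => .top
  | .atom Y d => if Y = X ∧ d = .var i then ε else .atom Y d
  | .neg δ => .neg (Base.subst X i ε δ)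
  | .and δ δ' => .and (Base.subst X i ε δ) (Base.subst X i ε δ')

noncomputable def Lit.subst (X : V) (i : ℕ) (c : Cst B) (l : Lit V B) : Lit V B :=
  ⟨l.rv, l.sym.subst X i c l.rv, l.pos⟩

/-- Replace the range variable `x_i` by the constant `c` in a condition. -/
noncomputable def Cond.subst (X : V) (i : ℕ) (c : Cst B) (κ : Cond V B) : Cond V B :=
  ⟨κ.lits.map (Lit.subst X i c), by
    have h : (κ.lits.map (Lit.subst X i c)).map Lit.rv = κ.lits.map Lit.rv := by
      rw [List.map_map]; rfl
    rw [h]; exact κ.nodup⟩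

open Classical in
/-- Replace the free occurrences of `X = x_i` in a term: by the base formula `ε` in the event
of a probability, and by the literal `X = c` in a condition (where only literals may stand). -/
noncomputable def Term.subst (X : V) (i : ℕ) (ε : Base V B) (c : Cst B) : Term V B → Term V B
  | .prob δ κ => .prob (Base.subst X i ε δ) (κ.subst X i c)
  | .sum Y j t => if Y = X ∧ j = i then .sum Y j t else .sum Y j (t.subst X i ε c)
  | .add t s => .add (t.subst X i ε c) (s.subst X i ε c)
  | .mul t s => .mul (t.subst X i ε c) (s.subst X i ε c)

/-- `t[x_i / c]`. -/
noncomputable def Term.substC (X : V) (i : ℕ) (c : Cst B) (t : Term V B) : Term V B :=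
  t.subst X i (.atom X (.const c)) c

/-- `φ[x_i / c]`. -/
noncomputable def Formula.substC (X : V) (i : ℕ) (c : Cst B) : Formula V B → Formula V B
  | .eq Y d d' => .eq Y (d.subst X i c Y) (d'.subst X i c Y)
  | .ge t s => .ge (t.substC X i c) (s.substC X i c)
  | .neg φ => .neg (φ.substC X i c)
  | .and φ ψ => .and (φ.substC X i c) (ψ.substC X i c)

/-! ## Structural causal models -/

/-- Structural causal models with endogenous variables `V` whose ranges are sets of positive
integers. The exogenous variables are indexed by `U`, with ranges `UVal`. -/
structure SCM (V : Type u) : Type (u + 1) where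
  Val : V → Set ℕ
  val_pos : ∀ X, ∀ n ∈ Val X, 1 ≤ n
  U : Type u
  UVal : U → Type u
  mU : MeasurableSpace (∀ j, UVal j)
  P : @Measure (∀ j, UVal j) mU
  isProb : IsProbabilityMeasure P
  f : ∀ X, (∀ Y, Val Y) → (∀ j, UVal j) → Val X

namespace SCM

instance (M : SCM V) : MeasurableSpace (∀ j, M.UVal j) := M.mU

/-- The structural functions respect some well-order of the endogenous variables. -/
def Recursive (M : SCM V) : Prop :=
  ∃ r : V → V → Prop, IsWellOrder V r ∧
    ∀ X (v w : ∀ Y, M.Val Y), (∀ Y, r Y X → v Y = w Y) → ∀ e, M.f X v e = M.f X w e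

open Classical in
/-- The intervention that sets every `X ∈ S` to `x X`. -/
noncomputable def intervene (M : SCM V) (S : Finset V) (x : ∀ Y, M.Val Y) : SCM V :=
  { M with f := fun X v e => if X ∈ S then x X else M.f X v e }

/-- `v` solves the structural equations in the exogenous state `e`. -/
def IsSolution (M : SCM V) (e : ∀ j, M.UVal j) (v : ∀ Y, M.Val Y) : Prop :=
  ∀ X, v X = M.f X v e

/-- The exogenous states whose (in a recursive model: unique) solution lies in `E`. -/
def event (M : SCM V) (E : Set (∀ Y, M.Val Y)) : Set (∀ j, M.UVal j) :=
  {e | ∃ v, M.IsSolution e v ∧ v ∈ E}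

/-- The joint distribution of the endogenous variables. -/
noncomputable def prob (M : SCM V) (E : Set (∀ Y, M.Val Y)) : ℝ≥0∞ :=
  M.P (M.event E)

/-- Under every finite intervention the joint distribution of the endogenous variables is
well defined, for the product of the discrete σ-algebras on the ranges. -/
def IsMeasurable (M : SCM V) : Prop :=
  ∀ (S : Finset V) (x : ∀ Y, M.Val Y) (E : Set (∀ Y, M.Val Y)), MeasurableSet E →
    MeasurableSet ((M.intervene S x).event E)

/-- Strict positivity: every nonempty clopen cylinder has nonzero probability. -/
def Positive (M : SCM V) : Prop :=
  ∀ S : ∀ X, Set (M.Val X), (∀ X, (S X).Nonempty) → {X | S X ≠ Set.univ}.Finite →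
    M.prob {v | ∀ X, v X ∈ S X} ≠ 0

end SCM

/-- Models: recursive measurable structural causal models with an interpretation of the constants
that names every element of every range. -/
structure Model (V : Type u) (B : ℕ∞) : Type (u + 1) extends SCM V where
  recursive : toSCM.Recursive
  measurable : toSCM.IsMeasurable
  const : ∀ X, Cst B → Val X
  closedWorld : ∀ X, Function.Surjective (const X)

/-! ## Semantics -/

/-- Assignments of values to the range variables. -/
abbrev Model.Asg (M : Model V B) : Type u := ∀ X, ℕ → M.Val X

open Classical in
/-- The assignment `ι[X, i ↦ n]`. -/
noncomputable def Model.Asg.upd {M : Model V B} (ι : M.Asg) (X : V) (i : ℕ) (n : M.Val X) :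
    M.Asg :=
  Function.update ι X (Function.update (ι X) i n)

def Sym.den (M : Model V B) (ι : M.Asg) (X : V) : Sym B → M.Val X
  | .const c => M.const X c
  | .var i => ι X i

/-- Truth of a base formula at a joint value of the endogenous variables. -/
def Base.Holds (M : Model V B) (ι : M.Asg) (v : ∀ Y, M.Val Y) (δ : Base V B) : Prop :=
  δ.Eval (fun X d => v X = d.den M ι X)

noncomputable def Base.prob (M : Model V B) (ι : M.Asg) (δ : Base V B) : ℝ≥0∞ :=
  M.toSCM.prob {v | δ.Holds M ι v}

/-- The term has a denotation: no probability conditional on a null event occurs in it. -/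
def Term.Defined (M : Model V B) : M.Asg → Term V B → Prop
  | ι, .prob _ κ => κ.toBase.prob M ι ≠ 0
  | ι, .sum X i t => ∀ n : M.Val X, t.Defined M (ι.upd X i n)
  | ι, .add t s => t.Defined M ι ∧ s.Defined M ι
  | ι, .mul t s => t.Defined M ι ∧ s.Defined M ι

/-- The denotation in `[0, ∞]` of a term that has one; here `0 * ∞ = 0`. -/
noncomputable def Term.value (M : Model V B) : M.Asg → Term V B → ℝ≥0∞
  | ι, .prob δ κ => (Base.and δ κ.toBase).prob M ι / κ.toBase.prob M ι
  | ι, .sum X i t => ∑' n : M.Val X, t.value M (ι.upd X i n)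
  | ι, .add t s => t.value M ι + s.value M ι
  | ι, .mul t s => t.value M ι * s.value M ι

def Formula.Sat (M : Model V B) (ι : M.Asg) : Formula V B → Prop
  | .eq X d d' => d.den M ι X = d'.den M ι X
  | .ge t s => t.Defined M ι ∧ s.Defined M ι ∧ s.value M ι ≤ t.value M ι
  | .neg φ => ¬ φ.Sat M ι
  | .and φ ψ => φ.Sat M ι ∧ ψ.Sat M ι

/-- Validity in a model: free range variables are read universally. -/
def Formula.ValidIn (M : Model V B) (φ : Formula V B) : Prop := ∀ ι : M.Asg, φ.Sat M ι

/-- Entailment over a class of models. -/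
def Entails (𝓜 : Set (Model V B)) (Γ : Set (Formula V B)) (φ : Formula V B) : Prop :=
  ∀ M ∈ 𝓜, (∀ γ ∈ Γ, γ.ValidIn M) → φ.ValidIn M

/-- Positive models, all ranges having at least two elements. -/
def PosModels (V : Type u) (B : ℕ∞) : Set (Model V B) :=
  {M | M.toSCM.Positive ∧ ∀ X, (M.Val X).Nontrivial}

/-- Positive models with finite ranges. -/
def PosModelsFin (V : Type u) (B : ℕ∞) : Set (Model V B) :=
  {M | M ∈ PosModels V B ∧ ∀ X, (M.Val X).Finite}

/-- Positive models with ranges of cardinality `N`. -/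
def PosModelsCard (V : Type u) (B : ℕ∞) (N : ℕ) : Set (Model V B) :=
  {M | M ∈ PosModels V B ∧ ∀ X, (M.Val X).encard = N}

/-! ## Deductive systems -/

open Term Formula in
/-- Axiom schemes for polynomial reasoning about probabilities. Values of terms may be infinite,
so the two cancellation schemes cancel only terms without the summation operator. -/
inductive AxPoly : Formula V B → Prop
  | bool (φ) (h : Taut φ) : AxPoly φ
  | nonDeg : AxPoly (neg (ge zero one))
  | nonNeg (t) : AxPoly (ge t zero)
  | additivity (δ ε : Base V B) :
      AxPoly (approx (add (pr (.and δ ε)) (pr (.and δ (.neg ε)))) (pr δ))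
  | dist (δ ε : Base V B) (h : δ.TautEquiv ε) : AxPoly (approx (pr δ) (pr ε))
  | total (t s) : AxPoly (or (ge t s) (ge s t))
  | trans (t s r) : AxPoly (imp (and (ge t s) (ge s r)) (ge t r))
  | addComm (t s) : AxPoly (approx (add t s) (add s t))
  | addAssoc (t s r) : AxPoly (approx (add (add t s) r) (add t (add s r)))
  | addZero (t) : AxPoly (approx (add t zero) t)
  | addMono (t s r) : AxPoly (imp (ge t s) (ge (add t r) (add s r)))
  | addCancel (t s r) (h : r.SumFree) : AxPoly (imp (ge (add t r) (add s r)) (ge t s))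
  | mulComm (t s) : AxPoly (approx (mul t s) (mul s t))
  | mulAssoc (t s r) : AxPoly (approx (mul (mul t s) r) (mul t (mul s r)))
  | mulOne (t) : AxPoly (approx (mul t one) t)
  | mulZero (t) : AxPoly (approx (mul t zero) zero)
  | distrib (t s r) : AxPoly (approx (mul t (add s r)) (add (mul t s) (mul t r)))
  | sub (t s r q) : AxPoly (imp (and (ge t s) (ge r q))
      (ge (add (mul t r) (mul s q)) (add (mul t q) (mul s r))))
  | mulCancel (t s r) (h : r.SumFree) :
      AxPoly (imp (and (gt r zero) (ge (mul t r) (mul s r))) (ge t s))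

/-- `⋀_{c ≠ c' ∈ S} c ≢ c'` for constants of `X`. -/
noncomputable def distinctness (X : V) (S : Finset (Cst B)) : Formula V B :=
  .conj (S.offDiag.toList.map fun p => .neg (.eq X (.const p.1) (.const p.2)))

open Term Formula in
/-- Axiom schemes for equality, conditioning, summation and positivity. -/
inductive Ax : Formula V B → Prop
  | poly (φ) (h : AxPoly φ) : Ax φ
  | eqReflex (X : V) (c : Cst B) : Ax (eq X (.const c) (.const c))
  | eqReplace (X : V) (c c' : Cst B) (i : ℕ) (φ : Formula V B) :
      Ax (imp (eq X (.const c) (.const c')) (imp (φ.substC X i c) (φ.substC X i c')))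
  | eqDist (X : V) (c c' : Cst B) :
      Ax (imp (neg (eq X (.const c) (.const c')))
        (approx (pr (.and (.atom X (.const c)) (.atom X (.const c')))) zero))
  | cond (δ : Base V B) (κ : Cond V B) (t) :
      Ax (iff (ge (prob δ κ) t) (ge (pr (.and δ κ.toBase)) (mul t (pr κ.toBase))))
  | sumLower (X : V) (i : ℕ) (t) (S : Finset (Cst B)) :
      Ax (imp (distinctness X S)
        (ge (sum X i t) (finSum (S.toList.map fun c => t.substC X i c))))
  | pos (κ : Cond V B) : Ax (gt (pr κ.toBase) zero)

open Term Formula in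
/-- The axiom scheme `∑_{x_i} P(⊤) ≈ N`. -/
inductive AxCard (N : ℕ) : Formula V B → Prop
  | mk (X : V) (i : ℕ) : AxCard N (approx (sum X i one) (num N))

/-- `⋀_{X ∈ S} ⋁_{i ≤ n} X = c_i`. -/
noncomputable def coverBase (S : Finset V) (n : ℕ) : Base V B :=
  .conj (S.toList.map fun X =>
    .disj ((firstCst B n).toList.map fun c => .atom X (.const c)))

/-- `⋀_{X ∈ S} (X = c ∨ ¬ X = c)`. -/
noncomputable def trivialBase (S : Finset V) (c : Cst B) : Base V B :=
  .conj (S.toList.map fun X =>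
    .or (.atom X (.const c)) (.neg (.atom X (.const c))))

open Term Formula in
/-- `1 - P(δ) ≻ a / b`, with the difference and the quotient cleared. -/
def deficit (δ : Base V B) (a b : ℕ) : Formula V B :=
  gt (mul (num b) one) (add (num a) (mul (num b) (pr δ)))

open Classical in
/-- Constants of `X` in the same part of the partition are equal, others are not. -/
noncomputable def partitionFormula (X : V) {n : ℕ} (Q : Finpartition (firstCst B n)) :
    Formula V B :=
  .conj ((firstCst B n ×ˢ firstCst B n).toList.map fun p =>
    if ∃ S ∈ Q.parts, p.1 ∈ S ∧ p.2 ∈ S then .eq X (.const p.1) (.const p.2)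
    else .neg (.eq X (.const p.1) (.const p.2)))

/-- `∑_{S ∈ Q} t[X = x_i / ⋁_{c ∈ S} X = c]`; in conditions, where a disjunction may not stand,
the least constant of the part is used. -/
noncomputable def partitionSum (X : V) (i : ℕ) (t : Term V B) {n : ℕ}
    (Q : Finpartition (firstCst B n)) : Term V B :=
  .finSum (Q.parts.attach.toList.map fun S =>
    t.subst X i (.disj (S.1.toList.map fun c => .atom X (.const c)))
      (S.1.min' (Q.nonempty_of_mem_parts S.2)))

open Term Formula in
/-- Derivability from `Γ`, all formulas being taken from `L`, from the axioms `Ax` and the axioms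
in `A`; the rule for finite ranges is available if `fin` holds, the two rules for free variables
if `free` holds. Differences and quotients of terms are cleared:
* the rule `conv` concludes `t - s ≾ 0` from `t - s ≾ 1/n` for all `n ≥ 1`;
* the rule `sumUpper` concludes `∑_{x_i} t ≾ (r - s) / q` from the same bounds for the finite
  partial sums. -/
inductive Deriv (L A : Set (Formula V B)) (fin free : Prop) (Γ : Set (Formula V B)) :
    Formula V B → Prop
  | hyp (φ) (h : φ ∈ Γ) : Deriv L A fin free Γ φ
  | ax (φ) (h : Ax φ) (hL : φ ∈ L) : Deriv L A fin free Γ φ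
  | extra (φ) (h : φ ∈ A) (hL : φ ∈ L) : Deriv L A fin free Γ φ
  | mp (φ ψ) (h : Deriv L A fin free Γ φ) (h' : Deriv L A fin free Γ (imp φ ψ)) :
      Deriv L A fin free Γ ψ
  | conv (φ) (t s : Term V B) (hL : imp φ (le t s) ∈ L)
      (h : ∀ n : ℕ, 1 ≤ n →
        Deriv L A fin free Γ (imp φ (le (mul (num n) t) (add (mul (num n) s) one)))) :
      Deriv L A fin free Γ (imp φ (le t s))
  | unity (φ) (S : Finset V) (a b : ℕ) (ha : 1 ≤ a) (hb : 1 ≤ b) (c : Cst B) (hc : c.1 = 0)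
      (hL : imp φ (deficit (trivialBase S c) a b) ∈ L)
      (h : ∀ n : ℕ, 1 ≤ n → Deriv L A fin free Γ (imp φ (deficit (coverBase S n) a b))) :
      Deriv L A fin free Γ (imp φ (deficit (trivialBase S c) a b))
  | sumUpper (φ) (X : V) (i : ℕ) (t q s r : Term V B)
      (hL : imp φ (le (add (mul q (sum X i t)) s) r) ∈ L)
      (h : ∀ n : ℕ, 1 ≤ n → ∀ Q : Finpartition (firstCst B n),
        Deriv L A fin free Γ
          (imp φ (imp (partitionFormula X Q) (le (add (mul q (partitionSum X i t Q)) s) r)))) :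
      Deriv L A fin free Γ (imp φ (le (add (mul q (sum X i t)) s) r))
  | finite (hfin : fin) (φ) (X : V) (i : ℕ) (hL : imp φ (gt zero (sum X i one)) ∈ L)
      (h : ∀ n : ℕ, 1 ≤ n → Deriv L A fin free Γ (imp φ (ge (sum X i one) (num n)))) :
      Deriv L A fin free Γ (imp φ (gt zero (sum X i one)))
  | freeElim (hfree : free) (φ) (X : V) (i : ℕ) (c : Cst B) (h : Deriv L A fin free Γ φ) :
      Deriv L A fin free Γ (φ.substC X i c)
  | freeIntro (hfree : free) (φ) (X : V) (i : ℕ)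
      (h : ∀ c : Cst B, Deriv L A fin free Γ (φ.substC X i c)) :
      Deriv L A fin free Γ φ

/-- The closed language. -/
def ClosedLang (V : Type u) (B : ℕ∞) : Set (Formula V B) := {φ | φ.Closed}

/-- The language with free range variables. -/
def FullLang (V : Type u) (B : ℕ∞) : Set (Formula V B) := Set.univ

/-- `AX^closed`. -/
def AXclosed (Γ : Set (Formula V ⊤)) (φ : Formula V ⊤) : Prop :=
  Deriv (ClosedLang V ⊤) ∅ False False Γ φ

/-- `AX^closed_fin`. -/
def AXclosedFin (Γ : Set (Formula V ⊤)) (φ : Formula V ⊤) : Prop :=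
  Deriv (ClosedLang V ⊤) ∅ True False Γ φ

/-- `AX^closed_N`. -/
def AXclosedCard (N : ℕ) (Γ : Set (Formula V N)) (φ : Formula V N) : Prop :=
  Deriv (ClosedLang V N) {φ | AxCard N φ} False False Γ φ

/-- `AX`. -/
def AX (Γ : Set (Formula V ⊤)) (φ : Formula V ⊤) : Prop :=
  Deriv (FullLang V ⊤) ∅ False True Γ φ

/-- `AX_fin`. -/
def AXFin (Γ : Set (Formula V ⊤)) (φ : Formula V ⊤) : Prop :=
  Deriv (FullLang V ⊤) ∅ True True Γ φ

/-- `AX_N`. -/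
def AXCard (N : ℕ) (Γ : Set (Formula V N)) (φ : Formula V N) : Prop :=
  Deriv (FullLang V N) {φ | AxCard N φ} False True Γ φ

/-- Soundness: what is derivable from a set of formulas of `L` is entailed by it. -/
def Sound (derives : Set (Formula V B) → Formula V B → Prop) (L : Set (Formula V B))
    (𝓜 : Set (Model V B)) : Prop :=
  ∀ Γ ⊆ L, ∀ φ ∈ L, derives Γ φ → Entails 𝓜 Γ φ

/-- Strong completeness: what is entailed by an arbitrary set of formulas is derivable from it. -/
def StronglyComplete (derives : Set (Formula V B) → Formula V B → Prop) (L : Set (Formula V B))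
    (𝓜 : Set (Model V B)) : Prop :=
  ∀ Γ ⊆ L, ∀ φ ∈ L, Entails 𝓜 Γ φ → derives Γ φ

end ProbSum

/-!
# Soundness and strong completeness of probability logics with summation

In a positive model every condition has positive probability, so every term is defined, and
soundness is a direct check: `Deriv.validIn`. The rule for upper bounds of sums is sound because
the partition of the first `n` constants according to their interpretation is one of the partitions
of the premises, and the corresponding partial sums exhaust the sum over the range.

For completeness (`deriv_of_entails_closed`), let the closed formula `φ` not be derivable from `Γ`.
The language is countable, so there are countably many instances of the infinitary rules, and the
Rasiowa–Sikorski lemma yields a complete theory that contains `Γ` and not `φ` and is closed under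
all of them: `exists_completeTheory`. The infinitary rules carry an arbitrary hypothesis in front of
their inequality, so no deduction theorem is needed here.

Closed terms modulo the equalities of the theory form a linearly ordered semiring. By the rule
`conv` it is Archimedean, and the axioms and the rule for upper bounds of sums show that all elements
above every numeral coincide (`CompleteTheory.val_finite_or_top`): an infinite sum of finite terms
absorbs its own multiples and its square, because only finite partial sums have to be compared with
it. Hence the semiring embeds into `[0, ∞]`, by `ArchimedeanSemiring.toENNReal`. The value of a sum is
the supremum of the values of its finite partial sums (`CompleteTheory.num_sum_eq_iSup`); here the
events `⋁_{c ∈ S} X = c` of the rule have to be replaced by `X = c` for a single constant of the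
part, which `CompleteTheory.replaceable` justifies by induction on terms.

The values of the probabilities `P(δ)` form a finitely additive function on the clopen subsets of
the space of truth assignments to the atoms `X = c`. This space is compact, so the function extends
to a measure. By the axioms for equality and the rule `unity`, almost every truth assignment makes
`X = c` true for exactly one class of constants `c`, for each `X` (`CompleteTheory.ae_regular`). The
canonical model takes a random truth assignment as its only exogenous variable and lets the
structural functions read off the values; by `CompleteTheory.sat_canonicalModel_iff` it satisfies
exactly the formulas of the theory.

With free range variables, `freeElim` derives all closed instances of the premises, and `freeIntro`
recovers a formula from its closed instances, which reduces the general case to the closed one: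
`deriv_of_entails`.
-/

set_option linter.unusedSectionVars false

namespace ProbSum

variable {V : Type u} {B : ℕ∞}

/-! ### Solutions and the joint distribution -/

theorem SCM.Recursive.existsUnique_isSolution {M : SCM V} (h : M.Recursive)
    [∀ X, Nonempty (M.Val X)] (e : ∀ j, M.UVal j) : ∃! v, M.IsSolution e v := by
  classical
  obtain ⟨r, hr, h⟩ := h
  have wf : WellFounded r := IsWellFounded.wf
  let d : ∀ Y, M.Val Y := fun Y => Classical.arbitrary _
  let g : ∀ X, M.Val X :=
    wf.fix (fun X ih => M.f X (fun Y => if hY : r Y X then ih Y hY else d Y) e)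
  have hg : M.IsSolution e g := by
    intro X
    have hX : g X = M.f X (fun Y => if r Y X then g Y else d Y) e := wf.fix_eq _ X
    rw [hX]
    apply h
    intro Y hY
    simp [hY]
  refine ⟨g, hg, fun w hw => ?_⟩
  funext X
  induction X using wf.induction with
  | _ X ih => rw [hw X, hg X]; exact h X _ _ (fun Y hY => ih Y hY) e

theorem SCM.event_intervene_empty (M : SCM V) (x : ∀ Y, M.Val Y) (E : Set (∀ Y, M.Val Y)) :
    (M.intervene ∅ x).event E = M.event E := by
  simp [SCM.event, SCM.IsSolution, SCM.intervene]
  rfl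

namespace Model

variable [Nonempty (Cst B)] (M : Model V B)

instance (X : V) : Nonempty (M.Val X) := ⟨M.const X (Classical.arbitrary _)⟩

theorem existsUnique_isSolution (e : ∀ j, M.UVal j) : ∃! v, M.IsSolution e v :=
  M.recursive.existsUnique_isSolution e

/-- The solution of the structural equations in an exogenous state. -/
noncomputable def sol (e : ∀ j, M.UVal j) : ∀ Y, M.Val Y :=
  (M.existsUnique_isSolution e).choose

theorem event_eq (E : Set (∀ Y, M.Val Y)) : M.event E = M.sol ⁻¹' E := by
  ext e
  have h := (M.existsUnique_isSolution e).choose_spec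
  constructor
  · rintro ⟨v, hv, hE⟩
    change (M.existsUnique_isSolution e).choose ∈ E
    rwa [← h.2 v hv]
  · intro hE
    exact ⟨M.sol e, h.1, hE⟩

theorem measurable_sol : Measurable M.sol := by
  intro E hE
  have h := M.measurable ∅ (fun _ => Classical.arbitrary _) E hE
  rwa [SCM.event_intervene_empty, event_eq] at h

/-- The joint distribution of the endogenous variables, as a measure. -/
noncomputable def law : Measure (∀ Y, M.Val Y) := M.P.map M.sol

instance : IsProbabilityMeasure M.law :=
  haveI := M.isProb
  Measure.isProbabilityMeasure_map M.measurable_sol.aemeasurable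

theorem prob_eq_law {E : Set (∀ Y, M.Val Y)} (hE : MeasurableSet E) : M.prob E = M.law E := by
  rw [law, Measure.map_apply M.measurable_sol hE, ← event_eq]
  rfl

end Model

/-! ### Evaluation of base formulas -/

namespace Base

variable (p : V → Sym B → Prop)

@[simp] theorem eval_top : (top : Base V B).Eval p ↔ True := Iff.rfl
@[simp] theorem eval_atom (X : V) (d : Sym B) : (atom X d).Eval p ↔ p X d := Iff.rfl
@[simp] theorem eval_neg (δ : Base V B) : (neg δ).Eval p ↔ ¬ δ.Eval p := Iff.rfl
@[simp] theorem eval_and (δ ε : Base V B) : (and δ ε).Eval p ↔ δ.Eval p ∧ ε.Eval p := Iff.rfl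
@[simp] theorem eval_bot : ¬ (bot : Base V B).Eval p := by simp [bot]
@[simp] theorem eval_or (δ ε : Base V B) : (or δ ε).Eval p ↔ δ.Eval p ∨ ε.Eval p := by
  simp [or]; tauto

@[simp] theorem eval_conj (l : List (Base V B)) : (conj l).Eval p ↔ ∀ δ ∈ l, δ.Eval p := by
  induction l with
  | nil => simp [conj]
  | cons a l ih =>
    have h : (conj (a :: l)).Eval p ↔ a.Eval p ∧ (conj l).Eval p := Iff.rfl
    rw [h, ih]
    simp

@[simp] theorem eval_disj (l : List (Base V B)) : (disj l).Eval p ↔ ∃ δ ∈ l, δ.Eval p := by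
  induction l with
  | nil => simp [disj]
  | cons a l ih =>
    have h : (disj (a :: l)) = or a (disj l) := rfl
    rw [h, eval_or, ih]
    simp

end Base

theorem Lit.eval_toBase (l : Lit V B) (p : V → Sym B → Prop) :
    l.toBase.Eval p ↔ (l.pos = true ↔ p l.rv l.sym) := by
  unfold Lit.toBase
  split <;> simp_all

/-! ### Probabilities of base formulas in a model -/

section Semantics

variable [Nonempty (Cst B)] {M : Model V B}

theorem Base.measurableSet_holds (ι : M.Asg) (δ : Base V B) :
    MeasurableSet {v | δ.Holds M ι v} := by
  induction δ with
  | top => exact MeasurableSet.univ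
  | atom X d => exact measurable_pi_apply (X := fun Y => M.Val Y) X (.singleton (d.den M ι X))
  | neg δ ih => exact ih.compl
  | and δ ε ih ih' => exact ih.inter ih'

theorem Base.prob_eq_law (ι : M.Asg) (δ : Base V B) :
    δ.prob M ι = M.law {v | δ.Holds M ι v} :=
  M.prob_eq_law (δ.measurableSet_holds ι)

theorem Base.prob_le_one (ι : M.Asg) (δ : Base V B) : δ.prob M ι ≤ 1 := by
  rw [Base.prob_eq_law]
  exact MeasureTheory.prob_le_one

theorem Base.prob_ne_top (ι : M.Asg) (δ : Base V B) : δ.prob M ι ≠ ∞ :=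
  ((Base.prob_le_one ι δ).trans_lt ENNReal.one_lt_top).ne

theorem Base.prob_congr {ι κ : M.Asg} {δ ε : Base V B}
    (h : ∀ v, δ.Holds M ι v ↔ ε.Holds M κ v) : δ.prob M ι = ε.prob M κ := by
  unfold Base.prob
  simp_rw [h]

theorem Base.prob_top (ι : M.Asg) : (Base.top : Base V B).prob M ι = 1 := by
  rw [Base.prob_eq_law]
  exact measure_univ

theorem Base.prob_and_add_prob_and_neg (ι : M.Asg) (δ ε : Base V B) :
    (Base.and δ ε).prob M ι + (Base.and δ (.neg ε)).prob M ι = δ.prob M ι := by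
  simp_rw [Base.prob_eq_law]
  exact measure_inter_add_sdiff _ (ε.measurableSet_holds ι)

theorem Base.prob_eq_zero {ι : M.Asg} {δ : Base V B} (h : ∀ v, ¬ δ.Holds M ι v) :
    δ.prob M ι = 0 := by
  rw [Base.prob_eq_law]
  simp [h]

@[simp] theorem Term.value_pr (ι : M.Asg) (δ : Base V B) :
    (Term.pr δ).value M ι = δ.prob M ι := by
  have h : (Cond.top : Cond V B).toBase.prob M ι = 1 := Base.prob_top ι
  rw [Term.pr, Term.value, h, div_one]
  exact Base.prob_congr fun v => by simp [Base.Holds, Cond.top, Cond.toBase]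

@[simp] theorem Term.value_zero (ι : M.Asg) : (Term.zero : Term V B).value M ι = 0 := by
  rw [Term.zero, Term.value_pr]
  exact Base.prob_eq_zero fun v => Base.eval_bot _

@[simp] theorem Term.value_one (ι : M.Asg) : (Term.one : Term V B).value M ι = 1 := by
  rw [Term.one, Term.value_pr, Base.prob_top]

@[simp] theorem Term.value_add (ι : M.Asg) (t s : Term V B) :
    (Term.add t s).value M ι = t.value M ι + s.value M ι := rfl

@[simp] theorem Term.value_mul (ι : M.Asg) (t s : Term V B) :
    (Term.mul t s).value M ι = t.value M ι * s.value M ι := rfl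

@[simp] theorem Term.value_num (ι : M.Asg) (n : ℕ) :
    (Term.num n : Term V B).value M ι = n := by
  induction n with
  | zero => simp [Term.num]
  | succ n ih => simp [Term.num, ih]

theorem Term.value_finSum (ι : M.Asg) (l : List (Term V B)) :
    (Term.finSum l).value M ι = (l.map fun t => t.value M ι).sum := by
  induction l with
  | nil => simp [Term.finSum]
  | cons a l ih =>
    have h : Term.finSum (a :: l) = .add a (Term.finSum l) := rfl
    simp [h, ih]

/-- In a positive model every condition has positive probability. -/
theorem Cond.prob_ne_zero (hM : M ∈ PosModels V B) (ι : M.Asg) (κ : Cond V B) :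
    κ.toBase.prob M ι ≠ 0 := by
  let S : ∀ X, Set (M.Val X) := fun X =>
    {x | ∀ l ∈ κ.lits, l.rv = X → (l.pos = true ↔ x = l.sym.den M ι X)}
  have hS : {v | κ.toBase.Holds M ι v} = {v | ∀ X, v X ∈ S X} := by
    ext v
    simp only [Base.Holds, Cond.toBase, Base.eval_conj, List.mem_map, forall_exists_index, and_imp,
      forall_apply_eq_imp_iff₂, Lit.eval_toBase, Set.mem_ofPred_eq, S]
    constructor
    · rintro h X l hl rfl
      exact h l hl
    · intro h l hl
      exact h _ l hl rfl
  unfold Base.prob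
  rw [hS]
  refine hM.1 S (fun X => ?_) ?_
  · by_cases h : ∃ l ∈ κ.lits, l.rv = X
    · obtain ⟨l, hl, rfl⟩ := h
      have huniq : ∀ l' ∈ κ.lits, l'.rv = l.rv → l' = l := fun l' hl' h =>
        List.inj_on_of_nodup_map κ.nodup hl' hl h
      cases hp : l.pos with
      | true =>
        refine ⟨l.sym.den M ι l.rv, fun l' hl' h => ?_⟩
        obtain rfl := huniq l' hl' h
        simp [hp]
      | false =>
        obtain ⟨y, hy, hne⟩ := (hM.2 l.rv).exists_ne (l.sym.den M ι l.rv : ℕ)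
        refine ⟨⟨y, hy⟩, fun l' hl' h => ?_⟩
        obtain rfl := huniq l' hl' h
        simp only [hp, Bool.false_eq_true, false_iff]
        intro h'
        exact hne (congrArg Subtype.val h')
    · exact ⟨Classical.arbitrary _, fun l hl hX => absurd ⟨l, hl, hX⟩ h⟩
  · refine (κ.lits.map Lit.rv).finite_toSet.subset fun X hX => ?_
    by_contra h
    refine hX (Set.eq_univ_of_forall fun x l hl hlX => absurd ?_ h)
    exact List.mem_map.2 ⟨l, hl, hlX⟩

theorem Term.defined (hM : M ∈ PosModels V B) (ι : M.Asg) (t : Term V B) : t.Defined M ι := by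
  induction t generalizing ι with
  | prob δ κ => exact κ.prob_ne_zero hM ι
  | sum X i t ih => exact fun n => ih _
  | add t s ih ih' => exact ⟨ih _, ih' _⟩
  | mul t s ih ih' => exact ⟨ih _, ih' _⟩

theorem Term.value_prob_ne_top (hM : M ∈ PosModels V B) (ι : M.Asg) (δ : Base V B)
    (κ : Cond V B) : (Term.prob δ κ).value M ι ≠ ∞ :=
  ENNReal.div_ne_top (Base.prob_ne_top _ _) (κ.prob_ne_zero hM ι)

theorem Term.SumFree.value_ne_top (hM : M ∈ PosModels V B) (ι : M.Asg) {t : Term V B}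
    (ht : t.SumFree) : t.value M ι ≠ ∞ := by
  induction t with
  | prob δ κ => exact Term.value_prob_ne_top hM ι δ κ
  | sum X i t ih => exact ht.elim
  | add t s ih ih' => exact ENNReal.add_ne_top.2 ⟨ih ht.1, ih' ht.2⟩
  | mul t s ih ih' => exact ENNReal.mul_ne_top (ih ht.1) (ih' ht.2)

/-! ### Truth of abbreviated formulas -/

section Sat

variable (ι : M.Asg)

@[simp] theorem Formula.sat_neg (φ : Formula V B) : (Formula.neg φ).Sat M ι ↔ ¬ φ.Sat M ι := Iff.rfl

@[simp] theorem Formula.sat_and (φ ψ : Formula V B) :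
    (Formula.and φ ψ).Sat M ι ↔ φ.Sat M ι ∧ ψ.Sat M ι := Iff.rfl

@[simp] theorem Formula.sat_eq (X : V) (d d' : Sym B) :
    (Formula.eq X d d').Sat M ι ↔ d.den M ι X = d'.den M ι X := Iff.rfl

@[simp] theorem Formula.sat_imp (φ ψ : Formula V B) :
    (Formula.imp φ ψ).Sat M ι ↔ (φ.Sat M ι → ψ.Sat M ι) := by
  simp [Formula.imp]

@[simp] theorem Formula.sat_or (φ ψ : Formula V B) :
    (Formula.or φ ψ).Sat M ι ↔ (φ.Sat M ι ∨ ψ.Sat M ι) := by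
  simp [Formula.or]; tauto

@[simp] theorem Formula.sat_iff (φ ψ : Formula V B) :
    (Formula.iff φ ψ).Sat M ι ↔ (φ.Sat M ι ↔ ψ.Sat M ι) := by
  simp [Formula.iff]; tauto

variable (hM : M ∈ PosModels V B)
include hM

theorem Formula.sat_ge (t s : Term V B) :
    (Formula.ge t s).Sat M ι ↔ s.value M ι ≤ t.value M ι := by
  simp [Formula.Sat, Term.defined hM]

theorem Formula.sat_le (t s : Term V B) :
    (Formula.le t s).Sat M ι ↔ t.value M ι ≤ s.value M ι :=
  Formula.sat_ge ι hM s t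

theorem Formula.sat_gt (t s : Term V B) :
    (Formula.gt t s).Sat M ι ↔ s.value M ι < t.value M ι := by
  simp only [Formula.gt, sat_and, sat_neg, Formula.sat_ge ι hM, lt_iff_le_not_ge]

theorem Formula.sat_approx (t s : Term V B) :
    (Formula.approx t s).Sat M ι ↔ t.value M ι = s.value M ι := by
  simp only [Formula.approx, sat_and, Formula.sat_le ι hM, Formula.sat_ge ι hM, le_antisymm_iff,
    and_comm]

theorem Formula.sat_conj (l : List (Formula V B)) :
    (Formula.conj l).Sat M ι ↔ ∀ φ ∈ l, φ.Sat M ι := by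
  induction l with
  | nil => simp [Formula.conj, Formula.sat_ge ι hM]
  | cons a l ih =>
    have h : Formula.conj (a :: l) = .and a (Formula.conj l) := rfl
    simp [h, ih]

theorem Formula.sat_distinctness (X : V) (S : Finset (Cst B)) :
    (distinctness X S).Sat M ι ↔ Set.InjOn (M.const X) S := by
  rw [distinctness, Formula.sat_conj ι hM]
  simp only [List.mem_map, Finset.mem_toList, Finset.mem_offDiag, forall_exists_index, and_imp,
    Prod.forall, Set.InjOn, Finset.mem_coe]
  constructor
  · intro h c hc c' hc' he
    by_contra hne
    exact h _ c c' hc hc' hne rfl he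
  · rintro h _ c c' hc hc' hne rfl he
    exact hne (h hc hc' he)

theorem Formula.sat_partitionFormula (X : V) {n : ℕ} (Q : Finpartition (firstCst B n)) :
    (partitionFormula X Q).Sat M ι ↔ ∀ c ∈ firstCst B n, ∀ c' ∈ firstCst B n,
      (M.const X c = M.const X c' ↔ ∃ S ∈ Q.parts, c ∈ S ∧ c' ∈ S) := by
  rw [partitionFormula, Formula.sat_conj ι hM]
  simp only [List.mem_map, Finset.mem_toList, Finset.mem_product, Prod.exists, forall_exists_index,
    and_imp]
  constructor
  · intro h c hc c' hc'
    have := h _ c c' hc hc' rfl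
    split_ifs at this with h' <;> simp_all [Sym.den]
  · rintro h _ c c' hc hc' rfl
    have := h c hc c' hc'
    split_ifs with h' <;> simp_all [Sym.den]

theorem Formula.sat_deficit (δ : Base V B) (a b : ℕ) :
    (deficit δ a b).Sat M ι ↔ (a : ℝ≥0∞) + b * δ.prob M ι < b := by
  simp [deficit, Formula.sat_gt ι hM]

end Sat

/-! ### Substitution -/

section Subst

theorem Model.Asg.upd_same (ι : M.Asg) (X : V) (i : ℕ) (n : M.Val X) : ι.upd X i n X i = n := by
  simp [Model.Asg.upd]

theorem Model.Asg.upd_of_ne (ι : M.Asg) {X Y : V} {i j : ℕ} (n : M.Val X)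
    (h : ¬ (Y = X ∧ j = i)) : ι.upd X i n Y j = ι Y j := by
  unfold Model.Asg.upd
  by_cases hY : Y = X
  · subst hY
    have : j ≠ i := fun hj => h ⟨rfl, hj⟩
    simp [this]
  · simp [hY]

theorem Model.Asg.upd_upd_same (ι : M.Asg) (X : V) (i : ℕ) (m n : M.Val X) :
    (ι.upd X i m).upd X i n = ι.upd X i n := by
  simp [Model.Asg.upd]

theorem Model.Asg.upd_comm (ι : M.Asg) {X Y : V} {i j : ℕ} (m : M.Val X) (n : M.Val Y)
    (h : ¬ (Y = X ∧ j = i)) :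
    (ι.upd X i m).upd Y j n = (ι.upd Y j n).upd X i m := by
  funext Z k
  by_cases hX : Z = X ∧ k = i
  · obtain ⟨rfl, rfl⟩ := hX
    rw [Model.Asg.upd_same, Model.Asg.upd_of_ne _ _ (fun h' => h ⟨h'.1.symm, h'.2.symm⟩),
      Model.Asg.upd_same]
  · by_cases hY : Z = Y ∧ k = j
    · obtain ⟨rfl, rfl⟩ := hY
      rw [Model.Asg.upd_same, Model.Asg.upd_of_ne _ _ h, Model.Asg.upd_same]
    · rw [Model.Asg.upd_of_ne _ _ hY, Model.Asg.upd_of_ne _ _ hX, Model.Asg.upd_of_ne _ _ hX,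
        Model.Asg.upd_of_ne _ _ hY]

theorem Sym.den_subst (ι : M.Asg) (X : V) (i : ℕ) (c : Cst B) (Y : V) (d : Sym B) :
    (d.subst X i c Y).den M ι Y = d.den M (ι.upd X i (M.const X c)) Y := by
  unfold Sym.subst
  split_ifs with h
  · obtain ⟨rfl, rfl⟩ := h
    simp [Sym.den, Model.Asg.upd_same]
  · cases d with
    | const c => rfl
    | var j =>
      have h' : ¬ (Y = X ∧ j = i) := fun h' => h ⟨h'.1, by rw [h'.2]⟩
      simp [Sym.den, Model.Asg.upd_of_ne _ _ h']

theorem Base.holds_subst (ι : M.Asg) (X : V) (i : ℕ) (c : Cst B) (ε : Base V B)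
    (hε : ∀ v, ε.Holds M ι v ↔ v X = M.const X c) (v : ∀ Y, M.Val Y) (δ : Base V B) :
    (Base.subst X i ε δ).Holds M ι v ↔ δ.Holds M (ι.upd X i (M.const X c)) v := by
  induction δ with
  | top => exact Iff.rfl
  | atom Y d =>
    unfold Base.subst
    split_ifs with h
    · obtain ⟨rfl, rfl⟩ := h
      rw [hε]
      simp [Base.Holds, Sym.den, Model.Asg.upd_same]
    · have := Sym.den_subst ι X i c Y d
      rw [Sym.subst, if_neg h] at this
      simp [Base.Holds, this]
  | neg δ ih => exact not_congr ih
  | and δ δ' ih ih' => exact and_congr ih ih'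

theorem Cond.holds_subst (ι : M.Asg) (X : V) (i : ℕ) (c : Cst B) (v : ∀ Y, M.Val Y)
    (κ : Cond V B) :
    (κ.subst X i c).toBase.Holds M ι v ↔ κ.toBase.Holds M (ι.upd X i (M.const X c)) v := by
  simp only [Base.Holds, Cond.toBase, Cond.subst, Base.eval_conj, List.map_map, List.mem_map,
    forall_exists_index, and_imp, forall_apply_eq_imp_iff₂, Function.comp_apply, Lit.eval_toBase]
  simp only [Lit.subst, Sym.den_subst]

/-- Substituting for `x_i` an event that means `X = c` amounts to assigning to `x_i` the value of
the constant `c`. -/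
theorem Term.value_subst (X : V) (i : ℕ) (c : Cst B) (ε : Base V B)
    (hε : ∀ (ι : M.Asg) v, ε.Holds M ι v ↔ v X = M.const X c) (t : Term V B) (ι : M.Asg) :
    (t.subst X i ε c).value M ι = t.value M (ι.upd X i (M.const X c)) := by
  induction t generalizing ι with
  | prob δ κ =>
    have h : ∀ v, (κ.subst X i c).toBase.Holds M ι v ↔ _ := fun v => κ.holds_subst ι X i c v
    simp only [Term.subst, Term.value]
    rw [Base.prob_congr h, Base.prob_congr (ε := Base.and δ κ.toBase)
      (κ := ι.upd X i (M.const X c))]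
    exact fun v => and_congr (Base.holds_subst ι X i c ε (hε ι) v δ) (h v)
  | sum Y j t ih =>
    unfold Term.subst
    split_ifs with h
    · obtain ⟨rfl, rfl⟩ := h
      simp only [Term.value, Model.Asg.upd_upd_same]
    · simp only [Term.value, ih]
      simp_rw [Model.Asg.upd_comm ι (M.const X c) _ h]
  | add t s ih ih' => simp only [Term.subst, Term.value, ih, ih']
  | mul t s ih ih' => simp only [Term.subst, Term.value, ih, ih']

theorem Term.value_substC (X : V) (i : ℕ) (c : Cst B) (t : Term V B) (ι : M.Asg) :
    (t.substC X i c).value M ι = t.value M (ι.upd X i (M.const X c)) :=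
  Term.value_subst X i c _ (fun _ _ => Iff.rfl) t ι

theorem Formula.sat_substC (hM : M ∈ PosModels V B) (X : V) (i : ℕ) (c : Cst B)
    (φ : Formula V B) (ι : M.Asg) :
    (φ.substC X i c).Sat M ι ↔ φ.Sat M (ι.upd X i (M.const X c)) := by
  induction φ with
  | eq Y d d' => simp [Formula.substC, Sym.den_subst]
  | ge t s => simp [Formula.substC, Formula.sat_ge _ hM, Term.value_substC]
  | neg φ ih => exact not_congr ih
  | and φ ψ ih ih' => exact and_congr ih ih'

theorem Formula.validIn_substC_iff (hM : M ∈ PosModels V B) (X : V) (i : ℕ) (φ : Formula V B) :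
    (∀ c, (φ.substC X i c).ValidIn M) ↔ φ.ValidIn M := by
  constructor
  · intro h ι
    obtain ⟨c, hc⟩ := M.closedWorld X (ι X i)
    have := (Formula.sat_substC hM X i c φ ι).1 (h c ι)
    rwa [hc, show ι.upd X i (ι X i) = ι by simp [Model.Asg.upd]] at this
  · intro h c ι
    exact (Formula.sat_substC hM X i c φ ι).2 (h _)

end Subst

end Semantics

/-! ### Soundness -/

theorem mem_firstCst {n : ℕ} {c : Cst B} : c ∈ firstCst B n ↔ c.1 < n := by
  simp [firstCst]

theorem exists_subset_firstCst (F : Finset (Cst B)) : ∃ n, 1 ≤ n ∧ F ⊆ firstCst B n := by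
  refine ⟨F.sup (fun c => c.1) + 1, by omega, fun c hc => mem_firstCst.2 ?_⟩
  exact Nat.lt_succ_of_le (Finset.le_sup (f := fun c : Cst B => c.1) hc)

/-- The partition of the first constants into the classes of an equivalence relation. -/
theorem exists_finpartition (r : Setoid (Cst B)) (n : ℕ) :
    ∃ Q : Finpartition (firstCst B n), ∀ c ∈ firstCst B n, ∀ c' ∈ firstCst B n,
      (∃ S ∈ Q.parts, c ∈ S ∧ c' ∈ S) ↔ r c c' := by
  classical
  refine ⟨Finpartition.ofSetSetoid r _, fun c hc c' hc' => ?_⟩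
  have h := Finpartition.mem_part_ofSetSetoid_iff_rel (s := r) (firstCst B n) (a := c) (b := c')
  simp only [hc, hc', true_and] at h
  rw [← h, Finpartition.mem_part_iff_exists]
  tauto

section

variable [Nonempty (Cst B)] {M : Model V B}

theorem Formula.Taut.validIn {φ : Formula V B} (h : φ.Taut) : φ.ValidIn M :=
  fun ι => h (fun ψ => ψ.Sat M ι) (fun _ => Iff.rfl) (fun _ _ => Iff.rfl)

variable (hM : M ∈ PosModels V B)
include hM

open Term Formula in
theorem AxPoly.validIn {φ : Formula V B} (h : AxPoly φ) : φ.ValidIn M := by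
  intro ι
  cases h with
  | bool _ h => exact h.validIn ι
  | nonDeg => simp [sat_ge ι hM]
  | nonNeg t => simp [sat_ge ι hM]
  | additivity δ ε => simp [sat_approx ι hM, Base.prob_and_add_prob_and_neg]
  | dist δ ε h =>
    rw [sat_approx ι hM, value_pr, value_pr]
    exact Base.prob_congr fun v => h _
  | total t s => simp [sat_ge ι hM, le_total]
  | trans t s r => simpa [sat_ge ι hM] using fun h h' => le_trans h' h
  | addComm t s => simp [sat_approx ι hM, add_comm]
  | addAssoc t s r => simp [sat_approx ι hM, add_assoc]
  | addZero t => simp [sat_approx ι hM]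
  | addMono t s r => simpa [sat_ge ι hM] using fun h => by gcongr
  | addCancel t s r h =>
    simp only [sat_imp, sat_ge ι hM, value_add]
    exact (ENNReal.add_le_add_iff_right (h.value_ne_top hM ι)).1
  | mulComm t s => simp [sat_approx ι hM, mul_comm]
  | mulAssoc t s r => simp [sat_approx ι hM, mul_assoc]
  | mulOne t => simp [sat_approx ι hM]
  | mulZero t => simp [sat_approx ι hM]
  | distrib t s r => simp [sat_approx ι hM, mul_add]
  | sub t s r q =>
    simp only [sat_imp, sat_and, sat_ge ι hM, value_add, value_mul]
    rintro ⟨h, h'⟩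
    obtain ⟨a, ha⟩ := exists_add_of_le h
    obtain ⟨b, hb⟩ := exists_add_of_le h'
    rw [ha, hb]
    exact le_iff_exists_add.2 ⟨a * b, by ring⟩
  | mulCancel t s r h =>
    simp only [sat_imp, sat_and, sat_ge ι hM, sat_gt ι hM, value_mul, value_zero]
    rintro ⟨h0, h'⟩
    exact (ENNReal.mul_le_mul_iff_left h0.ne' (h.value_ne_top hM ι)).1 h'

open Term Formula in
theorem Ax.validIn {φ : Formula V B} (h : Ax φ) : φ.ValidIn M := by
  intro ι
  cases h with
  | poly _ h => exact h.validIn hM ι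
  | eqReflex X c => rfl
  | eqReplace X c c' i φ =>
    simp only [sat_imp, sat_eq, Formula.sat_substC hM, Sym.den]
    intro h
    rw [h]
    exact id
  | eqDist X c c' =>
    simp only [sat_imp, sat_neg, sat_eq, sat_approx ι hM, value_pr, value_zero, Sym.den]
    intro h
    exact Base.prob_eq_zero fun v hv => h (hv.1.symm.trans hv.2)
  | cond δ κ t =>
    simp only [sat_iff, sat_ge ι hM, value_mul, value_pr]
    exact ENNReal.le_div_iff_mul_le (Or.inl (κ.prob_ne_zero hM ι)) (Or.inl (Base.prob_ne_top _ _))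
  | sumLower X i t S =>
    rw [sat_imp, sat_distinctness ι hM, sat_ge ι hM, value_finSum]
    intro h
    classical
    simp only [List.map_map, Function.comp_def, value_substC, Finset.sum_map_toList]
    rw [← Finset.sum_image (f := fun n => t.value M (ι.upd X i n)) (g := M.const X) h]
    exact ENNReal.sum_le_tsum _
  | pos κ =>
    simpa [sat_gt ι hM] using (κ.prob_ne_zero hM ι).bot_lt

theorem tendsto_prob_coverBase (ι : M.Asg) (S : Finset V) :
    Filter.Tendsto (fun n => (coverBase S n).prob M ι) Filter.atTop (nhds 1) := by
  have hC : ∀ n v, (coverBase S n).Holds M ι v ↔ ∀ X ∈ S, ∃ c : Cst B, c.1 < n ∧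
      v X = M.const X c := by
    intro n v
    simp [Base.Holds, coverBase, mem_firstCst, Sym.den]
  simp_rw [Base.prob_eq_law]
  have h1 : (1 : ℝ≥0∞) = M.law (⋃ n, {v | (coverBase S n).Holds M ι v}) := by
    rw [← measure_univ (μ := M.law)]
    congr 1
    symm
    refine Set.eq_univ_of_forall fun v => ?_
    choose f hf using fun X => M.closedWorld X (v X)
    refine Set.mem_iUnion.2 ⟨S.sup (fun X => (f X).1) + 1, (hC _ _).2 fun X hX => ?_⟩
    exact ⟨f X, Nat.lt_succ_of_le (Finset.le_sup (f := fun X => (f X).1) hX), (hf X).symm⟩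
  rw [h1]
  refine tendsto_measure_iUnion_atTop fun m n hmn v hv => (hC _ _).2 fun X hX => ?_
  obtain ⟨c, hc, hv⟩ := (hC _ _).1 hv X hX
  exact ⟨c, hc.trans_le hmn, hv⟩

theorem value_partitionSum (ι : M.Asg) (X : V) (i : ℕ) (t : Term V B) {n : ℕ}
    (Q : Finpartition (firstCst B n)) (hQ : (partitionFormula X Q).Sat M ι) :
    (partitionSum X i t Q).value M ι = ∑ S ∈ Q.parts.attach,
      t.value M (ι.upd X i (M.const X (S.1.min' (Q.nonempty_of_mem_parts S.2)))) := by
  rw [Formula.sat_partitionFormula ι hM] at hQ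
  rw [partitionSum, Term.value_finSum, List.map_map, Finset.sum_map_toList]
  refine Finset.sum_congr rfl fun S _ => Term.value_subst X i _ _ (fun κ v => ?_) t ι
  have hmin := S.1.min'_mem (Q.nonempty_of_mem_parts S.2)
  have hsub : ∀ c ∈ S.1, c ∈ firstCst B n := fun c hc => Q.le S.2 hc
  simp only [Base.Holds, Base.eval_disj, List.mem_map, Finset.mem_toList]
  constructor
  · rintro ⟨_, ⟨c, hc, rfl⟩, hv⟩
    rw [show v X = M.const X c from hv]
    exact (hQ _ (hsub c hc) _ (hsub _ hmin)).2 ⟨S.1, S.2, hc, hmin⟩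
  · exact fun hv => ⟨_, ⟨_, hmin, rfl⟩, hv⟩

/-- The sums over partitions of finitely many constants approximate the infinite sum. -/
theorem exists_sum_le_value_partitionSum (ι : M.Asg) (X : V) (i : ℕ) (t : Term V B)
    (F : Finset (M.Val X)) : ∃ n, 1 ≤ n ∧ ∃ Q : Finpartition (firstCst B n),
      (partitionFormula X Q).Sat M ι ∧
      ∑ x ∈ F, t.value M (ι.upd X i x) ≤ (partitionSum X i t Q).value M ι := by
  classical
  choose f hf using M.closedWorld X
  obtain ⟨n, hn, hF⟩ := exists_subset_firstCst (F.image f)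
  obtain ⟨Q, hQ⟩ := exists_finpartition (Setoid.ker (M.const X)) n
  have hsat : (partitionFormula X Q).Sat M ι := by
    rw [Formula.sat_partitionFormula ι hM]
    exact fun c hc c' hc' => (hQ c hc c' hc').symm
  refine ⟨n, hn, Q, hsat, ?_⟩
  rw [value_partitionSum hM ι X i t Q hsat]
  let m : {S // S ∈ Q.parts} → M.Val X := fun S =>
    M.const X (S.1.min' (Q.nonempty_of_mem_parts S.2))
  have hmin : ∀ S : {S // S ∈ Q.parts}, S.1.min' (Q.nonempty_of_mem_parts S.2) ∈ S.1 :=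
    fun S => S.1.min'_mem _
  have hinj : Set.InjOn m (Q.parts.attach : Set {S // S ∈ Q.parts}) := by
    intro S _ S' _ h
    obtain ⟨T, hT, h1, h2⟩ := (hQ _ (Q.le S.2 (hmin S)) _ (Q.le S'.2 (hmin S'))).2 h
    exact Subtype.ext ((Q.eq_of_mem_parts S.2 hT (hmin S) h1).trans
      (Q.eq_of_mem_parts hT S'.2 h2 (hmin S')))
  rw [← Finset.sum_image (f := fun x => t.value M (ι.upd X i x)) (g := m) hinj]
  refine Finset.sum_le_sum_of_subset fun x hx => ?_
  have hfx := hF (Finset.mem_image_of_mem f hx)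
  obtain ⟨S, hS, h1, -⟩ := (hQ _ hfx _ hfx).2 rfl
  refine Finset.mem_image.2 ⟨⟨S, hS⟩, Finset.mem_attach _ _, ?_⟩
  have h2 := hmin ⟨S, hS⟩
  rw [← hf x]
  exact (hQ _ (Q.le hS h2) _ hfx).1 ⟨S, hS, h2, h1⟩

open Term Formula in
theorem Deriv.validIn {L A : Set (Formula V B)} {fin free : Prop} {Γ : Set (Formula V B)}
    (hA : ∀ φ ∈ A, φ.ValidIn M) (hfin : fin → ∀ X, (M.Val X).Finite)
    (hΓ : ∀ γ ∈ Γ, γ.ValidIn M) {φ : Formula V B} (h : Deriv L A fin free Γ φ) :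
    φ.ValidIn M := by
  induction h with
  | hyp φ h => exact hΓ φ h
  | ax φ h _ => exact h.validIn hM
  | extra φ h _ => exact hA φ h
  | mp φ ψ _ _ ih ih' => exact fun ι => (sat_imp ι φ ψ).1 (ih' ι) (ih ι)
  | conv φ t s _ _ ih =>
    intro ι
    rw [sat_imp, sat_le ι hM]
    intro hφ
    have h : ∀ n : ℕ, 1 ≤ n → (n : ℝ≥0∞) * t.value M ι ≤ n * s.value M ι + 1 := fun n hn => by
      have := ih n hn ι
      rw [sat_imp, sat_le ι hM] at this
      simpa using this hφ
    refine ENNReal.le_of_forall_pos_le_add fun ε hε hs => ?_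
    obtain ⟨n, hn⟩ := ENNReal.exists_inv_nat_lt (a := ε) (by simpa using hε.ne')
    have hn0 : n ≠ 0 := by rintro rfl; simp at hn
    have hn0' : (n : ℝ≥0∞) ≠ 0 := by exact_mod_cast hn0
    have hle := h n (Nat.one_le_iff_ne_zero.2 hn0)
    calc t.value M ι ≤ s.value M ι + (n : ℝ≥0∞)⁻¹ := by
          rw [← ENNReal.mul_le_mul_iff_right hn0' (ENNReal.natCast_ne_top n), mul_add,
            ENNReal.mul_inv_cancel hn0' (ENNReal.natCast_ne_top n)]
          exact hle
      _ ≤ _ := by gcongr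
  | unity φ S a b ha hb c hc _ _ ih =>
    intro ι
    rw [sat_imp]
    intro hφ
    exfalso
    have h : ∀ n : ℕ, 1 ≤ n → (a : ℝ≥0∞) + b * (coverBase S n).prob M ι ≤ b := fun n hn => by
      have := ih n hn ι
      rw [sat_imp, sat_deficit ι hM] at this
      exact (this hφ).le
    have hlim : Filter.Tendsto (fun n => (a : ℝ≥0∞) + b * (coverBase S n).prob M ι) Filter.atTop
        (nhds (a + b * 1)) :=
      tendsto_const_nhds.add
        (ENNReal.Tendsto.const_mul (tendsto_prob_coverBase hM ι S) (Or.inl one_ne_zero))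
    have hle := le_of_tendsto hlim (Filter.eventually_atTop.2 ⟨1, h⟩)
    rw [mul_one] at hle
    have : a + b ≤ b := by exact_mod_cast hle
    omega
  | sumUpper φ X i t q s r _ _ ih =>
    intro ι
    rw [sat_imp, sat_le ι hM]
    intro hφ
    simp only [Term.value]
    rw [ENNReal.tsum_eq_iSup_sum, ENNReal.mul_iSup, ENNReal.iSup_add]
    refine iSup_le fun F => ?_
    obtain ⟨n, hn, Q, hQ, hF⟩ := exists_sum_le_value_partitionSum hM ι X i t F
    have := ih n hn Q ι
    rw [sat_imp, sat_imp, sat_le ι hM] at this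
    refine le_trans ?_ (this hφ hQ)
    simp only [value_add, value_mul]
    gcongr
  | finite hf φ X i _ _ ih =>
    intro ι
    rw [sat_imp]
    intro hφ
    exfalso
    have := (hfin hf X).to_subtype
    have := Fintype.ofFinite (M.Val X)
    have h := ih (Fintype.card (M.Val X) + 1) (by omega) ι
    rw [sat_imp, sat_ge ι hM] at h
    have h := h hφ
    simp only [value_num, Term.value, value_one, tsum_fintype, Finset.sum_const, Finset.card_univ,
      nsmul_eq_mul, mul_one] at h
    have : Fintype.card (M.Val X) + 1 ≤ Fintype.card (M.Val X) := by exact_mod_cast h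
    omega
  | freeElim _ φ X i c _ ih => exact (validIn_substC_iff hM X i φ).2 ih c
  | freeIntro _ φ X i _ ih => exact (validIn_substC_iff hM X i φ).1 ih

open Term Formula in
theorem AxCard.validIn {N : ℕ} (hN : ∀ X, (M.Val X).encard = N) {φ : Formula V B}
    (h : AxCard N φ) : φ.ValidIn M := by
  intro ι
  obtain ⟨X, i⟩ := h
  rw [sat_approx ι hM]
  simp only [value_num, Term.value, value_one]
  rw [ENNReal.tsum_const, mul_one, ENat.card_coe_set_eq, hN X]
  rfl

end

/-! ### Closed expressions -/

def Base.Closed (δ : Base V B) : Prop := ∀ X i, ¬ δ.Free X i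
def Cond.Closed (κ : Cond V B) : Prop := ∀ X i, ¬ κ.Free X i
def Term.Closed (t : Term V B) : Prop := ∀ X i, ¬ t.Free X i

namespace Base

@[simp] theorem closed_top : (top : Base V B).Closed := fun _ _ => id
@[simp] theorem closed_atom_const (X : V) (c : Cst B) : (atom X (.const c)).Closed := by
  intro Y j h
  cases h.2
@[simp] theorem closed_neg {δ : Base V B} : (neg δ).Closed ↔ δ.Closed := Iff.rfl
@[simp] theorem closed_and {δ ε : Base V B} : (and δ ε).Closed ↔ δ.Closed ∧ ε.Closed := by
  simp [Closed, Free, not_or, forall_and]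
@[simp] theorem closed_bot : (bot : Base V B).Closed := closed_neg.2 closed_top
@[simp] theorem closed_or {δ ε : Base V B} : (or δ ε).Closed ↔ δ.Closed ∧ ε.Closed := by
  simp [or]

@[simp] theorem closed_conj {l : List (Base V B)} : (conj l).Closed ↔ ∀ δ ∈ l, δ.Closed := by
  induction l with
  | nil => simp [conj]
  | cons a l ih =>
    have h : conj (a :: l) = and a (conj l) := rfl
    simp [h, ih]

theorem closed_disj {l : List (Base V B)} : (disj l).Closed ↔ ∀ δ ∈ l, δ.Closed := by
  induction l with
  | nil => simp [disj]
  | cons a l ih =>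
    have h : disj (a :: l) = or a (disj l) := rfl
    simp [h, ih]

@[simp] theorem closed_disj_atom (X : V) (l : List (Cst B)) :
    (disj (l.map fun c => atom X (.const c))).Closed := by
  rw [closed_disj]
  intro δ h
  obtain ⟨c, -, rfl⟩ := List.mem_map.1 h
  exact closed_atom_const X c

theorem closed_coverBase (S : Finset V) (n : ℕ) : (coverBase (B := B) S n).Closed := by
  rw [coverBase, closed_conj]
  intro δ h
  obtain ⟨X, -, rfl⟩ := List.mem_map.1 h
  exact closed_disj_atom X _

theorem closed_trivialBase (S : Finset V) (c : Cst B) : (trivialBase S c).Closed := by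
  simp [trivialBase]

theorem free_of_free_subst {X : V} {i : ℕ} {ε : Base V B} (hε : ε.Closed) {δ : Base V B}
    {Y : V} {j : ℕ} (h : (Base.subst X i ε δ).Free Y j) : δ.Free Y j ∧ ¬ (X = Y ∧ i = j) := by
  induction δ with
  | top => exact h.elim
  | atom Z d =>
    unfold Base.subst at h
    split_ifs at h with h'
    · exact absurd h (hε Y j)
    · refine ⟨h, ?_⟩
      rintro ⟨rfl, rfl⟩
      exact h' h
  | neg δ ih => exact ih h
  | and δ δ' ih ih' =>
    rcases h with h | h
    · exact ⟨Or.inl (ih h).1, (ih h).2⟩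
    · exact ⟨Or.inr (ih' h).1, (ih' h).2⟩

/-- Substitution has no effect where the variable is not free. -/
theorem subst_eq_self {X : V} {i : ℕ} {ε δ : Base V B} (h : ¬ δ.Free X i) :
    Base.subst X i ε δ = δ := by
  induction δ with
  | top => rfl
  | atom Z d => exact if_neg h
  | neg δ ih => rw [Base.subst, ih h]
  | and δ δ' ih ih' => rw [Base.subst, ih fun h' => h (Or.inl h'), ih' fun h' => h (Or.inr h')]

end Base

theorem Cond.closed_top : (Cond.top : Cond V B).Closed := by
  simp [Closed, Free, Cond.top]

theorem Cond.closed_toBase {κ : Cond V B} (h : κ.Closed) : κ.toBase.Closed := by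
  simp only [toBase, Base.closed_conj, List.mem_map, forall_exists_index, and_imp,
    forall_apply_eq_imp_iff₂]
  intro l hl X i hX
  refine h X i ⟨l, hl, ?_⟩
  unfold Lit.toBase at hX
  split at hX <;> exact hX

theorem Sym.eq_var_of_subst {X : V} {i : ℕ} {c : Cst B} {d : Sym B} {Y : V} {j : ℕ}
    (h : d.subst X i c Y = .var j) : d = .var j ∧ ¬ (X = Y ∧ i = j) := by
  unfold Sym.subst at h
  split_ifs at h with h'
  refine ⟨h, ?_⟩
  rintro ⟨rfl, rfl⟩
  exact h' ⟨rfl, h⟩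

theorem Cond.free_of_free_subst {X : V} {i : ℕ} {c : Cst B} {κ : Cond V B}
    {Y : V} {j : ℕ} (h : (κ.subst X i c).Free Y j) : κ.Free Y j ∧ ¬ (X = Y ∧ i = j) := by
  obtain ⟨l, hl, rfl, hj⟩ := h
  obtain ⟨l, hl', rfl⟩ := List.mem_map.1 hl
  have := Sym.eq_var_of_subst hj
  exact ⟨⟨l, hl', rfl, this.1⟩, this.2⟩

namespace Term

@[simp] theorem closed_prob {δ : Base V B} {κ : Cond V B} :
    (prob δ κ).Closed ↔ δ.Closed ∧ κ.Closed := by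
  simp [Closed, Base.Closed, Cond.Closed, Free, not_or, forall_and]

@[simp] theorem closed_add {t s : Term V B} : (add t s).Closed ↔ t.Closed ∧ s.Closed := by
  simp [Closed, Free, not_or, forall_and]

@[simp] theorem closed_mul {t s : Term V B} : (mul t s).Closed ↔ t.Closed ∧ s.Closed := by
  simp [Closed, Free, not_or, forall_and]

@[simp] theorem closed_pr {δ : Base V B} : (pr δ).Closed ↔ δ.Closed := by
  simp [pr, Cond.closed_top]

@[simp] theorem closed_zero : (zero : Term V B).Closed := by simp [zero]
@[simp] theorem closed_one : (one : Term V B).Closed := by simp [one]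

@[simp] theorem closed_num (n : ℕ) : (num n : Term V B).Closed := by
  induction n with
  | zero => simp [num]
  | succ n ih => simp [num, ih]

@[simp] theorem closed_finSum {l : List (Term V B)} : (finSum l).Closed ↔ ∀ t ∈ l, t.Closed := by
  induction l with
  | nil => simp [finSum]
  | cons a l ih =>
    have h : finSum (a :: l) = add a (finSum l) := rfl
    simp [h, ih]

theorem closed_sum_of_closed {X : V} {i : ℕ} {t : Term V B} (h : t.Closed) :
    (sum X i t).Closed := fun Y j h' => h Y j h'.1

theorem sumFree_num (n : ℕ) : (num n : Term V B).SumFree := by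
  induction n with
  | zero => trivial
  | succ n ih => exact ⟨ih, trivial⟩

theorem free_of_free_subst {X : V} {i : ℕ} {ε : Base V B} (hε : ε.Closed) {c : Cst B}
    {t : Term V B} {Y : V} {j : ℕ} (h : (t.subst X i ε c).Free Y j) :
    t.Free Y j ∧ ¬ (X = Y ∧ i = j) := by
  induction t with
  | prob δ κ =>
    rcases h with h | h
    · exact ⟨Or.inl (Base.free_of_free_subst hε h).1, (Base.free_of_free_subst hε h).2⟩
    · exact ⟨Or.inr (Cond.free_of_free_subst h).1, (Cond.free_of_free_subst h).2⟩
  | sum Z k t ih =>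
    unfold subst at h
    split_ifs at h with h'
    · refine ⟨h, fun h'' => h.2 ?_⟩
      exact ⟨h'.1.trans h''.1, h'.2.trans h''.2⟩
    · exact ⟨⟨(ih h.1).1, h.2⟩, (ih h.1).2⟩
  | add t s ih ih' =>
    rcases h with h | h
    · exact ⟨Or.inl (ih h).1, (ih h).2⟩
    · exact ⟨Or.inr (ih' h).1, (ih' h).2⟩
  | mul t s ih ih' =>
    rcases h with h | h
    · exact ⟨Or.inl (ih h).1, (ih h).2⟩
    · exact ⟨Or.inr (ih' h).1, (ih' h).2⟩

theorem Closed.subst {X : V} {i : ℕ} {t : Term V B} (h : (sum X i t).Closed)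
    {ε : Base V B} (hε : ε.Closed) (c : Cst B) : (t.subst X i ε c).Closed := by
  intro Y j h'
  exact h Y j (free_of_free_subst hε h')

theorem Closed.substC {X : V} {i : ℕ} {t : Term V B} (h : (sum X i t).Closed) (c : Cst B) :
    (t.substC X i c).Closed :=
  h.subst (Base.closed_atom_const X c) c

theorem closed_partitionSum {X : V} {i : ℕ} {t : Term V B} (h : (sum X i t).Closed) {n : ℕ}
    (Q : Finpartition (firstCst B n)) : (partitionSum X i t Q).Closed := by
  simp only [partitionSum, closed_finSum, List.mem_map, Finset.mem_toList, forall_exists_index,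
    and_imp]
  rintro _ S - rfl
  exact h.subst (Base.closed_disj_atom X _) _

end Term

namespace Formula

@[simp] theorem closed_eq_const (X : V) (c c' : Cst B) :
    (eq X (.const c) (.const c')).Closed := by
  rintro Y j ⟨-, h⟩
  simp at h

@[simp] theorem closed_ge {t s : Term V B} : (ge t s).Closed ↔ t.Closed ∧ s.Closed := by
  simp [Closed, Term.Closed, Free, not_or, forall_and]

@[simp] theorem closed_neg {φ : Formula V B} : (neg φ).Closed ↔ φ.Closed := Iff.rfl

@[simp] theorem closed_and {φ ψ : Formula V B} : (and φ ψ).Closed ↔ φ.Closed ∧ ψ.Closed := by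
  simp [Closed, Free, not_or, forall_and]

@[simp] theorem closed_imp {φ ψ : Formula V B} : (imp φ ψ).Closed ↔ φ.Closed ∧ ψ.Closed := by
  simp [imp]

@[simp] theorem closed_or {φ ψ : Formula V B} : (or φ ψ).Closed ↔ φ.Closed ∧ ψ.Closed := by
  simp [or]

@[simp] theorem closed_iff {φ ψ : Formula V B} : (iff φ ψ).Closed ↔ φ.Closed ∧ ψ.Closed := by
  simp [iff]; tauto

@[simp] theorem closed_le {t s : Term V B} : (le t s).Closed ↔ t.Closed ∧ s.Closed := by
  simp [le, and_comm]

@[simp] theorem closed_gt {t s : Term V B} : (gt t s).Closed ↔ t.Closed ∧ s.Closed := by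
  simp [gt]; tauto

@[simp] theorem closed_approx {t s : Term V B} : (approx t s).Closed ↔ t.Closed ∧ s.Closed := by
  simp [approx]

theorem closed_conj {l : List (Formula V B)} (h : ∀ φ ∈ l, φ.Closed) : (conj l).Closed := by
  induction l with
  | nil => simp [conj]
  | cons a l ih => exact closed_and.2 ⟨h a (by simp), ih fun φ hφ => h φ (by simp [hφ])⟩

theorem closed_distinctness (X : V) (S : Finset (Cst B)) : (distinctness X S).Closed := by
  refine closed_conj fun φ h => ?_
  obtain ⟨p, -, rfl⟩ := List.mem_map.1 h
  simp

theorem closed_partitionFormula (X : V) {n : ℕ} (Q : Finpartition (firstCst B n)) :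
    (partitionFormula X Q).Closed := by
  refine closed_conj fun φ h => ?_
  obtain ⟨p, -, rfl⟩ := List.mem_map.1 h
  split_ifs <;> simp

@[simp] theorem closed_deficit {δ : Base V B} {a b : ℕ} : (deficit δ a b).Closed ↔ δ.Closed := by
  simp [deficit]

theorem free_of_free_substC {X : V} {i : ℕ} {c : Cst B} {φ : Formula V B} {Y : V} {j : ℕ}
    (h : (φ.substC X i c).Free Y j) : φ.Free Y j ∧ ¬ (X = Y ∧ i = j) := by
  induction φ with
  | eq Z d d' =>
    obtain ⟨rfl, h | h⟩ := h
    · have := Sym.eq_var_of_subst h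
      exact ⟨⟨rfl, Or.inl this.1⟩, this.2⟩
    · have := Sym.eq_var_of_subst h
      exact ⟨⟨rfl, Or.inr this.1⟩, this.2⟩
  | ge t s =>
    have hc := Base.closed_atom_const X c
    rcases h with h | h
    · have := Term.free_of_free_subst hc h
      exact ⟨Or.inl this.1, this.2⟩
    · have := Term.free_of_free_subst hc h
      exact ⟨Or.inr this.1, this.2⟩
  | neg φ ih => exact ih h
  | and φ ψ ih ih' =>
    rcases h with h | h
    · exact ⟨Or.inl (ih h).1, (ih h).2⟩
    · exact ⟨Or.inr (ih' h).1, (ih' h).2⟩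

end Formula

/-! ### Countability of the language -/

section Countability

variable [Countable V]

instance : Countable (Sym B) :=
  Function.Injective.countable (β := Cst B ⊕ ℕ)
    (f := fun | .const c => .inl c | .var i => .inr i) (by
      rintro (c | i) (c' | i') h <;> simp_all)

instance : Countable (Lit V B) :=
  Function.Injective.countable (f := fun l : Lit V B => (l.rv, l.sym, l.pos)) (by
    rintro ⟨_, _, _⟩ ⟨_, _, _⟩ h
    simp_all)

instance : Countable (Cond V B) :=
  Function.Injective.countable (f := Cond.lits) (by
    rintro ⟨l, _⟩ ⟨l', _⟩ h
    simp_all)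

/-- Gödel numbers of base formulas, built from numbers of the atoms. -/
def Base.code (e : V → Sym B → ℕ) : Base V B → ℕ
  | .top => Nat.pair 0 0
  | .atom X d => Nat.pair 1 (e X d)
  | .neg δ => Nat.pair 2 (δ.code e)
  | .and δ ε => Nat.pair 3 (Nat.pair (δ.code e) (ε.code e))

instance : Countable (Base V B) := by
  obtain ⟨e, he⟩ := exists_injective_nat (V × Sym B)
  refine Function.Injective.countable (f := Base.code fun X d => e (X, d)) fun δ => ?_
  induction δ with
  | top => rintro (_ | _ | _ | _) <;> simp [Base.code]
  | atom X d => rintro (_ | _ | _ | _) <;> simp [Base.code, he.eq_iff]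
  | neg δ ih =>
    rintro (_ | _ | _ | _) <;> simp [Base.code]
    exact fun h => ih h
  | and δ ε ih ih' =>
    rintro (_ | _ | _ | _) <;> simp [Base.code]
    exact fun h h' => ⟨ih h, ih' h'⟩

/-- Gödel numbers of terms. -/
def Term.code (e : Base V B → Cond V B → ℕ) (e' : V → ℕ) : Term V B → ℕ
  | .prob δ κ => Nat.pair 0 (e δ κ)
  | .sum X i t => Nat.pair 1 (Nat.pair (Nat.pair (e' X) i) (t.code e e'))
  | .add t s => Nat.pair 2 (Nat.pair (t.code e e') (s.code e e'))
  | .mul t s => Nat.pair 3 (Nat.pair (t.code e e') (s.code e e'))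

instance : Countable (Term V B) := by
  obtain ⟨e, he⟩ := exists_injective_nat (Base V B × Cond V B)
  obtain ⟨e', he'⟩ := exists_injective_nat V
  refine Function.Injective.countable (f := Term.code (fun δ κ => e (δ, κ)) e') fun t => ?_
  induction t with
  | prob δ κ => rintro (_ | _ | _ | _) <;> simp [Term.code, he.eq_iff]
  | sum X i t ih =>
    rintro (_ | _ | _ | _) <;> simp [Term.code, he'.eq_iff]
    exact fun h h' h'' => ⟨h, h', ih h''⟩
  | add t s ih ih' =>
    rintro (_ | _ | _ | _) <;> simp [Term.code]
    exact fun h h' => ⟨ih h, ih' h'⟩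
  | mul t s ih ih' =>
    rintro (_ | _ | _ | _) <;> simp [Term.code]
    exact fun h h' => ⟨ih h, ih' h'⟩

/-- Gödel numbers of formulas. -/
def Formula.code (e : V → Sym B → Sym B → ℕ) (e' : Term V B → Term V B → ℕ) : Formula V B → ℕ
  | .eq X d d' => Nat.pair 0 (e X d d')
  | .ge t s => Nat.pair 1 (e' t s)
  | .neg φ => Nat.pair 2 (φ.code e e')
  | .and φ ψ => Nat.pair 3 (Nat.pair (φ.code e e') (ψ.code e e'))

instance : Countable (Formula V B) := by
  obtain ⟨e, he⟩ := exists_injective_nat (V × Sym B × Sym B)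
  obtain ⟨e', he'⟩ := exists_injective_nat (Term V B × Term V B)
  refine Function.Injective.countable
    (f := Formula.code (fun X d d' => e (X, d, d')) fun t s => e' (t, s)) fun φ => ?_
  induction φ with
  | eq X d d' => rintro (_ | _ | _ | _) <;> simp [Formula.code, he.eq_iff]
  | ge t s => rintro (_ | _ | _ | _) <;> simp [Formula.code, he'.eq_iff]
  | neg φ ih =>
    rintro (_ | _ | _ | _) <;> simp [Formula.code]
    exact fun h => ih h
  | and φ ψ ih ih' =>
    rintro (_ | _ | _ | _) <;> simp [Formula.code]
    exact fun h h' => ⟨ih h, ih' h'⟩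

end Countability

/-! ### Complete theories -/

section Lindenbaum

variable {A : Set (Formula V B)} {fin free : Prop} {Γ : Set (Formula V B)}

local notation:25 "⊩" φ:26 => Deriv (ClosedLang V B) A fin free Γ φ

open Formula

theorem Deriv.of_taut₁ {φ ψ : Formula V B} (hφ : φ.Closed) (hψ : ψ.Closed)
    (h : ∀ p : Formula V B → Prop, (∀ ψ, p (neg ψ) ↔ ¬ p ψ) →
      (∀ ψ χ, p (and ψ χ) ↔ p ψ ∧ p χ) → p φ → p ψ)
    (h1 : ⊩ φ) : ⊩ ψ := by
  refine .mp φ ψ h1 (.ax _ (.poly _ (.bool _ fun p hn ha => ?_)) (closed_imp.2 ⟨hφ, hψ⟩))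
  have := h p hn ha
  simp only [imp, hn, ha]
  tauto

theorem Deriv.of_taut₂ {φ ψ χ : Formula V B} (hφ : φ.Closed) (hψ : ψ.Closed) (hχ : χ.Closed)
    (h : ∀ p : Formula V B → Prop, (∀ ψ, p (neg ψ) ↔ ¬ p ψ) →
      (∀ ψ χ, p (and ψ χ) ↔ p ψ ∧ p χ) → p φ → p ψ → p χ)
    (h1 : ⊩ φ) (h2 : ⊩ ψ) : ⊩ χ := by
  refine .mp ψ χ h2 (Deriv.of_taut₁ hφ (closed_imp.2 ⟨hψ, hχ⟩) (fun p hn ha h1 => ?_) h1)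
  have := h p hn ha h1
  simp only [imp, hn, ha]
  tauto

theorem Deriv.of_taut {φ : Formula V B} (hφ : φ.Closed)
    (h : ∀ p : Formula V B → Prop, (∀ ψ, p (neg ψ) ↔ ¬ p ψ) →
      (∀ ψ χ, p (and ψ χ) ↔ p ψ ∧ p χ) → p φ) : ⊩ φ :=
  .ax _ (.poly _ (.bool _ h)) hφ

/-- A closed formula consistent with `Γ`; stronger formulas are larger. -/
def ConsistentFormula (A : Set (Formula V B)) (fin free : Prop) (Γ : Set (Formula V B)) : Type u :=
  {θ : Formula V B // θ.Closed ∧ ¬ Deriv (ClosedLang V B) A fin free Γ (neg θ)}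

instance : Preorder (ConsistentFormula A fin free Γ) where
  le θ θ' := ⊩ imp θ'.1 θ.1
  le_refl θ := by
    refine Deriv.of_taut (closed_imp.2 ⟨θ.2.1, θ.2.1⟩) fun p hn ha => ?_
    simp only [imp, hn, ha]
    tauto
  le_trans a b c h h' := by
    refine Deriv.of_taut₂ (closed_imp.2 ⟨b.2.1, a.2.1⟩) (closed_imp.2 ⟨c.2.1, b.2.1⟩)
      (closed_imp.2 ⟨c.2.1, a.2.1⟩) (fun p hn ha => ?_) h h'
    simp only [imp, hn, ha]
    tauto

/-- Omitting types: an infinitary rule, given as its set of premises and its conclusion, is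
respected by a suitable completion of the theory, and so are countably many rules at once. A
formula `θ` consistent with `Γ` that does not imply the conclusion does not imply some premise
`π`, and so remains consistent when `¬ π` is added; hence the formulas that imply the conclusion
or refute a premise are cofinal. -/
theorem exists_complete_extension [Countable V] {𝓡 : Set (Set (Formula V B) × Formula V B)}
    (h𝓡 : 𝓡.Countable) (hcl : ∀ r ∈ 𝓡, (∀ π ∈ r.1, π.Closed) ∧ r.2.Closed)
    (hrule : ∀ r ∈ 𝓡, ∀ θ : Formula V B, θ.Closed → (∀ π ∈ r.1, ⊩ imp θ π) → ⊩ imp θ r.2)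
    {φ : Formula V B} (hφ : φ.Closed) (hnot : ¬ (⊩ φ)) :
    ∃ T : Set (Formula V B), (∀ ψ ∈ T, ψ.Closed) ∧ (∀ ψ, ψ.Closed → (⊩ ψ) → ψ ∈ T) ∧ φ ∉ T ∧
      (∀ ψ, ψ.Closed → (neg ψ ∈ T ↔ ψ ∉ T)) ∧
      (∀ ψ χ : Formula V B, ψ.Closed → χ.Closed → (.and ψ χ ∈ T ↔ ψ ∈ T ∧ χ ∈ T)) ∧
      ∀ r ∈ 𝓡, (∀ π ∈ r.1, π ∈ T) → r.2 ∈ T := by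
  classical
  -- Completeness of the theory is one more family of rules: from `ψ` and `¬ ψ` infer `ψ ∧ ¬ ψ`.
  let 𝓢 : Set (Set (Formula V B) × Formula V B) :=
    𝓡 ∪ (fun ψ => ({ψ, neg ψ}, and ψ (neg ψ))) '' {ψ : Formula V B | ψ.Closed}
  have h𝓢 : 𝓢.Countable := h𝓡.union ((Set.to_countable _).image _)
  have hcl' : ∀ r ∈ 𝓢, (∀ π ∈ r.1, π.Closed) ∧ r.2.Closed := by
    rintro r (hr | ⟨ψ, hψ : ψ.Closed, rfl⟩)
    · exact hcl r hr
    · simp [hψ]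
  have hrule' : ∀ r ∈ 𝓢, ∀ θ : Formula V B, θ.Closed → (∀ π ∈ r.1, ⊩ imp θ π) →
      ⊩ imp θ r.2 := by
    rintro r (hr | ⟨ψ, hψ : ψ.Closed, rfl⟩) θ hθ h
    · exact hrule r hr θ hθ h
    · refine Deriv.of_taut₂ ?_ ?_ ?_ (fun p hn ha => ?_) (h ψ (by simp)) (h (neg ψ) (by simp))
      · simp [hθ, hψ]
      · simp [hθ, hψ]
      · simp [hθ, hψ]
      · simp only [imp, hn, ha]
        tauto
  have := h𝓢.to_subtype
  have : Encodable 𝓢 := Encodable.ofCountable 𝓢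
  let 𝒟 : 𝓢 → Order.Cofinal (ConsistentFormula A fin free Γ) := fun r =>
    { carrier := {θ | (⊩ imp θ.1 r.1.2) ∨ ∃ π ∈ r.1.1, ⊩ imp θ.1 (neg π)}
      isCofinal := by
        intro θ
        by_cases h : ⊩ imp θ.1 r.1.2
        · exact ⟨θ, Or.inl h, le_rfl⟩
        · have : ∃ π ∈ r.1.1, ¬ (⊩ imp θ.1 π) := by
            by_contra! hc
            exact h (hrule' r r.2 θ.1 θ.2.1 hc)
          obtain ⟨π, hπ, hθπ⟩ := this
          have hπc := (hcl' r r.2).1 π hπ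
          refine ⟨⟨and θ.1 (neg π), by simp [θ.2.1, hπc], hθπ⟩, Or.inr ⟨π, hπ, ?_⟩, ?_⟩
          · refine Deriv.of_taut (by simp [θ.2.1, hπc]) fun p hn ha => ?_
            simp only [imp, hn, ha]
            tauto
          · refine Deriv.of_taut (by simp [θ.2.1, hπc]) fun p hn ha => ?_
            simp only [imp, hn, ha]
            tauto }
  have hstart : ¬ (⊩ neg (neg φ)) := fun h =>
    hnot (Deriv.of_taut₁ (φ := neg (neg φ)) hφ hφ (fun p hn ha => by simp only [hn]; tauto) h)
  let θ₀ : ConsistentFormula A fin free Γ := ⟨neg φ, hφ, hstart⟩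
  let I := Order.idealOfCofinals θ₀ 𝒟
  let T : Set (Formula V B) := {ψ | ψ.Closed ∧ ∃ θ ∈ I, ⊩ imp θ.1 ψ}
  have hT1 : ∀ {ψ χ : Formula V B}, χ.Closed → (∀ p : Formula V B → Prop, (∀ ψ, p (neg ψ) ↔ ¬ p ψ) →
      (∀ ψ χ, p (and ψ χ) ↔ p ψ ∧ p χ) → p ψ → p χ) → ψ ∈ T → χ ∈ T := by
    rintro ψ χ hχ h ⟨hψ, θ, hθ, hd⟩
    refine ⟨hχ, θ, hθ, Deriv.of_taut₁ (closed_imp.2 ⟨θ.2.1, hψ⟩) (closed_imp.2 ⟨θ.2.1, hχ⟩)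
      (fun p hn ha => ?_) hd⟩
    have := h p hn ha
    simp only [imp, hn, ha]
    tauto
  have hT2 : ∀ {ψ χ : Formula V B}, ψ ∈ T → χ ∈ T → and ψ χ ∈ T := by
    rintro ψ χ ⟨hψ, θ, hθ, hd⟩ ⟨hχ, θ', hθ', hd'⟩
    obtain ⟨η, hη, hle, hle'⟩ := I.directed θ hθ θ' hθ'
    have h1 : ⊩ imp η.1 ψ := by
      refine Deriv.of_taut₂ (closed_imp.2 ⟨η.2.1, θ.2.1⟩) (closed_imp.2 ⟨θ.2.1, hψ⟩)
        (closed_imp.2 ⟨η.2.1, hψ⟩) (fun p hn ha => ?_) hle hd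
      simp only [imp, hn, ha]
      tauto
    have h2 : ⊩ imp η.1 χ := by
      refine Deriv.of_taut₂ (closed_imp.2 ⟨η.2.1, θ'.2.1⟩) (closed_imp.2 ⟨θ'.2.1, hχ⟩)
        (closed_imp.2 ⟨η.2.1, hχ⟩) (fun p hn ha => ?_) hle' hd'
      simp only [imp, hn, ha]
      tauto
    refine ⟨closed_and.2 ⟨hψ, hχ⟩, η, hη, Deriv.of_taut₂ (closed_imp.2 ⟨η.2.1, hψ⟩)
      (closed_imp.2 ⟨η.2.1, hχ⟩) (closed_imp.2 ⟨η.2.1, closed_and.2 ⟨hψ, hχ⟩⟩)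
      (fun p hn ha => ?_) h1 h2⟩
    simp only [imp, hn, ha]
    tauto
  have hcons : ∀ ψ, ψ ∈ T → neg ψ ∉ T := by
    intro ψ h h'
    obtain ⟨hc, θ, hθ, hd⟩ := hT2 h h'
    refine θ.2.2 (Deriv.of_taut₁ (closed_imp.2 ⟨θ.2.1, hc⟩) θ.2.1 (fun p hn ha => ?_) hd)
    simp only [imp, hn, ha]
    tauto
  have hgen : ∀ r ∈ 𝓢, r.2 ∈ T ∨ ∃ π ∈ r.1, neg π ∈ T := by
    intro r hr
    obtain ⟨θ, hθ, hI⟩ := Order.cofinal_meets_idealOfCofinals θ₀ 𝒟 ⟨r, hr⟩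
    rcases hθ with h | ⟨π, hπ, h⟩
    · exact Or.inl ⟨(hcl' r hr).2, θ, hI, h⟩
    · exact Or.inr ⟨π, hπ, (hcl' r hr).1 π hπ, θ, hI, h⟩
  have hθ₀ : θ₀ ∈ I := Order.mem_idealOfCofinals θ₀ 𝒟
  have hnegφ : neg φ ∈ T := by
    refine ⟨hφ, θ₀, hθ₀, Deriv.of_taut (closed_imp.2 ⟨hφ, hφ⟩) fun p hn ha => ?_⟩
    simp only [θ₀, imp, hn, ha]
    tauto
  have hneg : ∀ ψ, ψ.Closed → (neg ψ ∈ T ↔ ψ ∉ T) := by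
    intro ψ hψ
    refine ⟨fun h h' => hcons ψ h' h, fun h => ?_⟩
    rcases hgen _ (Or.inr ⟨ψ, hψ, rfl⟩) with h' | ⟨π, hπ, h'⟩
    · exact absurd (hT1 hψ (fun p hn ha h => ((ha _ _).1 h).1) h') h
    · rcases hπ with rfl | rfl
      · exact h'
      · exact absurd (hT1 hψ (fun p hn ha h => by simpa [hn] using h) h') h
  refine ⟨T, fun ψ h => h.1, fun ψ hψ h => ⟨hψ, θ₀, hθ₀, ?_⟩, fun h => hcons φ h hnegφ, hneg,
    fun ψ χ hψ hχ => ⟨fun h => ⟨?_, ?_⟩, fun h => hT2 h.1 h.2⟩, fun r hr h => ?_⟩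
  · refine Deriv.of_taut₁ hψ (closed_imp.2 ⟨hφ, hψ⟩) (fun p hn ha => ?_) h
    simp only [imp, hn, ha]
    tauto
  · exact hT1 hψ (fun p hn ha h => ((ha _ _).1 h).1) h
  · exact hT1 hχ (fun p hn ha h => ((ha _ _).1 h).2) h
  · rcases hgen r (Or.inl hr) with h' | ⟨π, hπ, h'⟩
    · exact h'
    · exact absurd h' (hcons π (h π hπ))

end Lindenbaum

open Formula Term in
/-- A complete theory in the closed language that contains the axioms and is closed under modus
ponens (which follows from `neg_iff` and `and_iff`) and the infinitary rules. -/
structure CompleteTheory (A : Set (Formula V B)) (fin : Prop) (T : Set (Formula V B)) : Prop where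
  neg_iff : ∀ {φ : Formula V B}, φ.Closed → (neg φ ∈ T ↔ φ ∉ T)
  and_iff : ∀ {φ ψ : Formula V B}, φ.Closed → ψ.Closed → (.and φ ψ ∈ T ↔ φ ∈ T ∧ ψ ∈ T)
  ax : ∀ {φ : Formula V B}, Ax φ → φ.Closed → φ ∈ T
  extra : ∀ {φ : Formula V B}, φ ∈ A → φ.Closed → φ ∈ T
  conv : ∀ {t s : Term V B}, t.Closed → s.Closed →
    (∀ n : ℕ, 1 ≤ n → le (mul (num n) t) (add (mul (num n) s) one) ∈ T) → le t s ∈ T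
  unity : ∀ {S : Finset V} {a b : ℕ} {c : Cst B}, 1 ≤ a → 1 ≤ b → c.1 = 0 →
    (∀ n : ℕ, 1 ≤ n → deficit (coverBase S n) a b ∈ T) → deficit (trivialBase S c) a b ∈ T
  sumUpper : ∀ {X : V} {i : ℕ} {t q s r : Term V B}, (sum X i t).Closed → q.Closed → s.Closed →
    r.Closed → (∀ n : ℕ, 1 ≤ n → ∀ Q : Finpartition (firstCst B n),
      imp (partitionFormula X Q) (le (add (mul q (partitionSum X i t Q)) s) r) ∈ T) →
    le (add (mul q (sum X i t)) s) r ∈ T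
  finite : fin → ∀ (X : V) (i : ℕ), (∀ n : ℕ, 1 ≤ n → ge (sum X i one) (num n) ∈ T) →
    gt zero (sum X i one) ∈ T

open Formula Term in
theorem exists_completeTheory [Countable V] {A : Set (Formula V B)} {fin free : Prop}
    {Γ : Set (Formula V B)} (hΓ : ∀ γ ∈ Γ, γ.Closed) {φ : Formula V B} (hφ : φ.Closed)
    (hnot : ¬ Deriv (ClosedLang V B) A fin free Γ φ) :
    ∃ T, CompleteTheory A fin T ∧ Γ ⊆ T ∧ φ ∉ T := by
  let R₁ : Set (Set (Formula V B) × Formula V B) :=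
    (fun p : Term V B × Term V B =>
      ((fun n : ℕ => le (mul (num n) p.1) (add (mul (num n) p.2) one)) '' {n | 1 ≤ n},
        le p.1 p.2)) '' {p | p.1.Closed ∧ p.2.Closed}
  let R₂ : Set (Set (Formula V B) × Formula V B) :=
    (fun p : Finset V × ℕ × ℕ × Cst B =>
      ((fun n : ℕ => deficit (coverBase p.1 n) p.2.1 p.2.2.1) '' {n | 1 ≤ n},
        deficit (trivialBase p.1 p.2.2.2) p.2.1 p.2.2.1)) ''
      {p | 1 ≤ p.2.1 ∧ 1 ≤ p.2.2.1 ∧ p.2.2.2.1 = 0}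
  let R₃ : Set (Set (Formula V B) × Formula V B) :=
    (fun p : V × ℕ × Term V B × Term V B × Term V B × Term V B =>
      ((fun Q : Σ n, Finpartition (firstCst B n) => imp (partitionFormula p.1 Q.2)
          (le (add (mul p.2.2.2.1 (partitionSum p.1 p.2.1 p.2.2.1 Q.2)) p.2.2.2.2.1) p.2.2.2.2.2))
          '' {Q | 1 ≤ Q.1},
        le (add (mul p.2.2.2.1 (sum p.1 p.2.1 p.2.2.1)) p.2.2.2.2.1) p.2.2.2.2.2)) ''
      {p | (sum p.1 p.2.1 p.2.2.1).Closed ∧ p.2.2.2.1.Closed ∧ p.2.2.2.2.1.Closed ∧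
        p.2.2.2.2.2.Closed}
  let R₄ : Set (Set (Formula V B) × Formula V B) :=
    (fun p : V × ℕ => ((fun n : ℕ => ge (sum p.1 p.2 one) (num n)) '' {n | 1 ≤ n},
      gt zero (sum p.1 p.2 one))) '' {_p | fin}
  have h1 : (R₁ ∪ R₂ ∪ (R₃ ∪ R₄)).Countable :=
    (((Set.to_countable _).image _).union ((Set.to_countable _).image _)).union
      (((Set.to_countable _).image _).union ((Set.to_countable _).image _))
  have hsum1 : ∀ (X : V) i, (sum X i (one : Term V B)).Closed := fun X i =>
    closed_sum_of_closed closed_one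
  obtain ⟨T, hTc, hTd, hφT, hneg, hand, hr⟩ := exists_complete_extension (A := A) (fin := fin)
    (free := free) (Γ := Γ) h1 (by
      rintro r ((⟨⟨t, s⟩, ⟨ht, hs⟩, rfl⟩ | ⟨⟨S, a, b, c⟩, -, rfl⟩) |
        (⟨⟨X, i, t, q, s, r⟩, ⟨ht, hq, hs, hr⟩, rfl⟩ | ⟨⟨X, i⟩, -, rfl⟩))
      · dsimp only at ht hs
        refine ⟨?_, by simp [ht, hs]⟩
        rintro _ ⟨n, -, rfl⟩
        simp [ht, hs]
      · refine ⟨?_, by simp [Base.closed_trivialBase]⟩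
        rintro _ ⟨n, -, rfl⟩
        simp [Base.closed_coverBase]
      · dsimp only at ht hq hs hr
        refine ⟨?_, by simp [ht, hq, hs, hr]⟩
        rintro _ ⟨Q, -, rfl⟩
        simp [closed_partitionSum ht, closed_partitionFormula, hq, hs, hr]
      · refine ⟨?_, by simp [hsum1]⟩
        rintro _ ⟨n, -, rfl⟩
        simp [hsum1]) (by
      rintro r ((⟨⟨t, s⟩, ⟨ht, hs⟩, rfl⟩ | ⟨⟨S, a, b, c⟩, ⟨ha, hb, hc⟩, rfl⟩) |
        (⟨⟨X, i, t, q, s, r⟩, ⟨ht, hq, hs, hr⟩, rfl⟩ | ⟨⟨X, i⟩, hf, rfl⟩)) θ hθ h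
      · dsimp only at ht hs h ⊢
        refine .conv _ _ _ ?_ fun n hn => h _ ⟨n, hn, rfl⟩
        exact closed_imp.2 ⟨hθ, closed_le.2 ⟨ht, hs⟩⟩
      · refine .unity _ _ _ _ ha hb _ hc ?_ fun n hn => h _ ⟨n, hn, rfl⟩
        exact closed_imp.2 ⟨hθ, closed_deficit.2 (Base.closed_trivialBase _ _)⟩
      · dsimp only at ht hq hs hr h ⊢
        refine .sumUpper _ _ _ _ _ _ _ ?_ fun n hn Q => h _ ⟨⟨n, Q⟩, hn, rfl⟩
        exact closed_imp.2 ⟨hθ, by simp [ht, hq, hs, hr]⟩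
      · refine .finite hf _ _ _ ?_ fun n hn => h _ ⟨n, hn, rfl⟩
        exact closed_imp.2 ⟨hθ, by simp [hsum1]⟩) hφ hnot
  refine ⟨T, ⟨hneg _, hand _ _, fun h hc => hTd _ hc (.ax _ h hc), fun h hc =>
    hTd _ hc (.extra _ h hc), fun {t s} ht hs h => ?_, fun {S a b c} ha hb hc h => ?_,
    fun {X i t q s r} ht hq hs h' h => ?_, fun hf X i h => ?_⟩,
    fun γ h => hTd γ (hΓ γ h) (.hyp γ h), hφT⟩
  · refine hr _ (Or.inl (Or.inl ⟨(t, s), ⟨ht, hs⟩, rfl⟩)) ?_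
    rintro _ ⟨n, hn, rfl⟩
    exact h n hn
  · refine hr _ (Or.inl (Or.inr ⟨(S, a, b, c), ⟨ha, hb, hc⟩, rfl⟩)) ?_
    rintro _ ⟨n, hn, rfl⟩
    exact h n hn
  · refine hr _ (Or.inr (Or.inl ⟨(X, i, t, q, s, r), ⟨ht, hq, hs, h'⟩, rfl⟩)) ?_
    rintro _ ⟨Q, hn, rfl⟩
    exact h Q.1 hn Q.2
  · refine hr _ (Or.inr (Or.inr ⟨(X, i), hf, rfl⟩)) ?_
    rintro _ ⟨n, hn, rfl⟩
    exact h n hn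

/-! ### Archimedean semirings with one infinite element -/

/-- Linearly ordered semirings that embed into `[0, ∞]`: nonnegative, nondegenerate, Archimedean
for the order with numerals cancellable, and with at most one element above all numerals. -/
class ArchimedeanSemiring (Q : Type*) [CommSemiring Q] [LinearOrder Q] : Prop extends
    IsOrderedRing Q where
  nonneg : ∀ x : Q, 0 ≤ x
  not_one_le_zero : ¬ (1 : Q) ≤ 0
  add_cancel : ∀ (n : ℕ) (x y : Q), x + n ≤ y + n → x ≤ y
  mul_cancel : ∀ (n : ℕ) (x y : Q), 1 ≤ n → n * x ≤ n * y → x ≤ y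
  conv : ∀ x y : Q, (∀ n : ℕ, 1 ≤ n → n * x ≤ n * y + 1) → x ≤ y
  finite_or_top : ∀ x : Q, (∃ n : ℕ, x ≤ n) ∨ ∀ y, y ≤ x

namespace ArchimedeanSemiring

variable {Q : Type*} [CommSemiring Q] [LinearOrder Q] [ArchimedeanSemiring Q]

theorem natCast_le {m n : ℕ} : (m : Q) ≤ n ↔ m ≤ n := by
  refine ⟨fun h => ?_, fun h => Nat.mono_cast h⟩
  by_contra! hlt
  obtain ⟨k, rfl⟩ := Nat.exists_eq_add_of_lt hlt
  have h1 : ((k : Q) + 1) + n ≤ 0 + n := by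
    calc ((k : Q) + 1) + n = ((n + k + 1 : ℕ) : Q) := by push_cast; ring
      _ ≤ n := h
      _ = 0 + n := by ring
  have h2 := add_cancel _ _ _ h1
  exact not_one_le_zero (Q := Q) (le_trans (le_add_of_nonneg_left (nonneg _)) h2)

/-- The value in `[0, ∞]` of an element, as the supremum of its rational lower bounds. -/
noncomputable def toENNReal (x : Q) : ℝ≥0∞ :=
  ⨆ (a : ℕ) (b : ℕ) (_ : 1 ≤ b) (_ : (a : Q) ≤ b * x), (a / b : ℝ≥0∞)

theorem div_le_toENNReal {x : Q} {a b : ℕ} (hb : 1 ≤ b) (h : (a : Q) ≤ b * x) :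
    (a / b : ℝ≥0∞) ≤ toENNReal x :=
  le_iSup_of_le a (le_iSup_of_le b (le_iSup_of_le hb (le_iSup_of_le h le_rfl)))

theorem div_le_div_iff_nat {a b a' b' : ℕ} (hb : 1 ≤ b) (hb' : 1 ≤ b') :
    (a' / b' : ℝ≥0∞) ≤ a / b ↔ a' * b ≤ a * b' := by
  have h1 : (b : ℝ≥0∞) ≠ 0 := by exact_mod_cast (by omega : b ≠ 0)
  have h2 : (b' : ℝ≥0∞) ≠ 0 := by exact_mod_cast (by omega : b' ≠ 0)
  rw [ENNReal.div_le_iff h2 (ENNReal.natCast_ne_top _), div_eq_mul_inv, mul_right_comm,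
    ← div_eq_mul_inv, ENNReal.le_div_iff_mul_le (Or.inl h1) (Or.inl (ENNReal.natCast_ne_top _))]
  exact_mod_cast Iff.rfl

theorem toENNReal_le_div {x : Q} {a b : ℕ} (hb : 1 ≤ b) (h : b * x ≤ (a : Q)) :
    toENNReal x ≤ (a / b : ℝ≥0∞) := by
  refine iSup_le fun a' => iSup_le fun b' => iSup_le fun hb' => iSup_le fun h' => ?_
  rw [div_le_div_iff_nat hb hb', ← natCast_le (Q := Q)]
  push_cast
  calc (a' : Q) * b ≤ (b' * x) * b := mul_le_mul_of_nonneg_right h' (nonneg _)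
    _ = (b * x) * b' := by ring
    _ ≤ a * b' := mul_le_mul_of_nonneg_right h (nonneg _)

theorem toENNReal_mono {x y : Q} (h : x ≤ y) : toENNReal x ≤ toENNReal y :=
  iSup_le fun _ => iSup_le fun _ => iSup_le fun hb => iSup_le fun h' =>
    div_le_toENNReal hb (h'.trans (mul_le_mul_of_nonneg_left h (nonneg _)))

theorem toENNReal_natCast (n : ℕ) : toENNReal (n : Q) = n := by
  apply le_antisymm
  · simpa using toENNReal_le_div (x := (n : Q)) (a := n) (b := 1) le_rfl (by simp)
  · simpa using div_le_toENNReal (x := (n : Q)) (a := n) (b := 1) le_rfl (by simp)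

theorem toENNReal_zero : toENNReal (0 : Q) = 0 := by simpa using toENNReal_natCast (Q := Q) 0

theorem toENNReal_one : toENNReal (1 : Q) = 1 := by simpa using toENNReal_natCast (Q := Q) 1

theorem exists_floor {x : Q} (hx : ∃ n : ℕ, x ≤ n) (n : ℕ) :
    ∃ p : ℕ, (p : Q) ≤ n * x ∧ n * x ≤ p + 1 := by
  classical
  obtain ⟨K, hK⟩ := hx
  have hex : ∃ p : ℕ, n * x ≤ p + 1 := by
    refine ⟨n * K, ?_⟩
    push_cast
    exact (mul_le_mul_of_nonneg_left hK (nonneg _)).trans (le_add_of_nonneg_right zero_le_one)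
  refine ⟨Nat.find hex, ?_, Nat.find_spec hex⟩
  rcases hp : Nat.find hex with _ | m
  · simpa using nonneg _
  · have := Nat.find_min hex (m := m) (by omega)
    push_cast
    exact (not_le.1 this).le

theorem toENNReal_lt {x y : Q} (h : x < y) : toENNReal x < toENNReal y := by
  have hx : ∃ n : ℕ, x ≤ n := (finite_or_top x).resolve_right fun h' => h.not_ge (h' y)
  have : ∃ n : ℕ, 1 ≤ n ∧ n * x + 1 < n * y := by
    by_contra! hc
    exact h.not_ge (conv _ _ fun n hn => hc n hn)
  obtain ⟨n, hn, hlt⟩ := this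
  -- Rounding at denominator `2 n` leaves a gap between the two approximations.
  obtain ⟨p, hp, hp'⟩ := exists_floor hx (2 * n)
  have h2n : 1 ≤ 2 * n := by omega
  refine (toENNReal_le_div (a := p + 1) h2n (by simpa using hp')).trans_lt
    (lt_of_lt_of_le (b := ((p + 2 : ℕ) / (2 * n : ℕ) : ℝ≥0∞)) ?_ (div_le_toENNReal h2n ?_))
  · rw [← not_le, div_le_div_iff_nat h2n h2n, not_le]
    exact Nat.mul_lt_mul_of_pos_right (by omega) (by omega)
  · push_cast at hp ⊢
    calc (p : Q) + 2 ≤ 2 * n * x + 2 := by gcongr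
      _ = 2 * (n * x + 1) := by ring
      _ ≤ 2 * (n * y) := mul_le_mul_of_nonneg_left hlt.le (nonneg _)
      _ = 2 * n * y := by ring

theorem toENNReal_le_iff {x y : Q} : toENNReal x ≤ toENNReal y ↔ x ≤ y :=
  ⟨fun h => not_lt.1 fun h' => h.not_gt (toENNReal_lt h'), toENNReal_mono⟩

theorem toENNReal_injective : Function.Injective (toENNReal : Q → ℝ≥0∞) := fun _ _ h =>
  le_antisymm (toENNReal_le_iff.1 h.le) (toENNReal_le_iff.1 h.ge)

theorem toENNReal_eq_top {x : Q} (h : ∀ n : ℕ, (n : Q) ≤ x) : toENNReal x = ∞ := by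
  refine ENNReal.eq_top_of_forall_nnreal_le fun r => ?_
  obtain ⟨n, hn⟩ := exists_nat_ge r
  calc (r : ℝ≥0∞) ≤ n := by exact_mod_cast hn
    _ = toENNReal (n : Q) := (toENNReal_natCast n).symm
    _ ≤ _ := toENNReal_mono (h n)

theorem le_of_forall_le_add_div {α β : ℝ≥0∞} (K : ℕ)
    (h : ∀ n : ℕ, 1 ≤ n → α ≤ β + K / n) : α ≤ β := by
  have hlim : Filter.Tendsto (fun n : ℕ => β + (K / n : ℝ≥0∞)) Filter.atTop (nhds (β + 0)) := by
    refine tendsto_const_nhds.add ?_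
    simpa using ENNReal.Tendsto.const_div (a := (K : ℝ≥0∞)) ENNReal.tendsto_nat_nhds_top
      (Or.inr (ENNReal.natCast_ne_top K))
  rw [add_zero] at hlim
  exact ge_of_tendsto hlim (Filter.eventually_atTop.2 ⟨1, h⟩)

theorem toENNReal_add (x y : Q) : toENNReal (x + y) = toENNReal x + toENNReal y := by
  by_cases hx : ∃ n : ℕ, x ≤ n
  · by_cases hy : ∃ n : ℕ, y ≤ n
    · have key : ∀ n : ℕ, 1 ≤ n → ∃ p q : ℕ, (p / n : ℝ≥0∞) ≤ toENNReal x ∧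
          toENNReal x ≤ ((p + 1 : ℕ) / n : ℝ≥0∞) ∧ (q / n : ℝ≥0∞) ≤ toENNReal y ∧
          toENNReal y ≤ ((q + 1 : ℕ) / n : ℝ≥0∞) ∧ ((p + q : ℕ) / n : ℝ≥0∞) ≤ toENNReal (x + y) ∧
          toENNReal (x + y) ≤ ((p + q + 2 : ℕ) / n : ℝ≥0∞) := by
        intro n hn
        obtain ⟨p, hp, hp'⟩ := exists_floor hx n
        obtain ⟨q, hq, hq'⟩ := exists_floor hy n
        refine ⟨p, q, div_le_toENNReal hn hp, toENNReal_le_div hn (by simpa using hp'),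
          div_le_toENNReal hn hq, toENNReal_le_div hn (by simpa using hq'),
          div_le_toENNReal hn ?_, toENNReal_le_div hn ?_⟩
        · push_cast
          rw [mul_add]
          exact add_le_add hp hq
        · push_cast
          calc n * (x + y) = n * x + n * y := mul_add _ _ _
            _ ≤ (p + 1) + (q + 1) := add_le_add hp' hq'
            _ = p + q + 2 := by ring
      apply le_antisymm
      · refine le_of_forall_le_add_div 2 fun n hn => ?_
        obtain ⟨p, q, h1, -, h3, -, -, h6⟩ := key n hn
        refine h6.trans ?_
        push_cast
        rw [ENNReal.add_div, ENNReal.add_div]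
        gcongr
      · refine le_of_forall_le_add_div 2 fun n hn => ?_
        obtain ⟨p, q, -, h2, -, h4, h5, -⟩ := key n hn
        refine (add_le_add h2 h4).trans (le_trans ?_ (add_le_add_left h5 _))
        push_cast
        rw [← ENNReal.add_div, ← ENNReal.add_div]
        refine le_of_eq ?_
        congr 1
        ring
    · have h := (finite_or_top y).resolve_left hy
      rw [toENNReal_eq_top (fun n => h _), toENNReal_eq_top (x := x + y), add_top]
      exact fun n => (h _).trans (le_add_of_nonneg_left (nonneg _))
  · have h := (finite_or_top x).resolve_left hx
    rw [toENNReal_eq_top (fun n => h _), toENNReal_eq_top (x := x + y), top_add]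
    exact fun n => (h _).trans (le_add_of_nonneg_right (nonneg _))

theorem exists_one_le_mul {y : Q} (hy : y ≠ 0) : ∃ n : ℕ, 1 ≤ n ∧ 1 ≤ n * y := by
  by_contra! hc
  refine hy (le_antisymm (conv _ _ fun n hn => ?_) (nonneg _))
  simpa using (hc n hn).le

theorem toENNReal_top_mul {x y : Q} (h : ∀ z, z ≤ x) (hy : y ≠ 0) : toENNReal (x * y) = ∞ := by
  obtain ⟨n, hn, hle⟩ := exists_one_le_mul hy
  refine toENNReal_eq_top fun m => mul_cancel n _ _ hn ?_
  calc (n : Q) * m ≤ x := h _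
    _ = x * 1 := (mul_one _).symm
    _ ≤ x * (n * y) := mul_le_mul_of_nonneg_left hle (nonneg _)
    _ = n * (x * y) := by ring

theorem toENNReal_ne_zero {x : Q} (hx : x ≠ 0) : toENNReal x ≠ 0 := fun h =>
  hx (toENNReal_injective (h.trans toENNReal_zero.symm))

theorem toENNReal_mul_of_top {x y : Q} (h : ∀ z, z ≤ x) :
    toENNReal (x * y) = toENNReal x * toENNReal y := by
  by_cases hy : y = 0
  · simp [hy, toENNReal_zero]
  · rw [toENNReal_top_mul h hy, toENNReal_eq_top fun n => h _,
      ENNReal.top_mul (toENNReal_ne_zero hy)]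

theorem toENNReal_mul (x y : Q) : toENNReal (x * y) = toENNReal x * toENNReal y := by
  rcases finite_or_top x with hx | hx
  · rcases finite_or_top y with hy | hy
    · obtain ⟨K, hK⟩ := hx
      obtain ⟨K', hK'⟩ := hy
      have key : ∀ n : ℕ, 1 ≤ n → ∃ p q : ℕ, p ≤ n * K ∧ q ≤ n * K' ∧
          (p / n : ℝ≥0∞) ≤ toENNReal x ∧
          toENNReal x ≤ ((p + 1 : ℕ) / n : ℝ≥0∞) ∧ (q / n : ℝ≥0∞) ≤ toENNReal y ∧
          toENNReal y ≤ ((q + 1 : ℕ) / n : ℝ≥0∞) ∧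
          ((p * q : ℕ) / (n * n : ℕ) : ℝ≥0∞) ≤ toENNReal (x * y) ∧
          toENNReal (x * y) ≤ (((p + 1) * (q + 1) : ℕ) / (n * n : ℕ) : ℝ≥0∞) := by
        intro n hn
        obtain ⟨p, hp, hp'⟩ := exists_floor ⟨K, hK⟩ n
        obtain ⟨q, hq, hq'⟩ := exists_floor ⟨K', hK'⟩ n
        have hnn : 1 ≤ n * n := Nat.mul_le_mul hn hn
        refine ⟨p, q, ?_, ?_, div_le_toENNReal hn hp, toENNReal_le_div hn (by simpa using hp'),
          div_le_toENNReal hn hq, toENNReal_le_div hn (by simpa using hq'),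
          div_le_toENNReal hnn ?_, toENNReal_le_div hnn ?_⟩
        · rw [← natCast_le (Q := Q)]
          push_cast
          exact hp.trans (mul_le_mul_of_nonneg_left hK (nonneg _))
        · rw [← natCast_le (Q := Q)]
          push_cast
          exact hq.trans (mul_le_mul_of_nonneg_left hK' (nonneg _))
        · push_cast
          calc (p : Q) * q ≤ (n * x) * (n * y) := mul_le_mul hp hq (nonneg _) (nonneg _)
            _ = n * n * (x * y) := by ring
        · push_cast
          calc n * n * (x * y) = (n * x) * (n * y) := by ring
            _ ≤ (p + 1) * (q + 1) := mul_le_mul hp' hq' (nonneg _) (nonneg _)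
      have gap : ∀ n p q : ℕ, 1 ≤ n → p ≤ n * K → q ≤ n * K' →
          (((p + 1) * (q + 1) : ℕ) / (n * n : ℕ) : ℝ≥0∞) ≤
            ((p * q : ℕ) / (n * n : ℕ) : ℝ≥0∞) + ((K + K' + 1 : ℕ) : ℝ≥0∞) / n := by
        intro n p q hn hp hq
        have hnn : 1 ≤ n * n := Nat.mul_le_mul hn hn
        have h1 : (((p + 1) * (q + 1) : ℕ) / (n * n : ℕ) : ℝ≥0∞) =
            ((p * q : ℕ) / (n * n : ℕ) : ℝ≥0∞) + ((p + q + 1 : ℕ) / (n * n : ℕ) : ℝ≥0∞) := by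
          rw [← ENNReal.add_div]
          congr 1
          push_cast
          ring
        rw [h1]
        refine add_le_add_right ((div_le_div_iff_nat hn hnn).2 ?_) _
        calc (p + q + 1) * n ≤ (n * K + n * K' + n) * n := by gcongr
          _ = (K + K' + 1) * (n * n) := by ring
      have split : ∀ n a b : ℕ, ((a * b : ℕ) / (n * n : ℕ) : ℝ≥0∞) = a / n * (b / n) := by
        intro n a b
        push_cast
        rw [div_eq_mul_inv, div_eq_mul_inv, div_eq_mul_inv, ENNReal.mul_inv (by simp) (by simp)]
        ring
      apply le_antisymm
      · refine le_of_forall_le_add_div (K + K' + 1) fun n hn => ?_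
        obtain ⟨p, q, hp, hq, h1, -, h3, -, -, h6⟩ := key n hn
        refine (h6.trans (gap n p q hn hp hq)).trans ?_
        rw [split]
        gcongr
      · refine le_of_forall_le_add_div (K + K' + 1) fun n hn => ?_
        obtain ⟨p, q, hp, hq, -, h2, -, h4, h5, -⟩ := key n hn
        refine ((mul_le_mul' h2 h4).trans ?_).trans (add_le_add_left h5 _)
        rw [← split]
        exact gap n p q hn hp hq
    · rw [mul_comm x y, toENNReal_mul_of_top hy, mul_comm]
  · exact toENNReal_mul_of_top hx

end ArchimedeanSemiring

/-! ### The ordered semiring of a complete theory -/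

namespace CompleteTheory

variable {A : Set (Formula V B)} {fin : Prop} {T : Set (Formula V B)}

section Connectives

variable (hT : CompleteTheory A fin T)
include hT

open Formula

theorem poly {φ : Formula V B} (h : AxPoly φ) (hc : φ.Closed) : φ ∈ T := hT.ax (.poly φ h) hc

theorem mem_imp {φ ψ : Formula V B} (hφ : φ.Closed) (hψ : ψ.Closed) :
    imp φ ψ ∈ T ↔ (φ ∈ T → ψ ∈ T) := by
  rw [imp, hT.neg_iff (by simp [hφ, hψ]), hT.and_iff hφ (by simp [hψ]), hT.neg_iff hψ]
  tauto

theorem mem_or {φ ψ : Formula V B} (hφ : φ.Closed) (hψ : ψ.Closed) :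
    Formula.or φ ψ ∈ T ↔ (φ ∈ T ∨ ψ ∈ T) := by
  rw [Formula.or, hT.neg_iff (by simp [hφ, hψ]), hT.and_iff (by simp [hφ]) (by simp [hψ]),
    hT.neg_iff hφ, hT.neg_iff hψ]
  tauto

theorem mem_formulaIff {φ ψ : Formula V B} (hφ : φ.Closed) (hψ : ψ.Closed) :
    iff φ ψ ∈ T ↔ (φ ∈ T ↔ ψ ∈ T) := by
  rw [iff, hT.and_iff (by simp [hφ, hψ]) (by simp [hφ, hψ]), hT.mem_imp hφ hψ, hT.mem_imp hψ hφ]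
  tauto

theorem mem_approx {t s : Term V B} (ht : t.Closed) (hs : s.Closed) :
    approx t s ∈ T ↔ (ge t s ∈ T ∧ ge s t ∈ T) :=
  hT.and_iff (by simp [ht, hs]) (by simp [ht, hs])

theorem mem_gt {t s : Term V B} (ht : t.Closed) (hs : s.Closed) :
    gt t s ∈ T ↔ (ge t s ∈ T ∧ ge s t ∉ T) := by
  rw [gt, hT.and_iff (by simp [ht, hs]) (by simp [ht, hs]), hT.neg_iff (by simp [ht, hs])]

theorem ge_refl {t : Term V B} (ht : t.Closed) : ge t t ∈ T := by
  have := hT.poly (.total t t) (by simp [ht])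
  rwa [hT.mem_or (by simp [ht]) (by simp [ht]), or_self] at this

theorem mem_conj {l : List (Formula V B)} (hl : ∀ φ ∈ l, φ.Closed) :
    conj l ∈ T ↔ ∀ φ ∈ l, φ ∈ T := by
  induction l with
  | nil => simpa [conj] using hT.ge_refl Term.closed_one
  | cons a l ih =>
    have h : conj (a :: l) = and a (conj l) := rfl
    rw [h, hT.and_iff (hl a (by simp)) (closed_conj fun φ hφ => hl φ (by simp [hφ])),
      ih fun φ hφ => hl φ (by simp [hφ])]
    simp

end Connectives

/-- Closed terms, to be compared by the inequalities in a complete theory. -/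
structure PreValue (_ : CompleteTheory A fin T) : Type u where
  term : Term V B
  closed : term.Closed

namespace PreValue

variable {hT : CompleteTheory A fin T}

instance : Preorder (PreValue hT) where
  le t s := Formula.ge s.1 t.1 ∈ T
  le_refl t := hT.ge_refl t.2
  le_trans t s r h h' := by
    have := hT.poly (.trans r.1 s.1 t.1) (by simp [t.2, s.2, r.2])
    rw [hT.mem_imp (by simp [t.2, s.2, r.2]) (by simp [t.2, r.2]),
      hT.and_iff (by simp [s.2, r.2]) (by simp [t.2, s.2])] at this
    exact this ⟨h', h⟩

instance : Add (PreValue hT) := ⟨fun t s => ⟨.add t.1 s.1, Term.closed_add.2 ⟨t.2, s.2⟩⟩⟩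
instance : Mul (PreValue hT) := ⟨fun t s => ⟨.mul t.1 s.1, Term.closed_mul.2 ⟨t.2, s.2⟩⟩⟩
instance : Zero (PreValue hT) := ⟨⟨.zero, Term.closed_zero⟩⟩
instance : One (PreValue hT) := ⟨⟨.one, Term.closed_one⟩⟩

theorem antisymmRel {t s : PreValue hT} (h : AxPoly (Formula.approx t.1 s.1)) :
    AntisymmRel (· ≤ ·) t s := by
  have := hT.poly h (by simp [t.2, s.2])
  rw [hT.mem_approx t.2 s.2] at this
  exact ⟨this.2, this.1⟩

theorem add_comm (t s : PreValue hT) : AntisymmRel (· ≤ ·) (t + s) (s + t) :=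
  antisymmRel (.addComm _ _)

theorem mul_comm (t s : PreValue hT) : AntisymmRel (· ≤ ·) (t * s) (s * t) :=
  antisymmRel (.mulComm _ _)

theorem add_zero (t : PreValue hT) : AntisymmRel (· ≤ ·) (t + 0) t :=
  antisymmRel (.addZero _)

theorem mul_zero (t : PreValue hT) : AntisymmRel (· ≤ ·) (t * 0) 0 :=
  antisymmRel (.mulZero _)

theorem add_le_add_right {t s : PreValue hT} (h : t ≤ s) (r : PreValue hT) : t + r ≤ s + r := by
  have := hT.poly (.addMono s.1 t.1 r.1) (by simp [t.2, s.2, r.2])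
  rw [hT.mem_imp (by simp [t.2, s.2]) (by simp [t.2, s.2, r.2])] at this
  exact this h

theorem add_le_add {t s t' s' : PreValue hT} (h : t ≤ s) (h' : t' ≤ s') : t + t' ≤ s + s' :=
  (add_le_add_right h t').trans ((add_comm _ _).1.trans
    ((add_le_add_right h' s).trans (add_comm _ _).1))

theorem nonneg (t : PreValue hT) : 0 ≤ t := 
  hT.poly (.nonNeg t.1) (Formula.closed_ge.2 ⟨t.2, Term.closed_zero⟩)

theorem mul_le_mul_right {t s : PreValue hT} (h : t ≤ s) (r : PreValue hT) : t * r ≤ s * r := by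
  have h1 := hT.poly (.sub s.1 t.1 r.1 .zero) (by simp [t.2, s.2, r.2])
  rw [hT.mem_imp (by simp [t.2, s.2, r.2]) (by simp [t.2, s.2, r.2]),
    hT.and_iff (by simp [t.2, s.2]) (by simp [r.2])] at h1
  have h2 : s * 0 + t * r ≤ s * r + t * 0 := h1 ⟨h, nonneg r⟩
  calc t * r ≤ t * r + 0 := (add_zero _).2
    _ ≤ t * r + s * 0 := add_le_add le_rfl (mul_zero s).2
    _ ≤ s * 0 + t * r := (add_comm _ _).1
    _ ≤ s * r + t * 0 := h2
    _ ≤ s * r + 0 := add_le_add le_rfl (mul_zero t).1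
    _ ≤ s * r := (add_zero _).1

theorem mul_le_mul {t s t' s' : PreValue hT} (h : t ≤ s) (h' : t' ≤ s') : t * t' ≤ s * s' :=
  (mul_le_mul_right h t').trans ((mul_comm _ _).1.trans
    ((mul_le_mul_right h' s).trans (mul_comm _ _).1))

theorem total (t s : PreValue hT) : t ≤ s ∨ s ≤ t := by
  have := hT.poly (.total t.1 s.1) (by simp [t.2, s.2])
  rw [hT.mem_or (by simp [t.2, s.2]) (by simp [t.2, s.2])] at this
  exact this.symm

end PreValue

/-- Closed terms modulo provable equality in a complete theory. -/
def Value (hT : CompleteTheory A fin T) : Type u := Antisymmetrization (PreValue hT) (· ≤ ·)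

namespace Value

variable {hT : CompleteTheory A fin T}

instance : PartialOrder (Value hT) :=
  inferInstanceAs (PartialOrder (Antisymmetrization (PreValue hT) (· ≤ ·)))

def mk (t : PreValue hT) : Value hT := toAntisymmetrization (· ≤ ·) t

theorem mk_le_mk {t s : PreValue hT} : mk t ≤ mk s ↔ t ≤ s :=
  toAntisymmetrization_le_toAntisymmetrization_iff

theorem mk_eq_mk {t s : PreValue hT} : mk t = mk s ↔ AntisymmRel (· ≤ ·) t s := Quotient.eq

theorem mk_surjective : Function.Surjective (mk : PreValue hT → Value hT) :=
  Quotient.mk_surjective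

noncomputable instance : LinearOrder (Value hT) :=
  { (inferInstance : PartialOrder (Value hT)) with
    le_total := by
      intro a b
      obtain ⟨a, rfl⟩ := mk_surjective a
      obtain ⟨b, rfl⟩ := mk_surjective b
      exact (PreValue.total a b).imp mk_le_mk.2 mk_le_mk.2
    toDecidableLE := Classical.decRel _ }

instance : Add (Value hT) := ⟨Quotient.map₂ (· + ·) fun _ _ h _ _ h' =>
  ⟨PreValue.add_le_add h.1 h'.1, PreValue.add_le_add h.2 h'.2⟩⟩
instance : Mul (Value hT) := ⟨Quotient.map₂ (· * ·) fun _ _ h _ _ h' =>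
  ⟨PreValue.mul_le_mul h.1 h'.1, PreValue.mul_le_mul h.2 h'.2⟩⟩
instance : Zero (Value hT) := ⟨mk 0⟩
instance : One (Value hT) := ⟨mk 1⟩

protected theorem add_comm (a b : Value hT) : a + b = b + a := by
  obtain ⟨a, rfl⟩ := mk_surjective a
  obtain ⟨b, rfl⟩ := mk_surjective b
  exact mk_eq_mk.2 (PreValue.add_comm a b)

protected theorem mul_comm (a b : Value hT) : a * b = b * a := by
  obtain ⟨a, rfl⟩ := mk_surjective a
  obtain ⟨b, rfl⟩ := mk_surjective b
  exact mk_eq_mk.2 (PreValue.mul_comm a b)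

protected theorem add_zero (a : Value hT) : a + 0 = a := by
  obtain ⟨a, rfl⟩ := mk_surjective a
  exact mk_eq_mk.2 (PreValue.add_zero a)

protected theorem mul_zero (a : Value hT) : a * 0 = 0 := by
  obtain ⟨a, rfl⟩ := mk_surjective a
  exact mk_eq_mk.2 (PreValue.mul_zero a)

protected theorem mul_one (a : Value hT) : a * 1 = a := by
  obtain ⟨a, rfl⟩ := mk_surjective a
  exact mk_eq_mk.2 (PreValue.antisymmRel (.mulOne _))

protected theorem mul_add (a b c : Value hT) : a * (b + c) = a * b + a * c := by
  obtain ⟨a, rfl⟩ := mk_surjective a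
  obtain ⟨b, rfl⟩ := mk_surjective b
  obtain ⟨c, rfl⟩ := mk_surjective c
  exact mk_eq_mk.2 (PreValue.antisymmRel (.distrib _ _ _))

noncomputable instance : CommSemiring (Value hT) where
  add_assoc a b c := by
    obtain ⟨a, rfl⟩ := mk_surjective a
    obtain ⟨b, rfl⟩ := mk_surjective b
    obtain ⟨c, rfl⟩ := mk_surjective c
    exact mk_eq_mk.2 (PreValue.antisymmRel (.addAssoc _ _ _))
  zero_add a := by rw [Value.add_comm, Value.add_zero]
  add_zero := Value.add_zero
  nsmul := nsmulRec
  add_comm := Value.add_comm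
  left_distrib := Value.mul_add
  right_distrib a b c := by
    rw [Value.mul_comm, Value.mul_add, Value.mul_comm c, Value.mul_comm c]
  zero_mul a := by rw [Value.mul_comm, Value.mul_zero]
  mul_zero := Value.mul_zero
  mul_assoc a b c := by
    obtain ⟨a, rfl⟩ := mk_surjective a
    obtain ⟨b, rfl⟩ := mk_surjective b
    obtain ⟨c, rfl⟩ := mk_surjective c
    exact mk_eq_mk.2 (PreValue.antisymmRel (.mulAssoc _ _ _))
  one_mul a := by rw [Value.mul_comm, Value.mul_one]
  mul_one := Value.mul_one
  mul_comm := Value.mul_comm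

theorem nonneg (a : Value hT) : 0 ≤ a := by
  obtain ⟨a, rfl⟩ := mk_surjective a
  exact mk_le_mk.2 (PreValue.nonneg a)

instance : IsOrderedRing (Value hT) where
  add_le_add_left a b h c := by
    obtain ⟨a, rfl⟩ := mk_surjective a
    obtain ⟨b, rfl⟩ := mk_surjective b
    obtain ⟨c, rfl⟩ := mk_surjective c
    exact mk_le_mk.2 (PreValue.add_le_add_right (mk_le_mk.1 h) c)
  zero_le_one := nonneg 1
  mul_le_mul_of_nonneg_left a _ b c h := by
    obtain ⟨a, rfl⟩ := mk_surjective a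
    obtain ⟨b, rfl⟩ := mk_surjective b
    obtain ⟨c, rfl⟩ := mk_surjective c
    exact mk_le_mk.2 (PreValue.mul_le_mul le_rfl (mk_le_mk.1 h))
  mul_le_mul_of_nonneg_right c _ a b h := by
    obtain ⟨a, rfl⟩ := mk_surjective a
    obtain ⟨b, rfl⟩ := mk_surjective b
    obtain ⟨c, rfl⟩ := mk_surjective c
    exact mk_le_mk.2 (PreValue.mul_le_mul (mk_le_mk.1 h) le_rfl)

end Value

/-! ### Values of closed terms -/

section Val

variable (hT : CompleteTheory A fin T)

open Classical in
/-- The class of a closed term; zero for terms that are not closed. -/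
noncomputable def val (t : Term V B) : Value hT := if h : t.Closed then Value.mk ⟨t, h⟩ else 0

theorem val_of_closed {t : Term V B} (h : t.Closed) : hT.val t = Value.mk ⟨t, h⟩ := dif_pos h

theorem exists_val (q : Value hT) : ∃ t : Term V B, t.Closed ∧ hT.val t = q := by
  obtain ⟨t, rfl⟩ := Value.mk_surjective q
  exact ⟨t.1, t.2, hT.val_of_closed t.2⟩

theorem val_le_val {t s : Term V B} (ht : t.Closed) (hs : s.Closed) :
    hT.val s ≤ hT.val t ↔ Formula.ge t s ∈ T := by
  rw [hT.val_of_closed ht, hT.val_of_closed hs, Value.mk_le_mk]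
  rfl

theorem val_add {t s : Term V B} (ht : t.Closed) (hs : s.Closed) :
    hT.val (.add t s) = hT.val t + hT.val s := by
  rw [hT.val_of_closed ht, hT.val_of_closed hs, hT.val_of_closed (Term.closed_add.2 ⟨ht, hs⟩)]
  rfl

theorem val_mul {t s : Term V B} (ht : t.Closed) (hs : s.Closed) :
    hT.val (.mul t s) = hT.val t * hT.val s := by
  rw [hT.val_of_closed ht, hT.val_of_closed hs, hT.val_of_closed (Term.closed_mul.2 ⟨ht, hs⟩)]
  rfl

@[simp] theorem val_zero : hT.val .zero = 0 := hT.val_of_closed Term.closed_zero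

@[simp] theorem val_one : hT.val .one = 1 := hT.val_of_closed Term.closed_one

@[simp] theorem val_num (n : ℕ) : hT.val (.num n) = n := by
  induction n with
  | zero => simp [Term.num]
  | succ n ih => rw [Term.num, val_add _ (by simp) (by simp), ih]; simp

theorem val_finSum {l : List (Term V B)} (hl : ∀ t ∈ l, t.Closed) :
    hT.val (.finSum l) = (l.map hT.val).sum := by
  induction l with
  | nil => simp [Term.finSum]
  | cons a l ih =>
    have h : Term.finSum (a :: l) = .add a (Term.finSum l) := rfl
    have hl' : ∀ t ∈ l, t.Closed := fun t ht => hl t (by simp [ht])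
    rw [h, hT.val_add (hl a (by simp)) (Term.closed_finSum.2 hl'), ih hl']
    simp

theorem val_eq_of_approx {t s : Term V B} (ht : t.Closed) (hs : s.Closed)
    (h : Formula.approx t s ∈ T) : hT.val t = hT.val s := by
  rw [hT.mem_approx ht hs] at h
  exact le_antisymm ((hT.val_le_val hs ht).2 h.2) ((hT.val_le_val ht hs).2 h.1)

theorem le_of_forall_mul_le (x y : Value hT) (h : ∀ n : ℕ, 1 ≤ n → n * x ≤ n * y + 1) :
    x ≤ y := by
  obtain ⟨t, ht, rfl⟩ := hT.exists_val x
  obtain ⟨s, hs, rfl⟩ := hT.exists_val y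
  rw [hT.val_le_val hs ht]
  refine hT.conv ht hs fun n hn => ?_
  rw [Formula.le, ← hT.val_le_val (by simp [hs]) (by simp [ht]), hT.val_mul (by simp) ht,
    hT.val_add (by simp [hs]) (by simp), hT.val_mul (by simp) hs]
  simpa using h n hn

theorem not_one_le_zero : ¬ (1 : Value hT) ≤ 0 := by
  rw [← hT.val_one, ← hT.val_zero, hT.val_le_val (by simp) (by simp),
    ← hT.neg_iff (by simp)]
  exact hT.poly .nonDeg (by simp)

theorem le_of_add_natCast_le (n : ℕ) (x y : Value hT) (h : x + n ≤ y + n) : x ≤ y := by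
  obtain ⟨t, ht, rfl⟩ := hT.exists_val x
  obtain ⟨s, hs, rfl⟩ := hT.exists_val y
  have h1 := hT.poly (.addCancel s t _ (Term.sumFree_num n)) (by simp [ht, hs])
  rw [hT.mem_imp (by simp [ht, hs]) (by simp [ht, hs]), ← hT.val_le_val (by simp [hs])
    (by simp [ht]), hT.val_add hs (by simp), hT.val_add ht (by simp), hT.val_num,
    ← hT.val_le_val hs ht] at h1
  exact h1 h

theorem one_le_natCast {n : ℕ} (hn : 1 ≤ n) : (1 : Value hT) ≤ n := by
  obtain ⟨m, rfl⟩ := Nat.exists_eq_add_of_le hn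
  push_cast
  exact le_add_of_nonneg_right (Value.nonneg _)

theorem le_of_natCast_mul_le (n : ℕ) (x y : Value hT) (hn : 1 ≤ n) (h : n * x ≤ n * y) :
    x ≤ y := by
  obtain ⟨t, ht, rfl⟩ := hT.exists_val x
  obtain ⟨s, hs, rfl⟩ := hT.exists_val y
  have h1 := hT.poly (.mulCancel s t _ (Term.sumFree_num n)) (by simp [ht, hs])
  rw [hT.mem_imp (by simp [ht, hs]) (by simp [ht, hs]), hT.and_iff (by simp) (by simp [ht, hs]),
    hT.mem_gt (by simp) (by simp), ← hT.val_le_val (by simp) (by simp),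
    ← hT.val_le_val (by simp) (by simp), ← hT.val_le_val (by simp [hs])
    (by simp [ht]), hT.val_mul hs (by simp), hT.val_mul ht (by simp), hT.val_num,
    ← hT.val_le_val hs ht, hT.val_zero] at h1
  refine h1 ⟨⟨Value.nonneg _, fun h0 => ?_⟩, by rwa [mul_comm _ (n : Value hT),
    mul_comm _ (n : Value hT)]⟩
  exact hT.not_one_le_zero ((hT.one_le_natCast hn).trans h0)

end Val

/-! ### Probabilities of closed base formulas -/

section Prob

variable (hT : CompleteTheory A fin T)

open Base

theorem val_pr_congr {δ ε : Base V B} (hδ : δ.Closed) (hε : ε.Closed) (h : δ.TautEquiv ε) :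
    hT.val (.pr δ) = hT.val (.pr ε) :=
  hT.val_eq_of_approx (by simp [hδ]) (by simp [hε]) (hT.poly (.dist δ ε h) (by simp [hδ, hε]))

theorem val_pr_add {δ ε : Base V B} (hδ : δ.Closed) (hε : ε.Closed) :
    hT.val (.pr (and δ ε)) + hT.val (.pr (and δ (neg ε))) = hT.val (.pr δ) := by
  rw [← hT.val_add (by simp [hδ, hε]) (by simp [hδ, hε])]
  exact hT.val_eq_of_approx (by simp [hδ, hε]) (by simp [hδ])
    (hT.poly (.additivity δ ε) (by simp [hδ, hε]))

theorem val_pr_mono {δ ε : Base V B} (hδ : δ.Closed) (hε : ε.Closed)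
    (h : ∀ p, δ.Eval p → ε.Eval p) : hT.val (.pr δ) ≤ hT.val (.pr ε) := by
  rw [← hT.val_pr_add hε hδ, hT.val_pr_congr hδ (ε := and ε δ) (by simp [hδ, hε]) fun p => by
    have := h p
    simp
    tauto]
  exact le_add_of_nonneg_right (Value.nonneg _)

theorem val_pr_le_one {δ : Base V B} (hδ : δ.Closed) : hT.val (.pr δ) ≤ 1 := by
  rw [← hT.val_one]
  exact hT.val_pr_mono hδ (by simp) fun p _ => trivial

theorem val_pr_or_le {δ α β : Base V B} (hδ : δ.Closed) (hα : α.Closed) (hβ : β.Closed)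
    (h : ∀ p, δ.Eval p → α.Eval p ∨ β.Eval p) :
    hT.val (.pr δ) ≤ hT.val (.pr α) + hT.val (.pr β) := by
  rw [← hT.val_pr_add hδ hα]
  refine add_le_add (hT.val_pr_mono (by simp [hδ, hα]) hα fun p hp => hp.2)
    (hT.val_pr_mono (by simp [hδ, hα]) hβ fun p hp => ?_)
  exact (h p hp.1).resolve_left hp.2

theorem val_pr_eq_zero {δ : Base V B} (hδ : δ.Closed) (h : ∀ p, ¬ δ.Eval p) :
    hT.val (.pr δ) = 0 := by
  rw [← hT.val_zero]
  exact hT.val_pr_congr hδ (by simp) fun p => by simp [h p]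

/-- The constants of `X` that a theory takes to be equal. -/
def cstSetoid (X : V) : Setoid (Cst B) where
  r c c' := Formula.eq X (.const c) (.const c') ∈ T
  iseqv :=
    { refl := fun c => hT.ax (.eqReflex X c) (by simp)
      symm := fun {c c'} h => by
        have h1 := hT.ax (.eqReplace X c c' 0 (.eq X (.var 0) (.const c)))
          (by simp [Formula.substC, Sym.subst])
        rw [hT.mem_imp (by simp) (by simp [Formula.substC, Sym.subst])] at h1
        simp only [Formula.substC, Sym.subst] at h1
        have h2 := h1 h
        simp only [and_self, ↓reduceIte, reduceCtorEq, and_false] at h2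
        rw [hT.mem_imp (by simp) (by simp)] at h2
        exact h2 (hT.ax (.eqReflex X c) (by simp))
      trans := fun {c c' c''} h h' => by
        have h1 := hT.ax (.eqReplace X c' c'' 0 (.eq X (.const c) (.var 0)))
          (by simp [Formula.substC, Sym.subst])
        rw [hT.mem_imp (by simp) (by simp [Formula.substC, Sym.subst])] at h1
        simp only [Formula.substC, Sym.subst] at h1
        have h2 := h1 h'
        simp only [and_self, ↓reduceIte, reduceCtorEq, and_false] at h2
        rw [hT.mem_imp (by simp) (by simp)] at h2
        exact h2 h }

theorem val_pr_atom_and_atom {X : V} {c c' : Cst B} (h : ¬ hT.cstSetoid X c c') :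
    hT.val (.pr (and (atom X (.const c)) (atom X (.const c')))) = 0 := by
  have h1 := hT.ax (.eqDist X c c') (by simp)
  rw [hT.mem_imp (by simp) (by simp), hT.neg_iff (by simp)] at h1
  rw [← hT.val_zero]
  exact hT.val_eq_of_approx (by simp) (by simp) (h1 h)

theorem val_pr_atom_and_not_atom {X : V} {c c' : Cst B} (h : hT.cstSetoid X c c') :
    hT.val (.pr (and (atom X (.const c)) (neg (atom X (.const c'))))) = 0 := by
  have hsub : ∀ d, Formula.substC X 0 d
      (.approx (.pr (and (atom X (.var 0)) (neg (atom X (.const c'))))) .zero) =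
      .approx (.pr (and (atom X (.const d)) (neg (atom X (.const c'))))) (.zero : Term V B) := by
    intro d
    have htop : Cond.subst X 0 d Cond.top = Cond.top := rfl
    simp [Formula.approx, Formula.le, Formula.substC, Term.substC, Term.subst, Base.subst,
      Term.pr, Term.zero, Base.bot, htop]
  have h1 := hT.ax (.eqReplace X c' c 0
    (.approx (.pr (and (atom X (.var 0)) (neg (atom X (.const c'))))) .zero))
    (by rw [hsub, hsub]; simp)
  rw [hsub, hsub, hT.mem_imp (by simp) (by simp), hT.mem_imp (by simp) (by simp)] at h1
  rw [← hT.val_zero]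
  refine hT.val_eq_of_approx (by simp) (by simp) (h1 ((hT.cstSetoid X).symm h) ?_)
  exact hT.poly (.dist _ _ fun p => by simp) (by simp)

/-- Equality of events up to probability zero, according to the theory. -/
structure AlmostEq (δ ε : Base V B) : Prop where
  closed_left : δ.Closed
  closed_right : ε.Closed
  left : hT.val (.pr (and δ (neg ε))) = 0
  right : hT.val (.pr (and ε (neg δ))) = 0

variable {hT}

theorem AlmostEq.refl {δ : Base V B} (h : δ.Closed) : hT.AlmostEq δ δ :=
  ⟨h, h, hT.val_pr_eq_zero (by simp [h]) (by simp), hT.val_pr_eq_zero (by simp [h]) (by simp)⟩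

theorem AlmostEq.neg {δ ε : Base V B} (h : hT.AlmostEq δ ε) : hT.AlmostEq (neg δ) (neg ε) := by
  have h1 := h.closed_left
  have h2 := h.closed_right
  refine ⟨by simp [h1], by simp [h2], ?_, ?_⟩
  · rw [← h.right]
    exact hT.val_pr_congr (by simp [h1, h2]) (by simp [h1, h2]) fun p => by simp; tauto
  · rw [← h.left]
    exact hT.val_pr_congr (by simp [h1, h2]) (by simp [h1, h2]) fun p => by simp; tauto

theorem AlmostEq.and {δ ε δ' ε' : Base V B} (h : hT.AlmostEq δ ε) (h' : hT.AlmostEq δ' ε') :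
    hT.AlmostEq (and δ δ') (and ε ε') := by
  have h1 := h.closed_left
  have h2 := h.closed_right
  have h3 := h'.closed_left
  have h4 := h'.closed_right
  refine ⟨by simp [h1, h3], by simp [h2, h4], ?_, ?_⟩
  · refine le_antisymm ?_ (Value.nonneg _)
    refine (hT.val_pr_or_le (α := .and δ (.neg ε)) (β := .and δ' (.neg ε')) (by simp [h1, h2, h3, h4])
      (by simp [h1, h2]) (by simp [h3, h4]) fun p => by simp; tauto).trans_eq ?_
    rw [h.left, h'.left, add_zero]
  · refine le_antisymm ?_ (Value.nonneg _)
    refine (hT.val_pr_or_le (α := .and ε (.neg δ)) (β := .and ε' (.neg δ')) (by simp [h1, h2, h3, h4])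
      (by simp [h1, h2]) (by simp [h3, h4]) fun p => by simp; tauto).trans_eq ?_
    rw [h.right, h'.right, add_zero]

theorem AlmostEq.symm {δ ε : Base V B} (h : hT.AlmostEq δ ε) : hT.AlmostEq ε δ :=
  ⟨h.2, h.1, h.4, h.3⟩

theorem AlmostEq.val_pr_le {δ ε : Base V B} (h : hT.AlmostEq δ ε) :
    hT.val (.pr δ) ≤ hT.val (.pr ε) := by
  have h1 := h.closed_left
  have h2 := h.closed_right
  refine (hT.val_pr_or_le (β := .and δ (.neg ε)) h1 h2 (by simp [h1, h2]) fun p => by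
    simp; tauto).trans_eq ?_
  rw [h.left, add_zero]

theorem AlmostEq.val_pr_eq {δ ε : Base V B} (h : hT.AlmostEq δ ε) :
    hT.val (.pr δ) = hT.val (.pr ε) :=
  le_antisymm h.val_pr_le h.symm.val_pr_le

theorem AlmostEq.subst {ε ε' : Base V B} (h : hT.AlmostEq ε ε') {X : V} {i : ℕ} {δ : Base V B}
    (hδ : ∀ Y j, δ.Free Y j → Y = X ∧ j = i) :
    hT.AlmostEq (Base.subst X i ε δ) (Base.subst X i ε' δ) := by
  induction δ with
  | top => exact .refl (by simp [Base.subst])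
  | atom Y d =>
    unfold Base.subst
    split_ifs with h'
    · exact h
    · refine .refl fun Z k hZ => h' ?_
      obtain ⟨rfl, rfl⟩ := hδ _ _ hZ
      exact hZ
  | neg δ ih => exact (ih hδ).neg
  | and δ δ' ih ih' =>
    exact (ih fun Y j hY => hδ Y j (Or.inl hY)).and (ih' fun Y j hY => hδ Y j (Or.inr hY))

theorem almostEq_disj_atom {X : V} {l : List (Cst B)} {c : Cst B} (hc : c ∈ l)
    (hl : ∀ c' ∈ l, hT.cstSetoid X c' c) :
    hT.AlmostEq (disj (l.map fun c => atom X (.const c))) (atom X (.const c)) := by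
  refine ⟨by simp, by simp, ?_, ?_⟩
  · have key : ∀ l : List (Cst B), (∀ c' ∈ l, hT.cstSetoid X c' c) → hT.val (.pr
        (.and (disj (l.map fun c => atom X (.const c))) (.neg (atom X (.const c))))) = 0 := by
      intro l hl
      induction l with
      | nil => exact hT.val_pr_eq_zero (by simp [disj]) (by simp [disj])
      | cons a l ih =>
        refine le_antisymm ?_ (Value.nonneg _)
        refine (hT.val_pr_or_le (α := .and (atom X (.const a)) (.neg (atom X (.const c))))
          (β := .and (disj (l.map fun c => atom X (.const c))) (.neg (atom X (.const c))))
          ?_ (by simp) (by simp) fun p => ?_).trans_eq ?_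
        · exact closed_and.2 ⟨closed_disj_atom X (a :: l), by simp⟩
        · simp
          tauto
        · rw [hT.val_pr_atom_and_not_atom (hl a (by simp)), ih fun c' h => hl c' (by simp [h]),
            add_zero]
    exact key l hl
  · refine hT.val_pr_eq_zero (by simp) fun p => ?_
    simp only [eval_and, eval_atom, eval_neg, eval_disj, List.mem_map, not_and, not_not]
    exact fun hp => ⟨_, ⟨c, hc, rfl⟩, hp⟩

variable (hT)

/-- A conditional probability is the largest value whose product with the probability of the
condition is at most that of the conjunction. -/
theorem le_val_prob_iff {δ : Base V B} {κ : Cond V B} (hδ : δ.Closed) (hκ : κ.Closed)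
    (q : Value hT) :
    q ≤ hT.val (.prob δ κ) ↔ q * hT.val (.pr κ.toBase) ≤ hT.val (.pr (and δ κ.toBase)) := by
  obtain ⟨t, ht, rfl⟩ := hT.exists_val q
  have hκ' := Cond.closed_toBase hκ
  have h1 := hT.ax (.cond δ κ t) (by simp [hδ, hκ, ht, hκ'])
  rw [hT.mem_formulaIff (by simp [hδ, hκ, ht]) (by simp [hδ, ht, hκ']),
    ← hT.val_le_val (by simp [hδ, hκ]) ht, ← hT.val_le_val (by simp [hδ, hκ'])
    (by simp [ht, hκ']), hT.val_mul ht (by simp [hκ'])] at h1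
  exact h1

theorem val_pr_cond_ne_zero {κ : Cond V B} (hκ : κ.Closed) : hT.val (.pr κ.toBase) ≠ 0 := by
  have hκ' := Cond.closed_toBase hκ
  have h1 := hT.ax (.pos κ) (by simp [hκ'])
  rw [hT.mem_gt (by simp [hκ']) (by simp), ← hT.val_le_val (by simp [hκ']) (by simp),
    ← hT.val_le_val (by simp) (by simp [hκ']), hT.val_zero] at h1
  exact fun h => h1.2 h.le

end Prob

end CompleteTheory

/-! ### Commuting substitutions -/

theorem Base.subst_comm {X Y : V} {i j : ℕ} {ε η : Base V B} (hε : ε.Closed) (hη : η.Closed)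
    (hne : ¬ (Y = X ∧ j = i)) (δ : Base V B) :
    Base.subst Y j η (Base.subst X i ε δ) = Base.subst X i ε (Base.subst Y j η δ) := by
  induction δ with
  | top => rfl
  | atom Z d =>
    by_cases h : Z = X ∧ d = .var i
    · have h' : ¬ (Z = Y ∧ d = .var j) := by
        rintro ⟨rfl, rfl⟩
        exact hne ⟨h.1, by simpa using h.2⟩
      simp only [Base.subst, if_pos h, if_neg h']
      exact subst_eq_self (hε Y j)
    · by_cases h' : Z = Y ∧ d = .var j
      · simp only [Base.subst, if_pos h', if_neg h]
        exact (subst_eq_self (hη X i)).symm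
      · simp only [Base.subst, if_neg h', if_neg h]
  | neg δ ih => simp only [Base.subst, ih]
  | and δ δ' ih ih' => simp only [Base.subst, ih, ih']

theorem Sym.subst_comm {X Y : V} {i j : ℕ} (c d : Cst B) (hne : ¬ (Y = X ∧ j = i)) (Z : V)
    (e : Sym B) : (e.subst X i c Z).subst Y j d Z = (e.subst Y j d Z).subst X i c Z := by
  have hc : ∀ (W : V) (k : ℕ) (a b : Cst B), (Sym.const b).subst W k a Z = .const b :=
    fun W k a b => if_neg (by simp)
  by_cases h : Z = X ∧ e = .var i
  · have h' : ¬ (Z = Y ∧ e = .var j) := by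
      rintro ⟨rfl, rfl⟩
      exact hne ⟨h.1, by simpa using h.2⟩
    have h1 : e.subst X i c Z = .const c := if_pos h
    have h2 : e.subst Y j d Z = e := if_neg h'
    rw [h1, h2, h1, hc]
  · have h1 : e.subst X i c Z = e := if_neg h
    by_cases h' : Z = Y ∧ e = .var j
    · have h2 : e.subst Y j d Z = .const d := if_pos h'
      rw [h1, h2, hc]
    · have h2 : e.subst Y j d Z = e := if_neg h'
      rw [h1, h2, h1]

theorem Cond.subst_comm {X Y : V} {i j : ℕ} (c d : Cst B) (hne : ¬ (Y = X ∧ j = i))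
    (κ : Cond V B) : (κ.subst X i c).subst Y j d = (κ.subst Y j d).subst X i c := by
  simp only [Cond.subst, Cond.mk.injEq, List.map_map]
  refine List.map_congr_left fun l _ => ?_
  simp only [Function.comp_apply, Lit.subst, Sym.subst_comm c d hne]

theorem Term.subst_comm {X Y : V} {i j : ℕ} {ε η : Base V B} (hε : ε.Closed) (hη : η.Closed)
    (c d : Cst B) (hne : ¬ (Y = X ∧ j = i)) (t : Term V B) :
    (t.subst X i ε c).subst Y j η d = (t.subst Y j η d).subst X i ε c := by
  induction t with
  | prob δ κ => simp only [Term.subst, Base.subst_comm hε hη hne, Cond.subst_comm c d hne]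
  | sum Z k t ih =>
    by_cases h : Z = X ∧ k = i
    · have h' : ¬ (Z = Y ∧ k = j) := fun h' => hne ⟨h'.1.symm.trans h.1, h'.2.symm.trans h.2⟩
      have h1 : ∀ t, (Term.sum Z k t).subst X i ε c = .sum Z k t := fun t => if_pos h
      have h2 : ∀ t, (Term.sum Z k t).subst Y j η d = .sum Z k (t.subst Y j η d) :=
        fun t => if_neg h'
      rw [h1, h2, h1]
    · have h1 : ∀ t, (Term.sum Z k t).subst X i ε c = .sum Z k (t.subst X i ε c) :=
        fun t => if_neg h
      by_cases h' : Z = Y ∧ k = j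
      · have h2 : ∀ t, (Term.sum Z k t).subst Y j η d = .sum Z k t := fun t => if_pos h'
        rw [h1, h2, h2, h1]
      · have h2 : ∀ t, (Term.sum Z k t).subst Y j η d = .sum Z k (t.subst Y j η d) :=
          fun t => if_neg h'
        rw [h1, h2, h2, h1, ih]
  | add t s ih ih' => simp only [Term.subst, ih, ih']
  | mul t s ih ih' => simp only [Term.subst, ih, ih']

/-- The nesting depth of a term above its probabilities; substitutions preserve it. -/
def Term.rank : Term V B → ℕ
  | .prob _ _ => 0
  | .sum _ _ t => t.rank + 1
  | .add t s => max t.rank s.rank + 1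
  | .mul t s => max t.rank s.rank + 1

@[simp] theorem Term.rank_subst (X : V) (i : ℕ) (ε : Base V B) (c : Cst B) (t : Term V B) :
    (t.subst X i ε c).rank = t.rank := by
  induction t with
  | prob δ κ => rfl
  | sum Z k t ih =>
    unfold Term.subst
    split_ifs
    · rfl
    · simp [Term.rank, ih]
  | add t s ih ih' => simp [Term.subst, Term.rank, ih, ih']
  | mul t s ih ih' => simp [Term.subst, Term.rank, ih, ih']

@[simp] theorem Term.rank_substC (X : V) (i : ℕ) (c : Cst B) (t : Term V B) :
    (t.substC X i c).rank = t.rank := Term.rank_subst X i _ c t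

namespace CompleteTheory

variable {A : Set (Formula V B)} {fin : Prop} {T : Set (Formula V B)}
variable (hT : CompleteTheory A fin T)

/-! ### Sums as suprema of partial sums -/

/-- Finite sets of constants of `X` that the theory takes to be distinct. -/
def Distinct (X : V) (F : Finset (Cst B)) : Prop :=
  ∀ c ∈ F, ∀ c' ∈ F, hT.cstSetoid X c c' → c = c'

/-- The value of a term does not change when the event substituted for a variable is replaced
by one that the theory considers almost equal. -/
def Replaceable (t : Term V B) : Prop :=
  ∀ (X : V) (i : ℕ) (ε ε' : Base V B) (c : Cst B), hT.AlmostEq ε ε' → (Term.sum X i t).Closed →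
    hT.val (t.subst X i ε c) = hT.val (t.subst X i ε' c)

variable {hT}

theorem sum_le_val_sum {X : V} {i : ℕ} {t : Term V B} (ht : (Term.sum X i t).Closed)
    {F : Finset (Cst B)} (hF : hT.Distinct X F) :
    ∑ c ∈ F, hT.val (t.substC X i c) ≤ hT.val (.sum X i t) := by
  have hcl : ∀ s ∈ F.toList.map fun c => t.substC X i c, s.Closed := by
    intro s hs
    obtain ⟨c, -, rfl⟩ := List.mem_map.1 hs
    exact ht.substC c
  have h1 := hT.ax (.sumLower X i t F)
    (by simp only [Formula.closed_imp, Formula.closed_ge, Term.closed_finSum, ht, true_and]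
        exact ⟨Formula.closed_distinctness X F, hcl⟩)
  rw [hT.mem_imp (Formula.closed_distinctness X F)
    (Formula.closed_ge.2 ⟨ht, Term.closed_finSum.2 hcl⟩),
    ← hT.val_le_val ht (Term.closed_finSum.2 hcl), hT.val_finSum hcl, List.map_map] at h1
  rw [← Finset.sum_map_toList]
  refine h1 ?_
  rw [distinctness, hT.mem_conj]
  · intro φ hφ
    obtain ⟨p, hp, rfl⟩ := List.mem_map.1 hφ
    rw [Finset.mem_toList, Finset.mem_offDiag] at hp
    rw [hT.neg_iff (by simp)]
    exact fun h => hp.2.2 (hF _ hp.1 _ hp.2.1 h)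
  · intro φ hφ
    obtain ⟨p, -, rfl⟩ := List.mem_map.1 hφ
    simp

theorem mem_partitionFormula {X : V} {n : ℕ} {Q : Finpartition (firstCst B n)} :
    partitionFormula X Q ∈ T ↔ ∀ c ∈ firstCst B n, ∀ c' ∈ firstCst B n,
      (hT.cstSetoid X c c' ↔ ∃ S ∈ Q.parts, c ∈ S ∧ c' ∈ S) := by
  rw [partitionFormula, hT.mem_conj]
  · simp only [List.mem_map, Finset.mem_toList, Finset.mem_product, Prod.exists,
      forall_exists_index, and_imp]
    constructor
    · intro h c hc c' hc'
      have := h _ c c' hc hc' rfl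
      split_ifs at this with h'
      · exact iff_of_true this h'
      · exact iff_of_false ((hT.neg_iff (by simp)).1 this) h'
    · rintro h _ c c' hc hc' rfl
      have := h c hc c' hc'
      split_ifs with h'
      · exact this.2 h'
      · exact (hT.neg_iff (by simp)).2 fun h'' => h' (this.1 h'')
  · intro φ hφ
    obtain ⟨p, -, rfl⟩ := List.mem_map.1 hφ
    split_ifs <;> simp

theorem exists_val_partitionSum_eq {X : V} {i : ℕ} {t : Term V B} (ht : (Term.sum X i t).Closed)
    (hr : hT.Replaceable t) {n : ℕ} {Q : Finpartition (firstCst B n)}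
    (hQ : partitionFormula X Q ∈ T) :
    ∃ F, hT.Distinct X F ∧
      hT.val (partitionSum X i t Q) = ∑ c ∈ F, hT.val (t.substC X i c) := by
  classical
  rw [mem_partitionFormula (hT := hT)] at hQ
  let m : {S // S ∈ Q.parts} → Cst B := fun S => S.1.min' (Q.nonempty_of_mem_parts S.2)
  have hmin : ∀ S : {S // S ∈ Q.parts}, m S ∈ S.1 := fun S => S.1.min'_mem _
  have hsub : ∀ (S : {S // S ∈ Q.parts}) {c : Cst B}, c ∈ S.1 → c ∈ firstCst B n :=
    fun S c hc => Q.le S.2 hc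
  have hsep : ∀ S S' : {S // S ∈ Q.parts}, hT.cstSetoid X (m S) (m S') → S = S' := by
    intro S S' h
    obtain ⟨R, hR, h1, h2⟩ := (hQ _ (hsub S (hmin S)) _ (hsub S' (hmin S'))).1 h
    exact Subtype.ext ((Q.eq_of_mem_parts S.2 hR (hmin S) h1).trans
      (Q.eq_of_mem_parts hR S'.2 h2 (hmin S')))
  refine ⟨Q.parts.attach.image m, ?_, ?_⟩
  · intro c hc c' hc' h
    obtain ⟨S, -, rfl⟩ := Finset.mem_image.1 hc
    obtain ⟨S', -, rfl⟩ := Finset.mem_image.1 hc'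
    rw [hsep S S' h]
  · rw [Finset.sum_image fun S _ S' _ h => hsep S S' (by rw [h]), partitionSum,
      hT.val_finSum, List.map_map, Finset.sum_map_toList]
    · refine Finset.sum_congr rfl fun S _ => hr X i _ _ _ ?_ ht
      refine almostEq_disj_atom (Finset.mem_toList.2 (hmin S)) fun c' hc' => ?_
      rw [Finset.mem_toList] at hc'
      exact (hQ _ (hsub S hc') _ (hsub S (hmin S))).2 ⟨S.1, S.2, hc', hmin S⟩
    · intro s hs
      obtain ⟨S, -, rfl⟩ := List.mem_map.1 hs
      exact ht.subst (Base.closed_disj_atom X _) _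

theorem mul_val_sum_add_le_of_replaceable {X : V} {i : ℕ} {t : Term V B}
    (ht : (Term.sum X i t).Closed) (hr : hT.Replaceable t) (q s r : Value hT)
    (h : ∀ F, hT.Distinct X F → q * ∑ c ∈ F, hT.val (t.substC X i c) + s ≤ r) :
    q * hT.val (.sum X i t) + s ≤ r := by
  obtain ⟨q, hq, rfl⟩ := hT.exists_val q
  obtain ⟨s, hs, rfl⟩ := hT.exists_val s
  obtain ⟨r, hr', rfl⟩ := hT.exists_val r
  rw [← hT.val_mul hq ht, ← hT.val_add (by simp [hq, ht]) hs,
    hT.val_le_val hr' (by simp [hq, hs, ht])]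
  refine hT.sumUpper ht hq hs hr' fun n _ Q => ?_
  have hp := Term.closed_partitionSum ht Q
  rw [hT.mem_imp (Formula.closed_partitionFormula X Q) (by simp [hp, hq, hs, hr'])]
  intro hQ
  obtain ⟨F, hF, hval⟩ := exists_val_partitionSum_eq ht hr hQ
  rw [Formula.le, ← hT.val_le_val hr' (by simp [hp, hq, hs]), hT.val_add (by simp [hp, hq]) hs,
    hT.val_mul hq hp, hval]
  exact h F hF

theorem val_sum_le_of_replaceable {X : V} {i : ℕ} {t : Term V B}
    (ht : (Term.sum X i t).Closed) (hr : hT.Replaceable t) (r : Value hT)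
    (h : ∀ F, hT.Distinct X F → ∑ c ∈ F, hT.val (t.substC X i c) ≤ r) :
    hT.val (.sum X i t) ≤ r := by
  simpa using mul_val_sum_add_le_of_replaceable ht hr 1 0 r (by simpa using h)

/-- Below a summation sign the replacement has to be justified for bodies of smaller rank first:
two sums are equal when all instances of their bodies are. -/
theorem replaceable (t : Term V B) : hT.Replaceable t := by
  induction hn : t.rank using Nat.strong_induction_on generalizing t with
  | _ n ih =>
    subst hn
    intro X i ε ε' c h ht
    have hε := h.closed_left
    have hε' := h.closed_right
    cases t with
    | prob δ κ =>
      have hδ : ∀ Y j, δ.Free Y j → Y = X ∧ j = i := fun Y j hY => by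
        by_contra hne
        exact ht Y j ⟨Or.inl hY, fun h' => hne ⟨h'.1.symm, h'.2.symm⟩⟩
      have hκ : (κ.subst X i c).Closed := fun Y j hY =>
        ht Y j ⟨Or.inr (Cond.free_of_free_subst hY).1, (Cond.free_of_free_subst hY).2⟩
      have hκ' := Cond.closed_toBase hκ
      have h1 := h.subst hδ
      have h2 := (h1.and (.refl hκ')).val_pr_eq
      refine eq_of_forall_le_iff fun q => ?_
      simp only [Term.subst]
      rw [hT.le_val_prob_iff h1.closed_left hκ, hT.le_val_prob_iff h1.closed_right hκ, h2]
    | sum Y j t =>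
      unfold Term.subst
      split_ifs with hY
      · rfl
      have hcl : ∀ {η : Base V B}, η.Closed → (Term.sum Y j (t.subst X i η c)).Closed := by
        intro η hη
        have := ht.subst hη c
        rwa [Term.subst, if_neg hY] at this
      have key : ∀ {η η' : Base V B}, hT.AlmostEq η η' →
          hT.val (.sum Y j (t.subst X i η c)) ≤ hT.val (.sum Y j (t.subst X i η' c)) := by
        intro η η' h
        refine val_sum_le_of_replaceable (hcl h.closed_left) ?_ _ fun F hF => ?_
        · exact ih t.rank (by simp [Term.rank]) _ (by simp)
        · refine le_of_eq_of_le (Finset.sum_congr rfl fun d _ => ?_)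
            (sum_le_val_sum (hcl h.closed_right) hF)
          have hd := Base.closed_atom_const Y d
          have hne : ¬ (Y = X ∧ j = i) := hY
          rw [Term.substC, Term.substC, Term.subst_comm h.closed_left hd c d hne,
            Term.subst_comm h.closed_right hd c d hne]
          refine ih t.rank (by simp [Term.rank]) (t.substC Y j d) (by simp) X i η η' c h ?_
          intro Z k hZ
          have h3 := Term.free_of_free_subst hd hZ.1
          exact ht Z k ⟨⟨h3.1, h3.2⟩, hZ.2⟩
      exact le_antisymm (key h) (key h.symm)
    | add t s =>
      have h1 : (Term.sum X i t).Closed := fun Y j hY => ht Y j ⟨Or.inl hY.1, hY.2⟩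
      have h2 : (Term.sum X i s).Closed := fun Y j hY => ht Y j ⟨Or.inr hY.1, hY.2⟩
      simp only [Term.subst]
      rw [hT.val_add (h1.subst hε c) (h2.subst hε c), hT.val_add (h1.subst hε' c)
        (h2.subst hε' c),
        ih t.rank (by simp [Term.rank]) t rfl X i ε ε' c h h1,
        ih s.rank (by simp [Term.rank]) s rfl X i ε ε' c h h2]
    | mul t s =>
      have h1 : (Term.sum X i t).Closed := fun Y j hY => ht Y j ⟨Or.inl hY.1, hY.2⟩
      have h2 : (Term.sum X i s).Closed := fun Y j hY => ht Y j ⟨Or.inr hY.1, hY.2⟩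
      simp only [Term.subst]
      rw [hT.val_mul (h1.subst hε c) (h2.subst hε c), hT.val_mul (h1.subst hε' c)
        (h2.subst hε' c),
        ih t.rank (by simp [Term.rank]) t rfl X i ε ε' c h h1,
        ih s.rank (by simp [Term.rank]) s rfl X i ε ε' c h h2]

theorem mul_val_sum_add_le {X : V} {i : ℕ} {t : Term V B}
    (ht : (Term.sum X i t).Closed) (q s r : Value hT)
    (h : ∀ F, hT.Distinct X F → q * ∑ c ∈ F, hT.val (t.substC X i c) + s ≤ r) :
    q * hT.val (.sum X i t) + s ≤ r :=
  mul_val_sum_add_le_of_replaceable ht (replaceable t) q s r h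

/-! ### Finite and infinite values -/

theorem val_prob_finite {δ : Base V B} {κ : Cond V B} (h : (Term.prob δ κ).Closed) :
    ∃ n : ℕ, hT.val (.prob δ κ) ≤ n := by
  obtain ⟨hδ, hκ⟩ := Term.closed_prob.1 h
  have h1 := (hT.le_val_prob_iff hδ hκ _).1 le_rfl
  have h2 : hT.val (.pr (Base.and δ κ.toBase)) ≤ 1 :=
    hT.val_pr_le_one (by simp [hδ, Cond.closed_toBase hκ])
  have h3 : ∃ n : ℕ, 1 ≤ n ∧ (1 : Value hT) ≤ n * hT.val (.pr κ.toBase) := by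
    by_contra! hc
    refine hT.val_pr_cond_ne_zero hκ (le_antisymm (hT.le_of_forall_mul_le _ _ fun n hn => ?_)
      (Value.nonneg _))
    simpa using (hc n hn).le
  obtain ⟨n, -, hn⟩ := h3
  refine ⟨n, ?_⟩
  calc hT.val (.prob δ κ) = hT.val (.prob δ κ) * 1 := (mul_one _).symm
    _ ≤ hT.val (.prob δ κ) * (n * hT.val (.pr κ.toBase)) :=
        mul_le_mul_of_nonneg_left hn (Value.nonneg _)
    _ = n * (hT.val (.prob δ κ) * hT.val (.pr κ.toBase)) := by ring
    _ ≤ n * 1 := mul_le_mul_of_nonneg_left (h1.trans h2) (Value.nonneg _)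
    _ = n := mul_one _

theorem sum_finite {ι : Type*} (F : Finset ι) (f : ι → Value hT)
    (h : ∀ c ∈ F, ∃ n : ℕ, f c ≤ n) : ∃ n : ℕ, ∑ c ∈ F, f c ≤ n := by
  choose! g hg using h
  refine ⟨∑ c ∈ F, g c, ?_⟩
  push_cast
  exact Finset.sum_le_sum hg

/-- An infinite sum of finite terms absorbs addition and multiplication, since the rule for upper
bounds only tests finite partial sums; so by induction it bounds all terms. -/
theorem le_val_sum_of_infinite {X : V} {i : ℕ} {t : Term V B} (ht : (Term.sum X i t).Closed)
    (hfin : ∀ c, ∃ n : ℕ, hT.val (t.substC X i c) ≤ n)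
    (hinf : ∀ n : ℕ, (n : Value hT) ≤ hT.val (.sum X i t)) (s : Term V B) (hs : s.Closed) :
    hT.val s ≤ hT.val (.sum X i t) := by
  set I := hT.val (.sum X i t) with hI
  have hadd : I + I ≤ I := by
    have := mul_val_sum_add_le ht 2 0 I fun F hF => by
      obtain ⟨n, hn⟩ := sum_finite F _ fun c _ => hfin c
      calc 2 * ∑ c ∈ F, hT.val (t.substC X i c) + 0
          ≤ 2 * (n : Value hT) + 0 := by
            gcongr
            exact zero_le_two
        _ = ((2 * n : ℕ) : Value hT) := by push_cast; ring
        _ ≤ I := hinf _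
    rwa [← hI, add_zero, two_mul] at this
  have hnat : ∀ n : ℕ, n * I ≤ I := by
    intro n
    induction n with
    | zero => simpa using Value.nonneg I
    | succ n ih =>
      push_cast
      rw [add_mul, one_mul]
      exact (add_le_add_left ih I).trans hadd
  have hmul : I * I ≤ I := by
    have := mul_val_sum_add_le ht I 0 I fun F hF => by
      obtain ⟨n, hn⟩ := sum_finite F _ fun c _ => hfin c
      rw [add_zero]
      exact (mul_le_mul_of_nonneg_left hn (Value.nonneg I)).trans
        ((mul_comm _ _).trans_le (hnat n))
    rwa [← hI, add_zero] at this
  induction hn : s.rank using Nat.strong_induction_on generalizing s with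
  | _ n ih =>
    subst hn
    cases s with
    | prob δ κ =>
      obtain ⟨n, hn⟩ := val_prob_finite hs
      exact hn.trans (hinf n)
    | sum Y j s =>
      refine val_sum_le_of_replaceable hs (replaceable s) _ fun F _ => ?_
      calc ∑ c ∈ F, hT.val (s.substC Y j c) ≤ ∑ c ∈ F, I := Finset.sum_le_sum fun c _ =>
            ih s.rank (by simp [Term.rank]) _ (hs.substC c) (by simp)
        _ = F.card * I := by simp
        _ ≤ I := hnat _
    | add t s =>
      obtain ⟨h1, h2⟩ := Term.closed_add.1 hs
      rw [hT.val_add h1 h2]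
      exact (add_le_add (ih t.rank (by simp [Term.rank]) t h1 rfl)
        (ih s.rank (by simp [Term.rank]) s h2 rfl)).trans hadd
    | mul t s =>
      obtain ⟨h1, h2⟩ := Term.closed_mul.1 hs
      rw [hT.val_mul h1 h2]
      exact (mul_le_mul (ih t.rank (by simp [Term.rank]) t h1 rfl)
        (ih s.rank (by simp [Term.rank]) s h2 rfl) (Value.nonneg _)
        (Value.nonneg _)).trans hmul

theorem finite_or_top_mul {x y : Value hT} (hx : ∀ z, z ≤ x) :
    (∃ n : ℕ, x * y ≤ n) ∨ ∀ z, z ≤ x * y := by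
  by_cases h3 : ∃ n : ℕ, 1 ≤ n ∧ (1 : Value hT) ≤ n * y
  · obtain ⟨n, hn, hle⟩ := h3
    refine Or.inr fun z => hT.le_of_natCast_mul_le n _ _ hn ?_
    calc (n : Value hT) * z ≤ x := hx _
      _ = x * 1 := (mul_one _).symm
      _ ≤ x * (n * y) := mul_le_mul_of_nonneg_left hle (Value.nonneg _)
      _ = n * (x * y) := by ring
  · push Not at h3
    have hy : y = 0 := by
      refine le_antisymm (hT.le_of_forall_mul_le _ _ fun n hn => ?_) (Value.nonneg _)
      simpa using (h3 n hn).le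
    exact Or.inl ⟨0, by simp [hy]⟩

/-- Every closed term is bounded by a numeral or bounds all closed terms. -/
theorem val_finite_or_top (t : Term V B) (ht : t.Closed) :
    (∃ n : ℕ, hT.val t ≤ n) ∨ ∀ x, x ≤ hT.val t := by
  induction hn : t.rank using Nat.strong_induction_on generalizing t with
  | _ n ih =>
    subst hn
    cases t with
    | prob δ κ => exact Or.inl (val_prob_finite ht)
    | sum X i t =>
      by_cases h : ∃ c, ∀ x, x ≤ hT.val (t.substC X i c)
      · obtain ⟨c, hc⟩ := h
        refine Or.inr fun x => (hc x).trans ?_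
        have := sum_le_val_sum (hT := hT) ht (F := {c}) fun a ha b hb _ => by
          rw [Finset.mem_singleton.1 ha, Finset.mem_singleton.1 hb]
        simpa using this
      · push Not at h
        have hfin : ∀ c, ∃ n : ℕ, hT.val (t.substC X i c) ≤ n := fun c => by
          refine (ih t.rank (by simp [Term.rank]) _ (ht.substC c) (by simp)).resolve_right ?_
          obtain ⟨x, hx⟩ := h c
          exact fun h' => hx.not_ge (h' x)
        refine or_iff_not_imp_left.2 fun hinf x => ?_
        push Not at hinf
        obtain ⟨s, hs, rfl⟩ := hT.exists_val x
        exact le_val_sum_of_infinite ht hfin (fun n => (hinf n).le) s hs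
    | add t s =>
      obtain ⟨h1, h2⟩ := Term.closed_add.1 ht
      rw [hT.val_add h1 h2]
      rcases ih t.rank (by simp [Term.rank]) t h1 rfl with ⟨m, hm⟩ | h
      · rcases ih s.rank (by simp [Term.rank]) s h2 rfl with ⟨n, hn⟩ | h
        · refine Or.inl ⟨m + n, ?_⟩
          push_cast
          exact add_le_add hm hn
        · exact Or.inr fun x => (h x).trans (le_add_of_nonneg_left (Value.nonneg _))
      · exact Or.inr fun x => (h x).trans (le_add_of_nonneg_right (Value.nonneg _))
    | mul t s =>
      obtain ⟨h1, h2⟩ := Term.closed_mul.1 ht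
      rw [hT.val_mul h1 h2]
      rcases ih t.rank (by simp [Term.rank]) t h1 rfl with ⟨m, hm⟩ | h
      · rcases ih s.rank (by simp [Term.rank]) s h2 rfl with ⟨n, hn⟩ | h
        · refine Or.inl ⟨m * n, ?_⟩
          push_cast
          exact mul_le_mul hm hn (Value.nonneg _) (Value.nonneg _)
        · rw [mul_comm]
          exact finite_or_top_mul h
      · exact finite_or_top_mul h

instance : ArchimedeanSemiring (Value hT) where
  nonneg := Value.nonneg
  not_one_le_zero := hT.not_one_le_zero
  add_cancel := hT.le_of_add_natCast_le
  mul_cancel n x y hn h := hT.le_of_natCast_mul_le n x y hn h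
  conv := hT.le_of_forall_mul_le
  finite_or_top x := by
    obtain ⟨t, ht, rfl⟩ := hT.exists_val x
    exact val_finite_or_top t ht

end CompleteTheory

/-! ### Numerical values of closed terms -/

theorem exists_nat_mul_pow_between {k α β : ℝ≥0∞} (hk0 : k ≠ 0) (hk1 : k < 1) (hαβ : α < β)
    (hβ : β ≠ ∞) : ∃ m n : ℕ, α < m * k ^ n ∧ m * k ^ n ≤ β := by
  lift β to NNReal using hβ
  lift α to NNReal using (hαβ.trans ENNReal.coe_lt_top).ne
  lift k to NNReal using (hk1.trans ENNReal.one_lt_top).ne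
  norm_cast at hk0 hk1 hαβ ⊢
  obtain ⟨n, hn⟩ := exists_pow_lt_of_lt_one (tsub_pos_of_lt hαβ) hk1
  have hpos : 0 < k ^ n := pow_pos (pos_iff_ne_zero.2 hk0) n
  refine ⟨⌊α / k ^ n⌋₊ + 1, n, ?_, ?_⟩
  · have := Nat.lt_floor_add_one (α / k ^ n)
    rw [div_lt_iff₀ hpos] at this
    exact_mod_cast this
  · have h1 : (⌊α / k ^ n⌋₊ : NNReal) * k ^ n ≤ α := by
      rw [← le_div_iff₀ hpos]
      exact Nat.floor_le zero_le
    push_cast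
    rw [add_mul, one_mul]
    calc (⌊α / k ^ n⌋₊ : NNReal) * k ^ n + k ^ n ≤ α + (β - α) := add_le_add h1 hn.le
      _ = β := add_tsub_cancel_of_le hαβ.le

namespace CompleteTheory

open ArchimedeanSemiring

variable {A : Set (Formula V B)} {fin : Prop} {T : Set (Formula V B)}
variable (hT : CompleteTheory A fin T)

/-- The number in `[0, ∞]` that a complete theory assigns to a closed term. -/
noncomputable def num (t : Term V B) : ℝ≥0∞ := toENNReal (hT.val t)

theorem num_le_num {t s : Term V B} (ht : t.Closed) (hs : s.Closed) :
    hT.num s ≤ hT.num t ↔ Formula.ge t s ∈ T := by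
  rw [num, num, toENNReal_le_iff, hT.val_le_val ht hs]

theorem num_add {t s : Term V B} (ht : t.Closed) (hs : s.Closed) :
    hT.num (.add t s) = hT.num t + hT.num s := by
  rw [num, hT.val_add ht hs, toENNReal_add]
  rfl

theorem num_mul {t s : Term V B} (ht : t.Closed) (hs : s.Closed) :
    hT.num (.mul t s) = hT.num t * hT.num s := by
  rw [num, hT.val_mul ht hs, toENNReal_mul]
  rfl

theorem toENNReal_sum {ι : Type*} (F : Finset ι) (f : ι → Value hT) :
    toENNReal (∑ c ∈ F, f c) = ∑ c ∈ F, toENNReal (f c) := by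
  classical
  induction F using Finset.induction_on with
  | empty => simp [toENNReal_zero]
  | insert a F ha ih => rw [Finset.sum_insert ha, Finset.sum_insert ha, toENNReal_add, ih]

theorem toENNReal_pow (x : Value hT) (n : ℕ) : toENNReal (x ^ n) = toENNReal x ^ n := by
  induction n with
  | zero => simp [toENNReal_one]
  | succ n ih => rw [pow_succ, pow_succ, toENNReal_mul, ih]

theorem num_pr_le_one {δ : Base V B} (hδ : δ.Closed) : hT.num (.pr δ) ≤ 1 := by
  rw [← toENNReal_one (Q := Value hT)]
  exact toENNReal_mono (hT.val_pr_le_one hδ)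

/-- The values of terms are dense enough to turn the conditioning axiom into the quotient formula:
unless the condition has probability one, multiples of powers of its probability lie between any
two numbers. -/
theorem num_prob {δ : Base V B} {κ : Cond V B} (hδ : δ.Closed) (hκ : κ.Closed) :
    hT.num (.prob δ κ) = hT.num (.pr (.and δ κ.toBase)) / hT.num (.pr κ.toBase) := by
  have hκ' := Cond.closed_toBase hκ
  have hk0 : hT.num (.pr κ.toBase) ≠ 0 := toENNReal_ne_zero (hT.val_pr_cond_ne_zero hκ)
  have hk1 := hT.num_pr_le_one hκ'
  have hk : hT.num (.pr κ.toBase) ≠ ∞ := (hk1.trans_lt ENNReal.one_lt_top).ne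
  have hd : hT.num (.pr (.and δ κ.toBase)) ≠ ∞ :=
    ((hT.num_pr_le_one (by simp [hδ, hκ'])).trans_lt ENNReal.one_lt_top).ne
  have key : ∀ q : Value hT, toENNReal q ≤ hT.num (.prob δ κ) ↔
      toENNReal q * hT.num (.pr κ.toBase) ≤ hT.num (.pr (.and δ κ.toBase)) := fun q => by
    rw [num, num, num, toENNReal_le_iff, ← toENNReal_mul, toENNReal_le_iff,
      hT.le_val_prob_iff hδ hκ]
  refine le_antisymm ?_ ?_
  · rw [ENNReal.le_div_iff_mul_le (Or.inl hk0) (Or.inl hk)]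
    exact (key _).1 le_rfl
  · by_contra! hlt
    rcases hk1.lt_or_eq with hk1 | hk1
    · obtain ⟨m, n, h1, h2⟩ := exists_nat_mul_pow_between hk0 hk1 hlt (ENNReal.div_ne_top hd hk0)
      have hv : toENNReal ((m : Value hT) * hT.val (.pr κ.toBase) ^ n) =
          m * hT.num (.pr κ.toBase) ^ n := by
        rw [toENNReal_mul, toENNReal_natCast, toENNReal_pow]
        rfl
      refine h1.not_ge ?_
      rw [← hv, key, hv]
      exact (ENNReal.le_div_iff_mul_le (Or.inl hk0) (Or.inl hk)).1 h2
    · refine hlt.not_ge ?_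
      rw [hk1, div_one]
      exact (key (hT.val (.pr (.and δ κ.toBase)))).2 (by rw [hk1, mul_one]; rfl)

/-- The value of a sum is the supremum of the values of its finite partial sums. -/
theorem num_sum_eq_iSup {X : V} {i : ℕ} {t : Term V B} (ht : (Term.sum X i t).Closed) :
    hT.num (.sum X i t) =
      ⨆ (F : Finset (Cst B)) (_ : hT.Distinct X F), ∑ c ∈ F, hT.num (t.substC X i c) := by
  apply le_antisymm
  · set σ := ⨆ (F : Finset (Cst B)) (_ : hT.Distinct X F), ∑ c ∈ F, hT.num (t.substC X i c)
      with hσ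
    have hF : ∀ F, hT.Distinct X F → toENNReal (∑ c ∈ F, hT.val (t.substC X i c)) ≤ σ := by
      intro F hF
      rw [toENNReal_sum]
      exact le_iSup₂_of_le F hF le_rfl
    rcases eq_or_ne σ ∞ with h | h
    · rw [h]
      exact le_top
    · refine le_of_forall_le_add_div 1 fun n hn => ?_
      -- The numerator `a` rounds `σ * n` up.
      have hn0 : (n : ℝ≥0∞) ≠ 0 := by exact_mod_cast (by omega : n ≠ 0)
      have hnt : (n : ℝ≥0∞) ≠ ∞ := ENNReal.natCast_ne_top n
      obtain ⟨a, ha, ha'⟩ : ∃ a : ℕ, σ * n ≤ a ∧ (a : ℝ≥0∞) ≤ σ * n + 1 := by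
        clear_value σ
        lift σ to NNReal using h
        refine ⟨⌈σ * n⌉₊, ?_, ?_⟩
        · exact_mod_cast Nat.le_ceil (σ * n)
        · exact_mod_cast (Nat.ceil_lt_add_one zero_le).le
      have h1 : (n : Value hT) * hT.val (.sum X i t) ≤ a := by
        have := mul_val_sum_add_le ht (n : Value hT) 0 a fun F hF' => by
          rw [add_zero, ← toENNReal_le_iff, toENNReal_mul, toENNReal_natCast, toENNReal_natCast,
            mul_comm]
          exact (mul_le_mul_left (hF F hF') _).trans ha
        rwa [add_zero] at this
      refine (toENNReal_le_div hn h1).trans ?_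
      rw [ENNReal.div_le_iff hn0 hnt, add_mul, ENNReal.div_mul_cancel hn0 hnt]
      exact_mod_cast ha'
  · refine iSup₂_le fun F hF => ?_
    have := toENNReal_mono (sum_le_val_sum (hT := hT) ht hF)
    rwa [toENNReal_sum] at this

/-! ### The probability measure of a complete theory -/

end CompleteTheory

/-- Truth assignments to the atoms `X = c`. -/
abbrev Cantor (V : Type u) (B : ℕ∞) : Type u := V × Cst B → Bool

/-- The valuation of atoms given by a truth assignment; atoms with range variables are false. -/
def Cantor.valuation (ω : Cantor V B) : V → Sym B → Prop
  | X, .const c => ω (X, c) = true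
  | _, .var _ => False

/-- The clopen set of truth assignments that satisfy a base formula. -/
def Base.cantorSet (δ : Base V B) : Set (Cantor V B) := {ω | δ.Eval ω.valuation}

theorem Base.eval_congr_of_closed {δ : Base V B} (hδ : δ.Closed) {p p' : V → Sym B → Prop}
    (h : ∀ X c, p X (.const c) ↔ p' X (.const c)) : δ.Eval p ↔ δ.Eval p' := by
  induction δ with
  | top => exact Iff.rfl
  | atom X d =>
    cases d with
    | const c => exact h X c
    | var i => exact absurd ⟨rfl, rfl⟩ (hδ X i)
  | neg δ ih => exact not_congr (ih hδ)
  | and δ ε ih ih' => exact and_congr (ih (closed_and.1 hδ).1) (ih' (closed_and.1 hδ).2)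

theorem Base.cantorSet_subset_iff {δ ε : Base V B} (hδ : δ.Closed) (hε : ε.Closed) :
    δ.cantorSet ⊆ ε.cantorSet ↔ ∀ p, δ.Eval p → ε.Eval p := by
  classical
  refine ⟨fun h p hp => ?_, fun h ω => h _⟩
  let ω : Cantor V B := fun a => decide (p a.1 (.const a.2))
  have hω : ∀ X c, ω.valuation X (.const c) ↔ p X (.const c) := fun X c => decide_eq_true_iff
  exact (Base.eval_congr_of_closed hε hω).1 (h ((Base.eval_congr_of_closed hδ hω).2 hp))

theorem Base.isClopen_cantorSet (δ : Base V B) : IsClopen δ.cantorSet := by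
  induction δ with
  | top => exact isClopen_univ
  | atom X d =>
    cases d with
    | const c => exact (isClopen_discrete {true}).preimage (continuous_apply (X, c))
    | var i => exact isClopen_empty
  | neg δ ih => exact ih.compl
  | and δ ε ih ih' => exact ih.inter ih'

theorem Base.measurableSet_cantorSet (δ : Base V B) : MeasurableSet δ.cantorSet := by
  induction δ with
  | top => exact MeasurableSet.univ
  | atom X d =>
    cases d with
    | const c => exact measurable_pi_apply (X := fun _ : V × Cst B => Bool) (X, c) (.singleton true)
    | var i => exact MeasurableSet.empty
  | neg δ ih => exact ih.compl
  | and δ ε ih ih' => exact ih.inter ih'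

/-- The sets of truth assignments defined by closed base formulas. -/
def cantorSets (V : Type u) (B : ℕ∞) : Set (Set (Cantor V B)) :=
  Base.cantorSet '' {δ : Base V B | δ.Closed}

theorem isSetRing_cantorSets : IsSetRing (cantorSets V B) where
  empty_mem := ⟨.bot, by simp, by ext; simp [Base.cantorSet]⟩
  union_mem := by
    rintro _ _ ⟨δ, hδ : δ.Closed, rfl⟩ ⟨ε, hε : ε.Closed, rfl⟩
    exact ⟨.or δ ε, by simp [hδ, hε], by ext; simp [Base.cantorSet]⟩
  sdiff_mem := by
    rintro _ _ ⟨δ, hδ : δ.Closed, rfl⟩ ⟨ε, hε : ε.Closed, rfl⟩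
    exact ⟨.and δ (.neg ε), by simp [hδ, hε], by ext; simp [Base.cantorSet]⟩

theorem generateFrom_cantorSets :
    (inferInstance : MeasurableSpace (Cantor V B)) =
      MeasurableSpace.generateFrom (cantorSets V B) := by
  apply le_antisymm
  · refine iSup_le fun a => ?_
    rw [← measurable_iff_comap_le]
    refine @measurable_to_bool _ (MeasurableSpace.generateFrom (cantorSets V B)) _ ?_
    exact MeasurableSpace.measurableSet_generateFrom
      ⟨.atom a.1 (.const a.2), Base.closed_atom_const _ _, rfl⟩
  · refine MeasurableSpace.generateFrom_le ?_
    rintro _ ⟨δ, -, rfl⟩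
    exact δ.measurableSet_cantorSet

/-- Finitely additive functions on the clopen sets of a compact space are countably additive. -/
theorem isSigmaSubadditive_cantorSets (m : AddContent ℝ≥0∞ (cantorSets V B)) :
    m.IsSigmaSubadditive := by
  intro f hf hU
  have hopen : ∀ i, IsOpen (f i) := fun i => by
    obtain ⟨δ, -, h⟩ := hf i
    exact h ▸ δ.isClopen_cantorSet.isOpen
  have hcomp : IsCompact (⋃ i, f i) := by
    obtain ⟨δ, -, h⟩ := hU
    exact h ▸ δ.isClopen_cantorSet.isClosed.isCompact
  obtain ⟨t, ht⟩ := hcomp.elim_finite_subcover f hopen subset_rfl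
  have hring := isSetRing_cantorSets (V := V) (B := B)
  calc m (⋃ i, f i) ≤ m (⋃ i ∈ t, f i) :=
        addContent_mono hring.isSetSemiring hU (hring.biUnion_mem t fun i _ => hf i) ht
    _ ≤ ∑ i ∈ t, m (f i) := addContent_biUnion_le hring fun i _ => hf i
    _ ≤ _ := ENNReal.sum_le_tsum t

namespace CompleteTheory

open ArchimedeanSemiring

variable {A : Set (Formula V B)} {fin : Prop} {T : Set (Formula V B)}
variable (hT : CompleteTheory A fin T)

theorem num_pr_eq_of_cantorSet_eq {δ ε : Base V B} (hδ : δ.Closed) (hε : ε.Closed)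
    (h : δ.cantorSet = ε.cantorSet) : hT.num (.pr δ) = hT.num (.pr ε) := by
  rw [num, num, hT.val_pr_congr hδ hε fun p =>
    ⟨(Base.cantorSet_subset_iff hδ hε).1 h.le p, (Base.cantorSet_subset_iff hε hδ).1 h.ge p⟩]

open Classical in
/-- The probability of the event described by a set of truth assignments. -/
noncomputable def cantorFun (s : Set (Cantor V B)) : ℝ≥0∞ :=
  if h : s ∈ cantorSets V B then hT.num (.pr h.choose) else 0

theorem cantorFun_cantorSet {δ : Base V B} (hδ : δ.Closed) :
    hT.cantorFun δ.cantorSet = hT.num (.pr δ) := by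
  have h : δ.cantorSet ∈ cantorSets V B := ⟨δ, hδ, rfl⟩
  rw [cantorFun, dif_pos h]
  exact hT.num_pr_eq_of_cantorSet_eq h.choose_spec.1 hδ h.choose_spec.2

theorem num_pr_add {δ ε : Base V B} (hδ : δ.Closed) (hε : ε.Closed) :
    hT.num (.pr (.and δ ε)) + hT.num (.pr (.and δ (.neg ε))) = hT.num (.pr δ) := by
  rw [num, num, ← toENNReal_add, hT.val_pr_add hδ hε]
  rfl

/-- The additive content on clopen sets given by a complete theory. -/
noncomputable def cantorContent : AddContent ℝ≥0∞ (cantorSets V B) :=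
  isSetRing_cantorSets.addContent_of_union hT.cantorFun
    (by
      have h : (∅ : Set (Cantor V B)) = (Base.bot : Base V B).cantorSet := by
        ext
        simp [Base.cantorSet]
      rw [h, hT.cantorFun_cantorSet (by simp)]
      change toENNReal (hT.val .zero) = 0
      rw [hT.val_zero, toENNReal_zero])
    (by
      rintro _ _ ⟨δ, hδ : δ.Closed, rfl⟩ ⟨ε, hε : ε.Closed, rfl⟩ hdisj
      have h : δ.cantorSet ∪ ε.cantorSet = (Base.or δ ε).cantorSet := by
        ext
        simp [Base.cantorSet]
      rw [h, hT.cantorFun_cantorSet (by simp [hδ, hε]), hT.cantorFun_cantorSet hδ,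
        hT.cantorFun_cantorSet hε, ← hT.num_pr_add (ε := δ) (by simp [hδ, hε]) hδ]
      congr 1
      · refine hT.num_pr_eq_of_cantorSet_eq (by simp [hδ, hε]) hδ ?_
        ext ω
        simp only [Base.cantorSet, Base.eval_and, Base.eval_or, Set.mem_ofPred_eq]
        tauto
      · refine hT.num_pr_eq_of_cantorSet_eq (by simp [hδ, hε]) hε ?_
        ext ω
        have : ¬ (δ.Eval ω.valuation ∧ ε.Eval ω.valuation) := fun h' =>
          Set.disjoint_left.1 hdisj h'.1 h'.2
        simp only [Base.cantorSet, Base.eval_and, Base.eval_or, Base.eval_neg, Set.mem_ofPred_eq]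
        tauto)

/-- The measure on truth assignments given by a complete theory. -/
noncomputable def cantorMeasure : Measure (Cantor V B) :=
  hT.cantorContent.measure isSetRing_cantorSets.isSetSemiring generateFrom_cantorSets.le
    (isSigmaSubadditive_cantorSets _)

theorem cantorMeasure_cantorSet {δ : Base V B} (hδ : δ.Closed) :
    hT.cantorMeasure δ.cantorSet = hT.num (.pr δ) := by
  rw [cantorMeasure, AddContent.measure_eq _ _ generateFrom_cantorSets _ ⟨δ, hδ, rfl⟩]
  exact hT.cantorFun_cantorSet hδ

instance : IsProbabilityMeasure hT.cantorMeasure where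
  measure_univ := by
    have h : (Set.univ : Set (Cantor V B)) = (Base.top : Base V B).cantorSet := rfl
    rw [h, hT.cantorMeasure_cantorSet (by simp)]
    change toENNReal (hT.val .one) = 1
    rw [hT.val_one, toENNReal_one]

/-- The truth assignments that for each variable make the atoms `X = c` true for the constants in
exactly one class. -/
def regular : Set (Cantor V B) :=
  {ω | ∀ X, (∃ c, ω (X, c) = true) ∧
    ∀ c c', (ω (X, c) = true → (ω (X, c') = true ↔ hT.cstSetoid X c c'))}

theorem ae_exists_atom (c₀ : Cst B) (hc₀ : c₀.1 = 0) (X : V) :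
    ∀ᵐ ω ∂hT.cantorMeasure, ∃ c, ω (X, c) = true := by
  have hmeas : MeasurableSet {ω : Cantor V B | ∃ c, ω (X, c) = true} := by
    have : {ω : Cantor V B | ∃ c, ω (X, c) = true} =
        ⋃ c, (Base.atom X (.const c)).cantorSet := by
      ext ω
      simp [Base.cantorSet, Cantor.valuation]
    rw [this]
    exact MeasurableSet.iUnion fun c => Base.measurableSet_cantorSet _
  rw [ae_iff, ← Set.compl_ofPred, prob_compl_eq_zero_iff hmeas]
  refine le_antisymm prob_le_one (le_of_forall_le_add_div 1 fun b hb => ?_)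
  have hb0 : (b : ℝ≥0∞) ≠ 0 := by exact_mod_cast (by omega : b ≠ 0)
  have hbt : (b : ℝ≥0∞) ≠ ∞ := ENNReal.natCast_ne_top b
  have hdef : ∀ {δ : Base V B}, δ.Closed → (deficit δ 1 b ∉ T ↔
      (b : ℝ≥0∞) ≤ 1 + b * hT.num (.pr δ)) := by
    intro δ hδ
    have hle : (b : ℝ≥0∞) ≤ 1 + b * hT.num (.pr δ) ↔
        Formula.ge (.add (.num 1) (.mul (.num b) (.pr δ))) (.mul (.num b) .one) ∈ T := by
      rw [← hT.num_le_num (by simp [hδ]) (by simp), hT.num_add (by simp) (by simp [hδ]),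
        hT.num_mul (by simp) (by simp), hT.num_mul (by simp) (by simp [hδ])]
      simp [num, toENNReal_natCast, toENNReal_one]
    rw [hle, deficit, hT.mem_gt (by simp) (by simp [hδ]), not_and_not_right]
    refine ⟨fun h => ?_, fun h _ => h⟩
    by_contra hc
    refine hc (h ?_)
    rw [← hT.num_le_num (by simp [hδ]) (by simp)] at hc
    rw [← hT.num_le_num (by simp) (by simp [hδ])]
    exact (not_le.1 hc).le
  have htriv : deficit (trivialBase {X} c₀) 1 b ∉ T := by
    rw [hdef (Base.closed_trivialBase _ _), num, hT.val_pr_congr (ε := .top)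
      (Base.closed_trivialBase _ _) (by simp) fun p => by simp [trivialBase, em]]
    change (b : ℝ≥0∞) ≤ 1 + b * toENNReal (hT.val .one)
    rw [hT.val_one, toENNReal_one, mul_one]
    exact le_add_self
  obtain ⟨n, -, hn⟩ : ∃ n : ℕ, 1 ≤ n ∧ deficit (coverBase {X} n) 1 b ∉ T := by
    by_contra! hc
    exact htriv (hT.unity le_rfl hb hc₀ hc)
  rw [hdef (Base.closed_coverBase _ _), ← hT.cantorMeasure_cantorSet (Base.closed_coverBase _ _)]
    at hn
  have hsub : (coverBase {X} n).cantorSet ⊆ {ω : Cantor V B | ∃ c, ω (X, c) = true} := by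
    intro ω hω
    simp only [Base.cantorSet, coverBase, Finset.toList_singleton, List.map_cons, List.map_nil,
      Base.eval_conj, List.mem_singleton, forall_eq, Base.eval_disj, List.mem_map,
      Set.mem_ofPred_eq] at hω
    obtain ⟨_, ⟨c, -, rfl⟩, hc⟩ := hω
    exact ⟨c, hc⟩
  have hle := hn.trans (add_le_add_right (mul_le_mul_right (measure_mono hsub) _) 1)
  rw [← ENNReal.mul_le_mul_iff_right hb0 hbt, mul_one, mul_add, add_comm, Nat.cast_one,
    ENNReal.mul_div_cancel hb0 hbt]
  exact hle

theorem ae_regular [Countable V] (c₀ : Cst B) (hc₀ : c₀.1 = 0) :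
    ∀ᵐ ω ∂hT.cantorMeasure, ω ∈ hT.regular := by
  refine ae_all_iff.2 fun X => (hT.ae_exists_atom c₀ hc₀ X).and ?_
  refine ae_all_iff.2 fun c => ae_all_iff.2 fun c' => ?_
  by_cases h : hT.cstSetoid X c c'
  · have h0 : hT.cantorMeasure (Base.and (.atom X (.const c))
        (.neg (.atom X (.const c')))).cantorSet = 0 := by
      rw [hT.cantorMeasure_cantorSet (by simp), num, hT.val_pr_atom_and_not_atom h,
        toENNReal_zero]
    filter_upwards [measure_eq_zero_iff_ae_notMem.1 h0] with ω hω hc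
    refine iff_of_true ?_ h
    by_contra hc'
    exact hω ⟨hc, hc'⟩
  · have h0 : hT.cantorMeasure (Base.and (.atom X (.const c))
        (.atom X (.const c'))).cantorSet = 0 := by
      rw [hT.cantorMeasure_cantorSet (by simp), num, hT.val_pr_atom_and_atom h,
        toENNReal_zero]
    filter_upwards [measure_eq_zero_iff_ae_notMem.1 h0] with ω hω hc
    exact iff_of_false (fun hc' => hω ⟨hc, hc'⟩) h

theorem measurableSet_regular [Countable V] : MeasurableSet hT.regular := by
  have hm : ∀ (X : V) (c : Cst B), MeasurableSet {ω : Cantor V B | ω (X, c) = true} :=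
    fun X c => (Base.atom X (.const c)).measurableSet_cantorSet
  have : hT.regular = ⋂ X, ((⋃ c, {ω : Cantor V B | ω (X, c) = true}) ∩
      ⋂ c, ⋂ c', {ω : Cantor V B | ω (X, c) = true → (ω (X, c') = true ↔
        hT.cstSetoid X c c')}) := by
    ext ω
    simp [regular]
  rw [this]
  refine MeasurableSet.iInter fun X => (MeasurableSet.iUnion fun c => hm X c).inter
    (MeasurableSet.iInter fun c => MeasurableSet.iInter fun c' => ?_)
  by_cases h : hT.cstSetoid X c c'
  · convert (hm X c).compl.union (hm X c') using 1
    ext ω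
    simp [h, imp_iff_not_or]
  · convert (hm X c).compl.union (hm X c').compl using 1
    ext ω
    simp [h, imp_iff_not_or]

end CompleteTheory

/-! ### The canonical model -/

namespace CompleteTheory

open ArchimedeanSemiring

variable {A : Set (Formula V B)} {fin : Prop} {T : Set (Formula V B)}
variable (hT : CompleteTheory A fin T)

/-- The range of `X` in the canonical model: the positive integers `i + 1` for representatives
`c_{i+1}` of the classes of constants. -/
def canonicalVal (X : V) : Set ℕ :=
  Set.range fun c : Cst B => (Quotient.mk (hT.cstSetoid X) c).out.1 + 1

/-- The interpretation of constants in the canonical model. -/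
noncomputable def canonicalConst (X : V) (c : Cst B) : hT.canonicalVal X :=
  ⟨(Quotient.mk (hT.cstSetoid X) c).out.1 + 1, c, rfl⟩

theorem canonicalConst_eq_iff {X : V} {c c' : Cst B} :
    hT.canonicalConst X c = hT.canonicalConst X c' ↔ hT.cstSetoid X c c' := by
  rw [Subtype.ext_iff]
  change (Quotient.mk (hT.cstSetoid X) c).out.1 + 1 = (Quotient.mk _ c').out.1 + 1 ↔ _
  rw [add_left_inj, Subtype.val_inj, Quotient.out_inj, Quotient.eq]

theorem canonicalConst_surjective (X : V) : Function.Surjective (hT.canonicalConst X) := by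
  rintro ⟨_, c, rfl⟩
  exact ⟨c, rfl⟩

open Classical in
/-- The value of `X` described by a truth assignment; arbitrary off the regular ones. -/
noncomputable def point (c₀ : Cst B) (ω : Cantor V B) (X : V) : hT.canonicalVal X :=
  if h : ω ∈ hT.regular then hT.canonicalConst X (h X).1.choose else hT.canonicalConst X c₀

theorem point_eq_iff (c₀ : Cst B) {ω : Cantor V B} (h : ω ∈ hT.regular) (X : V) (c : Cst B) :
    hT.point c₀ ω X = hT.canonicalConst X c ↔ ω (X, c) = true := by
  rw [point, dif_pos h, canonicalConst_eq_iff]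
  exact ((h X).2 _ c (h X).1.choose_spec).symm

theorem measurable_point [Countable V] (c₀ : Cst B) : Measurable (hT.point c₀) := by
  refine measurable_pi_iff.2 fun X => measurable_to_countable' fun x => ?_
  obtain ⟨c, rfl⟩ := hT.canonicalConst_surjective X x
  have h1 : MeasurableSet (hT.regular ∩ (Base.atom X (.const c)).cantorSet) :=
    hT.measurableSet_regular.inter (Base.measurableSet_cantorSet _)
  have h2 : (fun ω => hT.point c₀ ω X) ⁻¹' {hT.canonicalConst X c} ∩ hT.regular =
      hT.regular ∩ (Base.atom X (.const c)).cantorSet := by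
    ext ω
    simp only [Set.mem_inter_iff, Set.mem_preimage, Set.mem_singleton_iff]
    constructor
    · rintro ⟨h, hω⟩
      exact ⟨hω, (hT.point_eq_iff c₀ hω X c).1 h⟩
    · rintro ⟨hω, h⟩
      exact ⟨(hT.point_eq_iff c₀ hω X c).2 h, hω⟩
  have h3 : MeasurableSet
      ((fun ω => hT.point c₀ ω X) ⁻¹' {hT.canonicalConst X c} \ hT.regular) := by
    by_cases hc : hT.canonicalConst X c₀ = hT.canonicalConst X c
    · convert hT.measurableSet_regular.compl using 1
      ext ω
      by_cases hω : ω ∈ hT.regular <;> simp [point, hω, hc]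
    · convert MeasurableSet.empty using 1
      ext ω
      by_cases hω : ω ∈ hT.regular <;> simp [point, hω, hc]
  rw [← Set.inter_union_sdiff ((fun ω => hT.point c₀ ω X) ⁻¹' {hT.canonicalConst X c})
    hT.regular, h2]
  exact h1.union h3

/-- The structural causal model whose only exogenous variable is a random truth assignment, from
which the structural functions read off the values of the endogenous variables independently. -/
noncomputable def canonicalSCM (c₀ : Cst B) : SCM V where
  Val := hT.canonicalVal
  val_pos := by
    rintro X _ ⟨c, rfl⟩
    exact Nat.succ_pos _
  U := PUnit
  UVal _ := Cantor V B
  mU := MeasurableSpace.pi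
  P := hT.cantorMeasure.map fun ω _ => ω
  isProb := Measure.isProbabilityMeasure_map
    (measurable_pi_lambda _ fun _ => measurable_id).aemeasurable
  f X _ e := hT.point c₀ (e PUnit.unit) X

theorem event_intervene_canonicalSCM (c₀ : Cst B) (S : Finset V)
    (x : ∀ Y, (hT.canonicalSCM c₀).Val Y) (E : Set (∀ Y, (hT.canonicalSCM c₀).Val Y)) :
    ((hT.canonicalSCM c₀).intervene S x).event E = (fun e : PUnit → Cantor V B =>
      (open Classical in fun X => if X ∈ S then x X else hT.point c₀ (e PUnit.unit) X)) ⁻¹' E := by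
  ext e
  constructor
  · rintro ⟨v, hv, hE⟩
    have : v = _ := funext hv
    rw [this] at hE
    exact hE
  · intro hE
    exact ⟨_, fun X => rfl, hE⟩

variable [Countable V]

theorem isMeasurable_canonicalSCM (c₀ : Cst B) : (hT.canonicalSCM c₀).IsMeasurable := by
  classical
  intro S x E hE
  rw [event_intervene_canonicalSCM]
  have h : Measurable fun (e : PUnit.{u + 1} → Cantor V B) (X : V) =>
      if X ∈ S then (x X : hT.canonicalVal X) else hT.point c₀ (e PUnit.unit) X := by
    refine measurable_pi_iff.2 fun X => ?_
    by_cases hX : X ∈ S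
    · simp only [hX]
      exact measurable_const
    · simp only [hX]
      exact (measurable_pi_iff.1 (hT.measurable_point c₀) X).comp (measurable_pi_apply _)
  exact h hE

/-- The canonical model of a complete theory. -/
noncomputable def canonicalModel (c₀ : Cst B) : Model V B where
  toSCM := hT.canonicalSCM c₀
  recursive := ⟨WellOrderingRel, WellOrderingRel.isWellOrder, fun _ _ _ _ _ => rfl⟩
  measurable := hT.isMeasurable_canonicalSCM c₀
  const := hT.canonicalConst
  closedWorld := hT.canonicalConst_surjective

variable {c₀ : Cst B}

theorem prob_canonicalModel {E : Set (∀ Y, (hT.canonicalModel c₀).Val Y)} (hE : MeasurableSet E) :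
    (hT.canonicalModel c₀).prob E = hT.cantorMeasure (hT.point c₀ ⁻¹' E) := by
  have h : (hT.canonicalModel c₀).event E =
      (fun e : PUnit → Cantor V B => hT.point c₀ (e PUnit.unit)) ⁻¹' E := by
    rw [← SCM.event_intervene_empty _ (fun X => hT.canonicalConst X c₀)]
    exact (hT.event_intervene_canonicalSCM c₀ ∅ _ E).trans (by simp; rfl)
  rw [SCM.prob, h]
  exact Measure.map_apply (measurable_pi_lambda _ fun _ => measurable_id)
    (((hT.measurable_point c₀).comp (measurable_pi_apply PUnit.unit)) hE)

variable (hc₀ : c₀.1 = 0)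
include hc₀

theorem base_prob_canonicalModel (ι : (hT.canonicalModel c₀).Asg) {δ : Base V B} (hδ : δ.Closed) :
    δ.prob (hT.canonicalModel c₀) ι = hT.num (.pr δ) := by
  have : Nonempty (Cst B) := ⟨c₀⟩
  rw [Base.prob, hT.prob_canonicalModel (δ.measurableSet_holds ι),
    ← hT.cantorMeasure_cantorSet hδ]
  refine measure_congr ?_
  filter_upwards [hT.ae_regular c₀ hc₀] with ω hω
  exact propext (Base.eval_congr_of_closed hδ fun X c => hT.point_eq_iff c₀ hω X c)

theorem canonicalModel_positive : (hT.canonicalModel c₀).toSCM.Positive := by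
  intro S hS hfin
  choose x hx using hS
  choose c hc using fun X => hT.canonicalConst_surjective X (x X)
  let κ : Cond V B := ⟨hfin.toFinset.toList.map fun X => ⟨X, .const (c X), true⟩, by
    simpa [List.map_map, Function.comp_def] using hfin.toFinset.nodup_toList⟩
  have hκ : κ.Closed := by
    rintro X i ⟨l, hl, -, h⟩
    obtain ⟨Y, -, rfl⟩ := List.mem_map.1 hl
    cases h
  have ι : (hT.canonicalModel c₀).Asg := fun X _ => hT.canonicalConst X c₀
  have h0 : κ.toBase.prob (hT.canonicalModel c₀) ι ≠ 0 := by
    rw [hT.base_prob_canonicalModel hc₀ ι (Cond.closed_toBase hκ)]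
    exact toENNReal_ne_zero (hT.val_pr_cond_ne_zero hκ)
  intro h
  refine h0 (measure_mono_null ?_ h)
  rintro e ⟨v, hv, hE⟩
  refine ⟨v, hv, fun X => ?_⟩
  by_cases hX : S X = Set.univ
  · rw [hX]
    trivial
  · have h1 : (Lit.toBase ⟨X, .const (c X), true⟩ : Base V B).Eval
        (fun X d => v X = d.den (hT.canonicalModel c₀) ι X) := by
      refine (Base.eval_conj _ _).1 hE _ (List.mem_map_of_mem (List.mem_map_of_mem ?_))
      rw [Finset.mem_toList, Set.Finite.mem_toFinset]
      exact hX
    have h2 : v X = hT.canonicalConst X (c X) := h1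
    rw [h2, hc]
    exact hx X

theorem canonicalModel_mem_posModels : hT.canonicalModel c₀ ∈ PosModels V B := by
  refine ⟨hT.canonicalModel_positive hc₀, fun X => ?_⟩
  -- The event that `X` differs from the first constant has positive probability.
  let κ : Cond V B := ⟨[⟨X, .const c₀, false⟩], by simp⟩
  have hκ : κ.Closed := by
    rintro Y i ⟨l, hl, -, h⟩
    rw [List.mem_singleton.1 hl] at h
    cases h
  have ι : (hT.canonicalModel c₀).Asg := fun X _ => hT.canonicalConst X c₀
  have h0 : κ.toBase.prob (hT.canonicalModel c₀) ι ≠ 0 := by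
    rw [hT.base_prob_canonicalModel hc₀ ι (Cond.closed_toBase hκ)]
    exact toENNReal_ne_zero (hT.val_pr_cond_ne_zero hκ)
  by_contra hX
  have : Nonempty (Cst B) := ⟨c₀⟩
  refine h0 (Base.prob_eq_zero fun v hv => ?_)
  have h1 : ¬ v X = hT.canonicalConst X c₀ := hv.1
  rw [Set.not_nontrivial_iff] at hX
  exact h1 (Subtype.ext (hX (v X).2 (hT.canonicalConst X c₀).2))

/-! ### The truth lemma -/

theorem value_canonicalModel (t : Term V B) (ht : t.Closed) (ι : (hT.canonicalModel c₀).Asg) :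
    t.value (hT.canonicalModel c₀) ι = hT.num t := by
  have : Nonempty (Cst B) := ⟨c₀⟩
  induction hn : t.rank using Nat.strong_induction_on generalizing t ι with
  | _ n ih =>
    subst hn
    cases t with
    | prob δ κ =>
      obtain ⟨hδ, hκ⟩ := Term.closed_prob.1 ht
      have hκ' := Cond.closed_toBase hκ
      rw [hT.num_prob hδ hκ, Term.value, hT.base_prob_canonicalModel hc₀ ι hκ',
        hT.base_prob_canonicalModel hc₀ ι (by simp [hδ, hκ'])]
    | sum X i t =>
      classical
      choose g hg using hT.canonicalConst_surjective X
      have hgi : Function.Injective g := fun x y h => by rw [← hg x, ← hg y, h]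
      have hval : ∀ c, t.value (hT.canonicalModel c₀) (ι.upd X i (hT.canonicalConst X c)) =
          hT.num (t.substC X i c) := fun c => by
        rw [← ih t.rank (by simp [Term.rank]) (t.substC X i c) (ht.substC c) ι (by simp)]
        exact (Term.value_substC X i c t ι).symm
      have hval' : ∀ x, t.value (hT.canonicalModel c₀) (ι.upd X i x) =
          hT.num (t.substC X i (g x)) := fun x =>
        (congrArg (fun y => t.value (hT.canonicalModel c₀) (ι.upd X i y)) (hg x)).symm.trans
          (hval (g x))
      have htsum : (Term.sum X i t).value (hT.canonicalModel c₀) ι =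
          ∑' x : hT.canonicalVal X, hT.num (t.substC X i (g x)) := tsum_congr hval'
      rw [htsum, hT.num_sum_eq_iSup ht, ENNReal.tsum_eq_iSup_sum]
      apply le_antisymm
      · refine iSup_le fun F => le_iSup₂_of_le (F.image g) ?_ ?_
        · intro c hc c' hc' h
          obtain ⟨x, -, rfl⟩ := Finset.mem_image.1 hc
          obtain ⟨y, -, rfl⟩ := Finset.mem_image.1 hc'
          rw [← hT.canonicalConst_eq_iff, hg, hg] at h
          rw [h]
        · rw [Finset.sum_image hgi.injOn]
      · refine iSup₂_le fun F hF => le_iSup_of_le (F.image (hT.canonicalConst X)) ?_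
        rw [Finset.sum_image fun c hc c' hc' h => hF c hc c' hc' (hT.canonicalConst_eq_iff.1 h)]
        refine Finset.sum_le_sum fun c _ => le_of_eq ?_
        rw [← hval, ← hval, hg]
    | add t s =>
      obtain ⟨h1, h2⟩ := Term.closed_add.1 ht
      rw [hT.num_add h1 h2, ← ih t.rank (by simp [Term.rank]) t h1 ι rfl,
        ← ih s.rank (by simp [Term.rank]) s h2 ι rfl]
      rfl
    | mul t s =>
      obtain ⟨h1, h2⟩ := Term.closed_mul.1 ht
      rw [hT.num_mul h1 h2, ← ih t.rank (by simp [Term.rank]) t h1 ι rfl,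
        ← ih s.rank (by simp [Term.rank]) s h2 ι rfl]
      rfl

/-- The canonical model satisfies exactly the formulas of the theory. -/
theorem sat_canonicalModel_iff (φ : Formula V B) (hφ : φ.Closed)
    (ι : (hT.canonicalModel c₀).Asg) : φ.Sat (hT.canonicalModel c₀) ι ↔ φ ∈ T := by
  have : Nonempty (Cst B) := ⟨c₀⟩
  induction φ with
  | eq X d d' =>
    cases d with
    | var i => exact absurd ⟨rfl, Or.inl rfl⟩ (hφ X i)
    | const c =>
      cases d' with
      | var i => exact absurd ⟨rfl, Or.inr rfl⟩ (hφ X i)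
      | const c' => exact hT.canonicalConst_eq_iff
  | ge t s =>
    obtain ⟨ht, hs⟩ := Formula.closed_ge.1 hφ
    rw [Formula.sat_ge ι (hT.canonicalModel_mem_posModels hc₀), hT.value_canonicalModel hc₀ t ht,
      hT.value_canonicalModel hc₀ s hs, hT.num_le_num ht hs]
  | neg φ ih => exact (not_congr (ih hφ)).trans (hT.neg_iff (φ := φ) hφ).symm
  | and φ ψ ih ih' =>
    obtain ⟨h1, h2⟩ := Formula.closed_and.1 hφ
    exact (and_congr (ih h1) (ih' h2)).trans (hT.and_iff h1 h2).symm

theorem encard_canonicalVal (X : V) (i : ℕ) :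
    ((hT.canonicalModel c₀).Val X).encard = hT.num (.sum X i .one) := by
  have : Nonempty (Cst B) := ⟨c₀⟩
  let ι : (hT.canonicalModel c₀).Asg := fun X _ => hT.canonicalConst X c₀
  rw [← hT.value_canonicalModel hc₀ _ (Term.closed_sum_of_closed Term.closed_one) ι]
  simp only [Term.value, Term.value_one]
  rw [ENNReal.tsum_const, mul_one, ENat.card_coe_set_eq]

theorem canonicalModel_mem_posModelsFin (hf : fin) : hT.canonicalModel c₀ ∈ PosModelsFin V B := by
  refine ⟨hT.canonicalModel_mem_posModels hc₀, fun X => ?_⟩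
  have hcl : (Term.sum X 0 (.one : Term V B)).Closed := Term.closed_sum_of_closed Term.closed_one
  have h1 : Formula.gt .zero (.sum X 0 .one) ∉ T := by
    rw [hT.mem_gt (by simp) hcl, not_and_not_right]
    exact fun _ => hT.poly (.nonNeg _) (Formula.closed_ge.2 ⟨hcl, by simp⟩)
  obtain ⟨n, -, hn⟩ : ∃ n : ℕ, 1 ≤ n ∧ Formula.ge (.sum X 0 .one) (.num n) ∉ T := by
    by_contra! hc
    exact h1 (hT.finite hf X 0 hc)
  rw [← hT.num_le_num hcl (by simp), ← hT.encard_canonicalVal hc₀, not_le, num, hT.val_num,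
    toENNReal_natCast] at hn
  rw [← Set.encard_ne_top_iff]
  intro h
  rw [h] at hn
  exact not_top_lt hn

theorem canonicalModel_mem_posModelsCard {N : ℕ} (hA : ∀ φ, AxCard N φ → φ ∈ A) :
    hT.canonicalModel c₀ ∈ PosModelsCard V B N := by
  refine ⟨hT.canonicalModel_mem_posModels hc₀, fun X => ?_⟩
  have hcl : (Term.sum X 0 (.one : Term V B)).Closed := Term.closed_sum_of_closed Term.closed_one
  have h1 := hT.val_eq_of_approx hcl (by simp)
    (hT.extra (hA _ (AxCard.mk X 0)) (Formula.closed_approx.2 ⟨hcl, Term.closed_num N⟩))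
  have h2 := hT.encard_canonicalVal hc₀ X 0
  rw [num, h1, hT.val_num, toENNReal_natCast] at h2
  exact_mod_cast h2

end CompleteTheory

/-! ### Completeness -/

/-- Completeness for closed formulas, over any class of models that contains the canonical ones. -/
theorem deriv_of_entails_closed [Countable V] {A : Set (Formula V B)} {fin : Prop}
    {c₀ : Cst B} (hc₀ : c₀.1 = 0) {𝓜 : Set (Model V B)}
    (h𝓜 : ∀ {T : Set (Formula V B)} (hT : CompleteTheory A fin T), hT.canonicalModel c₀ ∈ 𝓜)
    {Γ : Set (Formula V B)} (hΓ : Γ ⊆ ClosedLang V B) {φ : Formula V B} (hφ : φ.Closed)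
    (h : Entails 𝓜 Γ φ) : Deriv (ClosedLang V B) A fin False Γ φ := by
  by_contra hnot
  obtain ⟨T, hT, hΓT, hφT⟩ := exists_completeTheory hΓ hφ hnot
  have hval := h (hT.canonicalModel c₀) (h𝓜 hT) fun γ hγ ι =>
    (hT.sat_canonicalModel_iff hc₀ γ (hΓ hγ) ι).2 (hΓT hγ)
  exact hφT ((hT.sat_canonicalModel_iff hc₀ φ hφ fun X _ => hT.canonicalConst X c₀).1 (hval _))

/-- `ψ` arises from `φ` by substituting constants for range variables. -/
inductive IsInstance (φ : Formula V B) : Formula V B → Prop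
  | refl : IsInstance φ φ
  | step {ψ : Formula V B} (X : V) (i : ℕ) (c : Cst B) (h : IsInstance φ ψ) :
      IsInstance φ (ψ.substC X i c)

theorem IsInstance.head {φ ψ : Formula V B} {X : V} {i : ℕ} {c : Cst B}
    (h : IsInstance (φ.substC X i c) ψ) : IsInstance φ ψ := by
  induction h with
  | refl => exact .step X i c .refl
  | step Y j d _ ih => exact .step Y j d ih

theorem Base.exists_free_list (δ : Base V B) :
    ∃ l : List (V × ℕ), ∀ X i, δ.Free X i → (X, i) ∈ l := by
  induction δ with
  | top => exact ⟨[], fun _ _ h => h.elim⟩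
  | atom Y d =>
    cases d with
    | const c => exact ⟨[], fun _ _ h => by cases h.2⟩
    | var j =>
      refine ⟨[(Y, j)], fun X i h => ?_⟩
      obtain ⟨rfl, h⟩ := h
      simpa using h.symm
  | neg δ ih => exact ih
  | and δ ε ih ih' =>
    obtain ⟨l, hl⟩ := ih
    obtain ⟨l', hl'⟩ := ih'
    exact ⟨l ++ l', fun X i h => List.mem_append.2 (h.imp (hl X i) (hl' X i))⟩

theorem Cond.exists_free_list (κ : Cond V B) :
    ∃ l : List (V × ℕ), ∀ X i, κ.Free X i → (X, i) ∈ l := by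
  refine ⟨κ.lits.map fun l => (l.rv, match l.sym with | .const _ => 0 | .var i => i), ?_⟩
  rintro X i ⟨l, hl, rfl, h⟩
  exact List.mem_map.2 ⟨l, hl, by rw [h]⟩

theorem Term.exists_free_list (t : Term V B) :
    ∃ l : List (V × ℕ), ∀ X i, t.Free X i → (X, i) ∈ l := by
  induction t with
  | prob δ κ =>
    obtain ⟨l, hl⟩ := δ.exists_free_list
    obtain ⟨l', hl'⟩ := κ.exists_free_list
    exact ⟨l ++ l', fun X i h => List.mem_append.2 (h.imp (hl X i) (hl' X i))⟩
  | sum Y j t ih =>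
    obtain ⟨l, hl⟩ := ih
    exact ⟨l, fun X i h => hl X i h.1⟩
  | add t s ih ih' =>
    obtain ⟨l, hl⟩ := ih
    obtain ⟨l', hl'⟩ := ih'
    exact ⟨l ++ l', fun X i h => List.mem_append.2 (h.imp (hl X i) (hl' X i))⟩
  | mul t s ih ih' =>
    obtain ⟨l, hl⟩ := ih
    obtain ⟨l', hl'⟩ := ih'
    exact ⟨l ++ l', fun X i h => List.mem_append.2 (h.imp (hl X i) (hl' X i))⟩

theorem Formula.exists_free_list (φ : Formula V B) :
    ∃ l : List (V × ℕ), ∀ X i, φ.Free X i → (X, i) ∈ l := by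
  induction φ with
  | eq Y d d' =>
    obtain ⟨l, hl⟩ := (Base.atom Y d).exists_free_list
    obtain ⟨l', hl'⟩ := (Base.atom Y d').exists_free_list
    refine ⟨l ++ l', fun X i h => List.mem_append.2 ?_⟩
    exact h.2.imp (fun h' => hl X i ⟨h.1, h'⟩) fun h' => hl' X i ⟨h.1, h'⟩
  | ge t s =>
    obtain ⟨l, hl⟩ := t.exists_free_list
    obtain ⟨l', hl'⟩ := s.exists_free_list
    exact ⟨l ++ l', fun X i h => List.mem_append.2 (h.imp (hl X i) (hl' X i))⟩
  | neg φ ih => exact ih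
  | and φ ψ ih ih' =>
    obtain ⟨l, hl⟩ := ih
    obtain ⟨l', hl'⟩ := ih'
    exact ⟨l ++ l', fun X i h => List.mem_append.2 (h.imp (hl X i) (hl' X i))⟩

/-- A property that passes from all instances by a range variable to the formula itself holds of
a formula if it holds of its closed instances. -/
theorem of_closed_instances {P : Formula V B → Prop}
    (hP : ∀ φ X i, (∀ c, P (Formula.substC X i c φ)) → P φ) (φ : Formula V B)
    (h : ∀ ψ, IsInstance φ ψ → ψ.Closed → P ψ) : P φ := by
  obtain ⟨l, hl⟩ := φ.exists_free_list
  induction l generalizing φ with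
  | nil => exact h φ .refl fun X i hX => by simpa using hl X i hX
  | cons a l ih =>
    refine hP φ a.1 a.2 fun c => ih _ (fun ψ hψ => h ψ hψ.head) fun X i hX => ?_
    obtain ⟨h1, h2⟩ := Formula.free_of_free_substC hX
    rcases List.mem_cons.1 (hl X i h1) with rfl | h3
    · exact absurd ⟨rfl, rfl⟩ h2
    · exact h3

theorem Deriv.of_isInstance {L A : Set (Formula V B)} {fin free : Prop} {Γ : Set (Formula V B)}
    (hfree : free) {φ ψ : Formula V B} (h : IsInstance φ ψ) (hφ : Deriv L A fin free Γ φ) :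
    Deriv L A fin free Γ ψ := by
  induction h with
  | refl => exact hφ
  | step X i c _ ih => exact .freeElim hfree _ X i c ih

/-- Derivations in a smaller system, from derivable premises, are derivations. -/
theorem Deriv.mono {L L' A : Set (Formula V B)} {fin free free' : Prop} {Γ Γ' : Set (Formula V B)}
    (hL : L ⊆ L') (hfree : free → free') (hΓ : ∀ γ ∈ Γ, Deriv L' A fin free' Γ' γ)
    {φ : Formula V B} (h : Deriv L A fin free Γ φ) : Deriv L' A fin free' Γ' φ := by
  induction h with
  | hyp φ h => exact hΓ φ h
  | ax φ h h' => exact .ax φ h (hL h')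
  | extra φ h h' => exact .extra φ h (hL h')
  | mp φ ψ _ _ ih ih' => exact .mp φ ψ ih ih'
  | conv φ t s h _ ih => exact .conv φ t s (hL h) ih
  | unity φ S a b ha hb c hc h _ ih => exact .unity φ S a b ha hb c hc (hL h) ih
  | sumUpper φ X i t q s r h _ ih => exact .sumUpper φ X i t q s r (hL h) ih
  | finite hf φ X i h _ ih => exact .finite hf φ X i (hL h) ih
  | freeElim hf φ X i c _ ih => exact .freeElim (hfree hf) φ X i c ih
  | freeIntro hf φ X i _ ih => exact .freeIntro (hfree hf) φ X i ih

/-- Completeness for formulas with free variables, by passing to closed instances. -/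
theorem deriv_of_entails [Countable V] {A : Set (Formula V B)} {fin : Prop}
    {c₀ : Cst B} (hc₀ : c₀.1 = 0) {𝓜 : Set (Model V B)} (hpos : 𝓜 ⊆ PosModels V B)
    (h𝓜 : ∀ {T : Set (Formula V B)} (hT : CompleteTheory A fin T), hT.canonicalModel c₀ ∈ 𝓜)
    {Γ : Set (Formula V B)} {φ : Formula V B}
    (h : Entails 𝓜 Γ φ) : Deriv (FullLang V B) A fin True Γ φ := by
  have : Nonempty (Cst B) := ⟨c₀⟩
  let Δ : Set (Formula V B) := {ψ | ψ.Closed ∧ ∃ γ ∈ Γ, IsInstance γ ψ}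
  refine of_closed_instances (fun φ X i => Deriv.freeIntro trivial φ X i) φ fun ψ hψ hc => ?_
  have hent : Entails 𝓜 Δ ψ := by
    intro M hM hΔ
    have hφ : φ.ValidIn M := h M hM fun γ hγ =>
      of_closed_instances (P := fun ψ => ψ.ValidIn M)
        (fun φ X i => (Formula.validIn_substC_iff (hpos hM) X i φ).1) γ
        fun ψ hψ hc => hΔ ψ ⟨hc, γ, hγ, hψ⟩
    clear hc
    induction hψ with
    | refl => exact hφ
    | step X i c _ ih => exact (Formula.validIn_substC_iff (hpos hM) X i _).2 ih c
  refine (deriv_of_entails_closed hc₀ h𝓜 (fun ψ h => h.1) hc hent).mono (Set.subset_univ _)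
    False.elim ?_
  rintro γ ⟨-, δ, hδ, hγ⟩
  exact Deriv.of_isInstance trivial hγ (.hyp δ hδ)

end ProbSum

theorem theorem5 {V : Type u} [Countable V] :
    (ProbSum.Sound ProbSum.AXclosed (ProbSum.ClosedLang V ⊤) (ProbSum.PosModels V ⊤) ∧
      ProbSum.StronglyComplete ProbSum.AXclosed (ProbSum.ClosedLang V ⊤)
        (ProbSum.PosModels V ⊤)) ∧
    (ProbSum.Sound ProbSum.AXclosedFin (ProbSum.ClosedLang V ⊤) (ProbSum.PosModelsFin V ⊤) ∧
      ProbSum.StronglyComplete ProbSum.AXclosedFin (ProbSum.ClosedLang V ⊤)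
        (ProbSum.PosModelsFin V ⊤)) ∧
    (∀ N : ℕ, 2 ≤ N →
      ProbSum.Sound (ProbSum.AXclosedCard N) (ProbSum.ClosedLang V N)
        (ProbSum.PosModelsCard V N N) ∧
      ProbSum.StronglyComplete (ProbSum.AXclosedCard N) (ProbSum.ClosedLang V N)
        (ProbSum.PosModelsCard V N N)) ∧
    (ProbSum.Sound ProbSum.AX (ProbSum.FullLang V ⊤) (ProbSum.PosModels V ⊤) ∧
      ProbSum.StronglyComplete ProbSum.AX (ProbSum.FullLang V ⊤) (ProbSum.PosModels V ⊤)) ∧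
    (ProbSum.Sound ProbSum.AXFin (ProbSum.FullLang V ⊤) (ProbSum.PosModelsFin V ⊤) ∧
      ProbSum.StronglyComplete ProbSum.AXFin (ProbSum.FullLang V ⊤)
        (ProbSum.PosModelsFin V ⊤)) ∧
    (∀ N : ℕ, 2 ≤ N →
      ProbSum.Sound (ProbSum.AXCard N) (ProbSum.FullLang V N) (ProbSum.PosModelsCard V N N) ∧
      ProbSum.StronglyComplete (ProbSum.AXCard N) (ProbSum.FullLang V N)
        (ProbSum.PosModelsCard V N N)) := by
  let c₀ : ProbSum.Cst ⊤ := ⟨0, ENat.natCast_lt_top 0⟩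
  have : Nonempty (ProbSum.Cst ⊤) := ⟨c₀⟩
  refine ⟨⟨?_, ?_⟩, ⟨?_, ?_⟩, fun N hN => ?_, ⟨?_, ?_⟩, ⟨?_, ?_⟩, fun N hN => ?_⟩
  · exact fun Γ _ φ _ h M hM hΓ => h.validIn hM (fun _ h => h.elim) False.elim hΓ
  · exact fun Γ hΓ φ hφ h => ProbSum.deriv_of_entails_closed (c₀ := c₀) rfl
      (fun hT => hT.canonicalModel_mem_posModels rfl) hΓ hφ h
  · exact fun Γ _ φ _ h M hM hΓ => h.validIn hM.1 (fun _ h => h.elim) (fun _ => hM.2) hΓ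
  · exact fun Γ hΓ φ hφ h => ProbSum.deriv_of_entails_closed (c₀ := c₀) rfl
      (fun hT => hT.canonicalModel_mem_posModelsFin rfl trivial) hΓ hφ h
  · let c : ProbSum.Cst N := ⟨0, by exact_mod_cast (by omega : 0 < N)⟩
    have : Nonempty (ProbSum.Cst N) := ⟨c⟩
    exact ⟨fun Γ _ φ _ h M hM hΓ => h.validIn hM.1 (fun _ h => ProbSum.AxCard.validIn hM.1 hM.2 h)
      False.elim hΓ, fun Γ hΓ φ hφ h => ProbSum.deriv_of_entails_closed (c₀ := c) rfl
      (fun hT => hT.canonicalModel_mem_posModelsCard rfl fun _ => id) hΓ hφ h⟩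
  · exact fun Γ _ φ _ h M hM hΓ => h.validIn hM (fun _ h => h.elim) False.elim hΓ
  · exact fun Γ _ φ _ h => ProbSum.deriv_of_entails (c₀ := c₀) rfl subset_rfl
      (fun hT => hT.canonicalModel_mem_posModels rfl) h
  · exact fun Γ _ φ _ h M hM hΓ => h.validIn hM.1 (fun _ h => h.elim) (fun _ => hM.2) hΓ
  · exact fun Γ _ φ _ h => ProbSum.deriv_of_entails (c₀ := c₀) rfl (fun _ h => h.1)
      (fun hT => hT.canonicalModel_mem_posModelsFin rfl trivial) h
  · let c : ProbSum.Cst N := ⟨0, by exact_mod_cast (by omega : 0 < N)⟩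
    have : Nonempty (ProbSum.Cst N) := ⟨c⟩
    exact ⟨fun Γ _ φ _ h M hM hΓ => h.validIn hM.1 (fun _ h => ProbSum.AxCard.validIn hM.1 hM.2 h)
      False.elim hΓ, fun Γ _ φ _ h => ProbSum.deriv_of_entails (c₀ := c) rfl (fun _ h => h.1)
      (fun hT => hT.canonicalModel_mem_posModelsCard rfl fun _ => id) h⟩
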